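/- Let $K$ be a field and let $A$ be a $K$-vector space with the structure of one of the following five types of Loday algebras (all operations bilinear, all identities for all $x,y,z\in A$): 1. a *dialgebra*: operations $\dashv,\vdash$ with $(x\dashv y)\dashv z=x\dashv(y\dashv z)=x\dashv(y\vdash z)$, $(x\vdash y)\dashv z=x\vdash(y\dashv z)$, $(x\dashv y)\vdash z=x\vdash(y\vdash z)=(x\vdash y)\vdash z$; 2. a *dendriform dialgebra*: operations $\prec,\succ$ with $(x\prec y)\prec z=x\prec(y\prec z+y\succ z)$, $(x\succ y)\prec z=x\succ(y\prec z)$, $(x\prec y+x\succ y)\succ z=x\succ(y\succ z)$; 3. an *associative trialgebra*: operations $\dashv,\vdash,\perp$ such that $\dashv,\vdash$ satisfy the identities in 1, $\perp$ is associative, and $(x\dashv y)\dashv z=x\dashv(y\perp z)$, $(x\perp y)\dashv z=x\perp(y\dashv z)$, $(x\dashv y)\perp z=x\perp(y\vdash z)$, $(x\vdash y)\perp z=x\vdash(y\perp z)$, $(x\perp y)\vdash z=x\vdash(y\vdash z)$; 4. a *dendriform trialgebra*: operations $\prec,\succ,\cdot$ such that, with $x*y=x\prec y+x\cdot y+x\succ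 y$, $(x\prec y)\prec z=x\prec(y*z)$, $(x\succ y)\prec z=x\succ(y\prec z)$, $(x*y)\succ z=x\succ(y\succ z)$, $(x\succ y)\cdot z=x\succ(y\cdot z)$, $(x\prec y)\cdot z=x\cdot(y\succ z)$, $(x\cdot y)\prec z=x\cdot(y\prec z)$, $(x\cdot y)\cdot z=x\cdot(y\cdot z)$; 5. a *cubical trialgebra*: operations $\dashv,\vdash,\perp$ with $(x\circ_1y)\circ_2z=x\circ_1(y\circ_2z)$ for all $\circ_1,\circ_2\in\{\dashv,\vdash,\perp\}$. For $n\ge1$ put $C^n(A,A)=\mathrm{Hom}_K(K[U_n]\otimes A^{\otimes n},A)$, where the sets $U_n$ and, for $k,n_1,\dots,n_k\ge1$, $N_i=n_1+\dots+n_i$, $N=N_k$, the functions $R_0:U_N\to U_k$ and $R_j:U_N\to U_{n_j}$ ($1\le j\le k$), and the cochain $\pi\in C^2(A,A)$ are as follows. - Types 1 and 3: $U_n$ is the set of planar rooted trees with leaves $0,\dots,n$ (numbered from left to right) in which every internal vertex has exactly two inputs (type 1), respectively at least two inputs (type 3). $R_0$ keeps the leaves $N_0=0,N_1,\dots,N_k$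 and deletes all others; $R_j$ keeps the leaves $N_{j-1},N_{j-1}+1,\dots,N_j$ and deletes all others (vertices left with one input are suppressed, remaining leaves are renumbered). $\pi(\psi;x,y)$ is $x\dashv y$ if $\psi$ is the grafting of the leaf $0$ with a tree with leaves $1,2$; it is $x\vdash y$ if $\psi$ is the grafting of a tree with leaves $0,1$ with the leaf $2$; and (type 3) it is $x\perp y$ if $\psi$ has a single internal vertex. - Type 2: $U_n=\{1,\dots,n\}$; $R_0(r)=i$ if $N_{i-1}<r\le N_i$; $R_j(r)$ is $1$ if $r\le N_{j-1}$, $r-N_{j-1}$ if $N_{j-1}<r\le N_j$, and $n_j$ if $r>N_j$. $\pi(r;x,y)=x\prec y+x\succ y$. - Type 4: $U_n$ is the set of non-empty subsets of $\{1,\dots,n\}$, and $R_0,R_j$ send a subset to its image under the functions $R_0,R_j$ of type 2. $\pi(X;x,y)=x\prec y+x\cdot y+x\succ y$. - Type 5: $U_n=\{-1,0,1\}^n$; $(R_0X)_i=\prod_{t=1}^{n_i}X_{N_{i-1}+t}$ and $(R_jX)_l=X_{N_{j-1}+l}$. $\pi(X;x,y)=x\dashv y+x\perp y+x\vdash y$.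 Put $\mathrm{Id}(r;x)=x$ and, for $f\in C^k$, $g_i\in C^{n_i}$, $r\in U_N$, $$\gamma(f;g_1,\dots,g_k)(r;x_1,\dots,x_N)=f\bigl(R_0(r);\,g_1(R_1(r);x_1,\dots,x_{N_1}),\dots,g_k(R_k(r);x_{N_{k-1}+1},\dots,x_N)\bigr).$$ Write $|x|=\deg x-1$ and $x\{y_1,\dots,y_s\}=\sum(-1)^{\varepsilon}\gamma(x;\mathrm{Id},\dots,y_1,\dots,y_s,\dots,\mathrm{Id})$, summed over all insertions of $y_1,\dots,y_s$ in this order, with $\varepsilon=\sum_a|y_a|\,i_a$, $i_a$ being the total number of inputs in front of $y_a$. Put $$x\circ y=x\{y\},\quad [x,y]=x\circ y-(-1)^{|x||y|}y\circ x,\quad x\cdot y=(-1)^{\deg x}\pi\{x,y\},\quad dx=[\pi,x].$$ Then, for each of the five types, the functions $R$ form a pre-operadic system on $(U_n)_{n\ge1}$, that is, for all $k,n_1,\dots,n_k,m_1,\dots,m_N\ge1$, $1\le i\le k$, $1\le j\le n_i$, with $M_l=m_1+\dots+m_l$ and $T_i=M_{N_i}-M_{N_{i-1}}$: $R_0(k;1,\dots,1)=\mathrm{id}$;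 $R_0(k;n_1,\dots,n_k)R_0(N;m_1,\dots,m_N)=R_0(k;T_1,\dots,T_k)$; $R_i(k;n_1,\dots,n_k)R_0(N;m_1,\dots,m_N)=R_0(n_i;m_{N_{i-1}+1},\dots,m_{N_i})R_i(k;T_1,\dots,T_k)$; $R_{N_{i-1}+j}(N;m_1,\dots,m_N)=R_j(n_i;m_{N_{i-1}+1},\dots,m_{N_i})R_i(k;T_1,\dots,T_k)$. Moreover $\pi$ is a multiplication, $\pi\circ\pi=0$; one has $d\circ d=0$; the dot product and the bracket of two cocycles are cocycles; and they induce well-defined operations $[x]\cdot[y]=[x\cdot y]$, $[[x],[y]]=[[x,y]]$ on the cohomology $H^*(A,A)=\bigoplus_{n\ge1}H^n(C^*(A,A),d)$ (with no coboundaries in degree $1$), which make $H^*(A,A)$ a Gerstenhaber algebra over $K$: the dot product is bilinear of degree $0$, associative and satisfies $x\cdot y=(-1)^{\deg x\deg y}y\cdot x$; the bracket is bilinear of degree $-1$ and is a graded Lie bracket, $[x,y]=-(-1)^{|x||y|}[y,x]$, $[x,[y,z]]=[[x,y],z]+(-1)^{|x||y|}[y,[x,z]]$, $[x,x]=0$ for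 $|x|$ even, $[x,[x,x]]=0$ for $|x|$ odd; and $[x,y\cdot z]=[x,y]\cdot z+(-1)^{|x|\deg y}y\cdot[x,z]$. -/

import Mathlib

open scoped TensorProduct

noncomputable section

namespace Loday

universe u v

/-! ### The five types of algebras -/

section Algebras

variable (K : Type u) (A : Type v) [Field K] [AddCommGroup A] [Module K A]

/-- A dialgebra structure on the vector space `A`: `left x y` is `x ⊣ y`, `right x y` is `x ⊢ y`. -/
structure Dialgebra where
  left : A →ₗ[K] A →ₗ[K] A
  right : A →ₗ[K] A →ₗ[K] A
  left_left : ∀ x y z, left (left x y) z = left x (left y z)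
  left_left' : ∀ x y z, left (left x y) z = left x (right y z)
  right_left : ∀ x y z, left (right x y) z = right x (left y z)
  left_right : ∀ x y z, right (left x y) z = right x (right y z)
  right_right : ∀ x y z, right (right x y) z = right x (right y z)

/-- A dendriform dialgebra structure on the vector space `A`: `left x y` is `x ≺ y`,
`right x y` is `x ≻ y`. -/
structure DendriformDialgebra where
  left : A →ₗ[K] A →ₗ[K] A
  right : A →ₗ[K] A →ₗ[K] A
  left_left : ∀ x y z, left (left x y) z = left x (left y z + right y z)
  right_left : ∀ x y z, left (right x y) z = right x (left y z)
  right_right : ∀ x y z, right (left x y + right x y) z = right x (right y z)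

/-- An associative trialgebra structure on the vector space `A`: `left x y` is `x ⊣ y`,
`right x y` is `x ⊢ y` and `mid x y` is `x ⊥ y`. -/
structure AssociativeTrialgebra where
  left : A →ₗ[K] A →ₗ[K] A
  right : A →ₗ[K] A →ₗ[K] A
  mid : A →ₗ[K] A →ₗ[K] A
  left_left : ∀ x y z, left (left x y) z = left x (left y z)
  left_left' : ∀ x y z, left (left x y) z = left x (right y z)
  right_left : ∀ x y z, left (right x y) z = right x (left y z)
  left_right : ∀ x y z, right (left x y) z = right x (right y z)
  right_right : ∀ x y z, right (right x y) z = right x (right y z)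
  left_left'' : ∀ x y z, left (left x y) z = left x (mid y z)
  mid_left : ∀ x y z, left (mid x y) z = mid x (left y z)
  left_mid : ∀ x y z, mid (left x y) z = mid x (right y z)
  right_mid : ∀ x y z, mid (right x y) z = right x (mid y z)
  mid_right : ∀ x y z, right (mid x y) z = right x (right y z)
  mid_mid : ∀ x y z, mid (mid x y) z = mid x (mid y z)

/-- A dendriform trialgebra structure on the vector space `A`: `left x y` is `x ≺ y`,
`right x y` is `x ≻ y` and `mid x y` is `x · y`. -/
structure DendriformTrialgebra where
  left : A →ₗ[K] A →ₗ[K] A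
  right : A →ₗ[K] A →ₗ[K] A
  mid : A →ₗ[K] A →ₗ[K] A
  left_left : ∀ x y z, left (left x y) z = left x (left y z + mid y z + right y z)
  right_left : ∀ x y z, left (right x y) z = right x (left y z)
  right_right : ∀ x y z, right (left x y + mid x y + right x y) z = right x (right y z)
  right_mid : ∀ x y z, mid (right x y) z = right x (mid y z)
  left_mid : ∀ x y z, mid (left x y) z = mid x (right y z)
  mid_left : ∀ x y z, left (mid x y) z = mid x (left y z)
  mid_mid : ∀ x y z, mid (mid x y) z = mid x (mid y z)

/-- A cubical trialgebra structure on the vector space `A`: `left x y` is `x ⊣ y`,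
`right x y` is `x ⊢ y` and `mid x y` is `x ⊥ y`; the nine relations are
`(x ∘₁ y) ∘₂ z = x ∘₁ (y ∘₂ z)` for all choices of the operations `∘₁`, `∘₂`. -/
structure CubicalTrialgebra where
  left : A →ₗ[K] A →ₗ[K] A
  right : A →ₗ[K] A →ₗ[K] A
  mid : A →ₗ[K] A →ₗ[K] A
  left_left : ∀ x y z, left (left x y) z = left x (left y z)
  left_right : ∀ x y z, right (left x y) z = left x (right y z)
  left_mid : ∀ x y z, mid (left x y) z = left x (mid y z)
  right_left : ∀ x y z, left (right x y) z = right x (left y z)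
  right_right : ∀ x y z, right (right x y) z = right x (right y z)
  right_mid : ∀ x y z, mid (right x y) z = right x (mid y z)
  mid_left : ∀ x y z, left (mid x y) z = mid x (left y z)
  mid_right : ∀ x y z, right (mid x y) z = mid x (right y z)
  mid_mid : ∀ x y z, mid (mid x y) z = mid x (mid y z)

end Algebras

/-! ### Pre-operadic systems -/

section PreOperadic

variable {k N : ℕ}

/-- The partial sum `n₁ + ⋯ + nᵢ`. -/
def psum (n : Fin k → ℕ) (i : ℕ) : ℕ :=
  ∑ j ∈ Finset.univ.filter (fun j : Fin k => (j : ℕ) < i), n j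

/-- When `n₁ + ⋯ + n_k = N`, the positions `0, …, N - 1` are cut into `k` consecutive blocks, the
`i`-th one of size `n i`; `block n hN i j` is the `j`-th position of the `i`-th block. -/
def block (n : Fin k → ℕ) (hN : ∑ i, n i = N) (i : Fin k) (j : Fin (n i)) : Fin N :=
  Fin.cast hN (finSigmaFinEquiv ⟨i, j⟩)

/-- The index of the block that contains the position `r`. -/
def blockIndex (n : Fin k → ℕ) (hN : ∑ i, n i = N) (r : Fin N) : Fin k :=
  (finSigmaFinEquiv.symm (Fin.cast hN.symm r)).1

theorem psum_succ (n : Fin k → ℕ) (i : Fin k) : psum n (i + 1) = psum n i + n i := by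
  unfold psum
  have : (Finset.univ.filter fun j : Fin k => (j : ℕ) < i + 1)
      = insert i (Finset.univ.filter fun j : Fin k => (j : ℕ) < i) := by
    ext j; simp [Fin.ext_iff]; omega
  rw [this, Finset.sum_insert (by simp), add_comm]

theorem psum_zero (n : Fin k → ℕ) : psum n 0 = 0 := by simp [psum]

theorem psum_top (n : Fin k → ℕ) : psum n k = ∑ i, n i := by
  unfold psum; congr 1; ext j; simp

theorem psum_mono (n : Fin k → ℕ) : Monotone (psum n) := fun a b h =>
  Finset.sum_le_sum_of_subset fun j hj => by
    simp only [Finset.mem_filter, Finset.mem_univ, true_and] at hj ⊢; omega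

theorem psum_le (n : Fin k → ℕ) (i : ℕ) : psum n i ≤ ∑ i, n i :=
  Finset.sum_le_sum_of_subset (Finset.subset_univ _)

theorem block_val (n : Fin k → ℕ) (hN : ∑ i, n i = N) (i : Fin k) (j : Fin (n i)) :
    (block n hN i j : ℕ) = psum n i + j := by
  simp only [block, Fin.val_cast, finSigmaFinEquiv_apply, psum]
  congr 1
  refine Finset.sum_bij (fun a _ => Fin.castLE i.2.le a) ?_ ?_ ?_ ?_
  · intro a _
    exact Finset.mem_filter.2 ⟨Finset.mem_univ _, a.2⟩
  · intro a _ b _ h; simpa [Fin.ext_iff] using h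
  · intro b hb
    simp only [Finset.mem_filter, Finset.mem_univ, true_and] at hb
    exact ⟨⟨b, hb⟩, by simp, rfl⟩
  · intro a _; rfl

/-- A collection of functions `R₀(k; n₁, …, n_k) : U_N → U_k` and
`Rᵢ(k; n₁, …, n_k) : U_N → U_{nᵢ}`, for positive integers `nᵢ` with `n₁ + ⋯ + n_k = N`. -/
structure SystemData (U : ℕ → Type) where
  R₀ : ∀ {k N : ℕ} (n : Fin k → ℕ), (∀ i, 0 < n i) → ∑ i, n i = N → U N → U k
  R : ∀ {k N : ℕ} (n : Fin k → ℕ), (∀ i, 0 < n i) → ∑ i, n i = N → ∀ i : Fin k, U N → U (n i)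

theorem sum_block {M : ℕ} (n : Fin k → ℕ) (hN : ∑ i, n i = N) (m : Fin N → ℕ)
    (hM : ∑ l, m l = M) : ∑ i, ∑ j, m (block n hN i j) = M := by
  subst hN hM
  rw [← Fintype.sum_sigma']
  exact Fintype.sum_equiv finSigmaFinEquiv _ _ fun _ => rfl

theorem sum_block_pos (n : Fin k → ℕ) (hn : ∀ i, 0 < n i) (hN : ∑ i, n i = N) (m : Fin N → ℕ)
    (hm : ∀ l, 0 < m l) (i : Fin k) : 0 < ∑ j, m (block n hN i j) :=
  Finset.sum_pos (fun _ _ => hm _) ⟨⟨0, hn i⟩, Finset.mem_univ _⟩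

/-- The four conditions on a pre-operadic system. Here `T i = ∑ j, m (block n hN i j)` is the sum
of those `m_l` whose index `l` lies in the `i`-th block. -/
structure SystemData.IsPreOperadic {U : ℕ → Type} (S : SystemData U) : Prop where
  identity : ∀ (k : ℕ), 0 < k → ∀ r : U k,
    S.R₀ (fun _ : Fin k => 1) (fun _ => Nat.one_pos) (by simp) r = r
  idempotency : ∀ {k N M : ℕ}, 0 < k → ∀ (n : Fin k → ℕ) (hn : ∀ i, 0 < n i) (hN : ∑ i, n i = N)
    (m : Fin N → ℕ) (hm : ∀ l, 0 < m l) (hM : ∑ l, m l = M) (r : U M),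
    S.R₀ n hn hN (S.R₀ m hm hM r)
      = S.R₀ (fun i => ∑ j, m (block n hN i j)) (sum_block_pos n hn hN m hm)
          (sum_block n hN m hM) r
  commutativity : ∀ {k N M : ℕ}, 0 < k → ∀ (n : Fin k → ℕ) (hn : ∀ i, 0 < n i)
    (hN : ∑ i, n i = N) (m : Fin N → ℕ) (hm : ∀ l, 0 < m l) (hM : ∑ l, m l = M) (r : U M)
    (i : Fin k),
    S.R n hn hN i (S.R₀ m hm hM r)
      = S.R₀ (fun j => m (block n hN i j)) (fun _ => hm _) rfl
          (S.R (fun i => ∑ j, m (block n hN i j)) (sum_block_pos n hn hN m hm)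
            (sum_block n hN m hM) i r)
  closure : ∀ {k N M : ℕ}, 0 < k → ∀ (n : Fin k → ℕ) (hn : ∀ i, 0 < n i) (hN : ∑ i, n i = N)
    (m : Fin N → ℕ) (hm : ∀ l, 0 < m l) (hM : ∑ l, m l = M) (r : U M)
    (i : Fin k) (j : Fin (n i)),
    S.R m hm hM (block n hN i j) r
      = S.R (fun j => m (block n hN i j)) (fun _ => hm _) rfl j
          (S.R (fun i => ∑ j, m (block n hN i j)) (sum_block_pos n hn hN m hm)
            (sum_block n hN m hM) i r)

end PreOperadic

/-! ### Cochains, operadic composition and braces -/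

section Cochains

variable (K : Type u) (A : Type v) [Field K] [AddCommGroup A] [Module K A] (U : ℕ → Type)

/-- `n`-cochains: `Hom_K(K[U_n] ⊗ A^{⊗ n}, A)`, written as families, indexed by `r ∈ U_n`, of
`n`-linear maps `f(r; x₁, …, x_n)`; see `cochainEquiv`. -/
abbrev Cochain (n : ℕ) : Type _ := U n → MultilinearMap K (fun _ : Fin n => A) A

/-- The identification of `Cochain` with `Hom_K(K[U_n] ⊗ A^{⊗ n}, A)`. -/
def cochainEquiv (n : ℕ) :
    Cochain K A U n ≃ₗ[K] ((U n →₀ K) ⊗[K] (⨂[K] _ : Fin n, A) →ₗ[K] A) :=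
  (LinearEquiv.piCongrRight fun _ => PiTensorProduct.lift) ≪≫ₗ
    Finsupp.llift _ K K (U n) ≪≫ₗ TensorProduct.lift.equiv (RingHom.id K) _ _ _

variable {K A U}

/-- The identity cochain `Id_A(r; x) = x`. -/
def idCochain : Cochain K A U 1 := fun _ =>
  MultilinearMap.ofSubsingleton K A A (0 : Fin 1) LinearMap.id

variable (S : SystemData U)

/-- The operadic composition: `γ(f; g₁, …, g_k)(r; x₁, …, x_N)` is `f` at `R₀(r)`, evaluated at the
elements `gᵢ(Rᵢ(r); xᵢ)`, where `xᵢ` is the `i`-th block of `x₁, …, x_N`. -/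
def gamma {k N : ℕ} (n : Fin k → ℕ) (hn : ∀ i, 0 < n i) (hN : ∑ i, n i = N)
    (f : Cochain K A U k) (g : ∀ i, Cochain K A U (n i)) : Cochain K A U N := fun r =>
  ((f (S.R₀ n hn hN r)).compMultilinearMap fun i => g i (S.R n hn hN i r)).domDomCongr
    (finSigmaFinEquiv.trans (finCongr hN))

theorem gamma_apply {k N : ℕ} (n : Fin k → ℕ) (hn : ∀ i, 0 < n i) (hN : ∑ i, n i = N)
    (f : Cochain K A U k) (g : ∀ i, Cochain K A U (n i)) (r : U N) (x : Fin N → A) :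
    gamma S n hn hN f g r x
      = f (S.R₀ n hn hN r) fun i => g i (S.R n hn hN i r) fun j => x (block n hN i j) := rfl

/-- A slot of a brace: slot `some a` carries the cochain `y a` and slot `none` carries `Id_A`. -/
def slot {s : ℕ} {q : Fin s → ℕ} (y : ∀ a, Cochain K A U (q a + 1)) :
    ∀ o : Option (Fin s), Cochain K A U (o.elim 0 q + 1)
  | none => idCochain
  | some a => y a

/-- The reduced degree of what is put into the `j`-th input when `y₁, …, y_s`, of reduced degrees
`q₁, …, q_s`, are inserted into the inputs `e 1 < ⋯ < e s` and `Id_A` into the others. -/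
def slotDeg {k s : ℕ} (q : Fin s → ℕ) (e : Fin s ↪o Fin k) (j : Fin k) : ℕ :=
  (Function.partialInv e j).elim 0 q

theorem sum_slotDeg {k s : ℕ} (q : Fin s → ℕ) (e : Fin s ↪o Fin k) :
    ∑ j, (slotDeg q e j + 1) = k + ∑ a, q a := by
  have h : ∑ j, slotDeg q e j = ∑ a, q a := by
    have h1 : ∑ a, q a = ∑ j ∈ Finset.univ.map e.toEmbedding, slotDeg q e j := by
      rw [Finset.sum_map]
      refine Finset.sum_congr rfl fun a _ => ?_
      simp [slotDeg, Function.partialInv_left e.injective]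
    rw [h1]
    symm
    refine Finset.sum_subset (Finset.subset_univ _) fun j _ hj => ?_
    unfold slotDeg
    rcases ho : Function.partialInv e j with _ | a
    · rfl
    · exact absurd (by simpa using ⟨a, (e.injective.isPartialInv a j).1 ho⟩) hj
  rw [Finset.sum_add_distrib, h]
  simp [add_comm]

/-- The brace `x{y₁, …, y_s} = ∑ (-1)^ε γ(x; Id, …, Id, y₁, Id, …, Id, y_s, Id, …, Id)` over all
substitutions of `y₁, …, y_s` into `x` in the given order. Here `ε = ∑ |y_a| i_a`, where `i_a` is the
total number of inputs in front of `y_a`. The cochain `x` has degree `p + 1`, that is `|x| = p`,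
and `|y_a| = q a`. -/
def brace {p s r : ℕ} (q : Fin s → ℕ) (h : p + ∑ a, q a = r) (x : Cochain K A U (p + 1))
    (y : ∀ a, Cochain K A U (q a + 1)) : Cochain K A U (r + 1) :=
  ∑ e : Fin s ↪o Fin (p + 1),
    (-1 : K) ^ (∑ a, q a * psum (fun j => slotDeg q e j + 1) (e a)) •
      gamma S (fun j => slotDeg q e j + 1) (fun _ => Nat.succ_pos _)
        ((sum_slotDeg q e).trans (by omega)) x (fun j => slot y (Function.partialInv e j))

/-- `x ∘ y = x{y}`, where `|x| = p`, `|y| = q`. -/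
def circ {p q r : ℕ} (h : p + q = r) (x : Cochain K A U (p + 1)) (y : Cochain K A U (q + 1)) :
    Cochain K A U (r + 1) :=
  brace S (fun _ : Fin 1 => q) (by simpa using h) x fun _ => y

/-- The bracket `[x, y] = x ∘ y - (-1)^{|x||y|} y ∘ x`. -/
def bracket {p q r : ℕ} (h : p + q = r) (x : Cochain K A U (p + 1)) (y : Cochain K A U (q + 1)) :
    Cochain K A U (r + 1) :=
  circ S h x y - (-1 : K) ^ (p * q) • circ S ((add_comm q p).trans h) y x

/-- A multiplication: a `2`-cochain with `π ∘ π = 0`, or equivalently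
`γ(π; π, Id_A) = γ(π; Id_A, π)`. -/
def IsMultiplication (π : Cochain K A U 2) : Prop :=
  circ (p := 1) (q := 1) S rfl π π = 0

variable (π : Cochain K A U 2)

/-- The dot product `x · y = (-1)^{deg x} π{x, y}`, where `|x| = p`, `|y| = q`, so that
`deg x = p + 1`. -/
def dot {p q r : ℕ} (h : p + q + 1 = r) (x : Cochain K A U (p + 1)) (y : Cochain K A U (q + 1)) :
    Cochain K A U (r + 1) :=
  (-1 : K) ^ (p + 1) •
    brace (p := 1) S ![p, q] (by simp; omega) π (Fin.cons x (Fin.cons y finZeroElim))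

theorem gamma_add_left {k N : ℕ} (n : Fin k → ℕ) (hn : ∀ i, 0 < n i) (hN : ∑ i, n i = N)
    (f f' : Cochain K A U k) (g : ∀ i, Cochain K A U (n i)) :
    gamma S n hn hN (f + f') g = gamma S n hn hN f g + gamma S n hn hN f' g := by
  funext r; ext x; simp [gamma_apply]

theorem gamma_smul_left {k N : ℕ} (n : Fin k → ℕ) (hn : ∀ i, 0 < n i) (hN : ∑ i, n i = N)
    (c : K) (f : Cochain K A U k) (g : ∀ i, Cochain K A U (n i)) :
    gamma S n hn hN (c • f) g = c • gamma S n hn hN f g := by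
  funext r; ext x; simp [gamma_apply]

theorem circ_add_left {p q r : ℕ} (h : p + q = r) (x x' : Cochain K A U (p + 1))
    (y : Cochain K A U (q + 1)) : circ S h (x + x') y = circ S h x y + circ S h x' y := by
  simp only [circ, brace, ← Finset.sum_add_distrib, ← smul_add]
  exact Finset.sum_congr rfl fun e _ => congrArg _ (gamma_add_left S _ _ _ _ _ _)

theorem circ_smul_left {p q r : ℕ} (h : p + q = r) (c : K) (x : Cochain K A U (p + 1))
    (y : Cochain K A U (q + 1)) : circ S h (c • x) y = c • circ S h x y := by
  simp only [circ, brace, Finset.smul_sum]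
  refine Finset.sum_congr rfl fun e _ => ?_
  rw [smul_comm c]
  exact congrArg _ (gamma_smul_left S _ _ _ c _ _)

theorem slot_none {s : ℕ} {q : Fin s → ℕ} (y y' : ∀ a, Cochain K A U (q a + 1))
    (o : Option (Fin s)) (ho : o = none) : slot y o = slot y' o := by subst ho; rfl

theorem slot_add {q : ℕ} (y y' : Cochain K A U (q + 1)) (o : Option (Fin 1)) (ho : o ≠ none) :
    slot (q := fun _ => q) (fun _ => y + y') o
      = slot (q := fun _ => q) (fun _ => y) o + slot (q := fun _ => q) (fun _ => y') o := by
  cases o with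
  | none => exact absurd rfl ho
  | some a => rfl

theorem slot_smul {q : ℕ} (c : K) (y : Cochain K A U (q + 1)) (o : Option (Fin 1))
    (ho : o ≠ none) :
    slot (q := fun _ => q) (fun _ => c • y) o = c • slot (q := fun _ => q) (fun _ => y) o := by
  cases o with
  | none => exact absurd rfl ho
  | some a => rfl

theorem partialInv_none {k : ℕ} (e : Fin 1 ↪o Fin k) (j : Fin k) (hj : j ≠ e 0) :
    Function.partialInv e j = none := by
  rcases ho : Function.partialInv e j with _ | a
  · rfl
  · exact absurd ((e.injective.isPartialInv a j).1 ho).symm (by rwa [Subsingleton.elim a 0])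

theorem gamma_add_right {k N : ℕ} (n : Fin k → ℕ) (hn : ∀ i, 0 < n i) (hN : ∑ i, n i = N)
    (f : Cochain K A U k) (g g' g'' : ∀ i, Cochain K A U (n i)) (l : Fin k)
    (hl : g l = g' l + g'' l) (h' : ∀ i, i ≠ l → g i = g' i) (h'' : ∀ i, i ≠ l → g i = g'' i) :
    gamma S n hn hN f g = gamma S n hn hN f g' + gamma S n hn hN f g'' := by
  classical
  funext r
  ext x
  simp only [gamma_apply, Pi.add_apply, add_apply]
  set V := fun i => g i (S.R n hn hN i r) fun j => x (block n hN i j) with hV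
  set V' := fun i => g' i (S.R n hn hN i r) fun j => x (block n hN i j) with hV'
  set V'' := fun i => g'' i (S.R n hn hN i r) fun j => x (block n hN i j) with hV''
  have e1 : V = Function.update V l (V' l + V'' l) := by
    rw [eq_comm, Function.update_eq_self_iff]; simp [hV, hV', hV'', hl]
  have e2 : V' = Function.update V l (V' l) := by
    rw [Function.eq_update_iff]; exact ⟨rfl, fun i hi => by simp [hV, hV', h' i hi]⟩
  have e3 : V'' = Function.update V l (V'' l) := by
    rw [Function.eq_update_iff]; exact ⟨rfl, fun i hi => by simp [hV, hV'', h'' i hi]⟩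
  rw [e1, MultilinearMap.map_update_add, ← e2, ← e3]

theorem gamma_smul_right {k N : ℕ} (n : Fin k → ℕ) (hn : ∀ i, 0 < n i) (hN : ∑ i, n i = N)
    (c : K) (f : Cochain K A U k) (g g' : ∀ i, Cochain K A U (n i)) (l : Fin k)
    (hl : g l = c • g' l) (h' : ∀ i, i ≠ l → g i = g' i) :
    gamma S n hn hN f g = c • gamma S n hn hN f g' := by
  classical
  funext r
  ext x
  simp only [gamma_apply, Pi.smul_apply, smul_apply]
  set V := fun i => g i (S.R n hn hN i r) fun j => x (block n hN i j) with hV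
  set V' := fun i => g' i (S.R n hn hN i r) fun j => x (block n hN i j) with hV'
  have e1 : V = Function.update V l (c • V' l) := by
    rw [eq_comm, Function.update_eq_self_iff]; simp [hV, hV', hl]
  have e2 : V' = Function.update V l (V' l) := by
    rw [Function.eq_update_iff]; exact ⟨rfl, fun i hi => by simp [hV, hV', h' i hi]⟩
  rw [e1, MultilinearMap.map_update_smul, ← e2]

theorem circ_add_right {p q r : ℕ} (h : p + q = r) (x : Cochain K A U (p + 1))
    (y y' : Cochain K A U (q + 1)) : circ S h x (y + y') = circ S h x y + circ S h x y' := by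
  simp only [circ, brace, ← Finset.sum_add_distrib, ← smul_add]
  refine Finset.sum_congr rfl fun e _ => congrArg _ (gamma_add_right S _ _ _ _ _ _ _ (e 0) ?_
    (fun i hi => slot_none _ _ _ (partialInv_none e i hi))
    (fun i hi => slot_none _ _ _ (partialInv_none e i hi)))
  exact slot_add y y' _ (by simp [Function.partialInv_left e.injective])

theorem circ_smul_right {p q r : ℕ} (h : p + q = r) (c : K) (x : Cochain K A U (p + 1))
    (y : Cochain K A U (q + 1)) : circ S h x (c • y) = c • circ S h x y := by
  simp only [circ, brace, Finset.smul_sum]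
  refine Finset.sum_congr rfl fun e _ => ?_
  rw [smul_comm c]
  refine congrArg _ (gamma_smul_right S _ _ _ c _ _ _ (e 0) ?_
    (fun i hi => slot_none _ _ _ (partialInv_none e i hi)))
  exact slot_smul c y _ (by simp [Function.partialInv_left e.injective])

/-- The differential `d x = [π, x] = π ∘ x - (-1)^{|x|} x ∘ π` from degree `p + 1` to degree
`p + 2`. -/
def differential (p : ℕ) : Cochain K A U (p + 1) →ₗ[K] Cochain K A U (p + 1 + 1) where
  toFun x := bracket S (add_comm 1 p) π x
  map_add' x y := by
    simp only [bracket, circ_add_left, circ_add_right, smul_add]; abel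
  map_smul' c x := by
    simp only [bracket, circ_smul_left, circ_smul_right, RingHom.id_apply, smul_sub]
    rw [smul_comm c]

/-- The cocycles of degree `p + 1`. -/
def cocycles (p : ℕ) : Submodule K (Cochain K A U (p + 1)) := LinearMap.ker (differential S π p)

/-- The coboundaries of degree `p + 1`; there are no cochains of degree `0`. -/
def coboundaries : ∀ p : ℕ, Submodule K (Cochain K A U (p + 1))
  | 0 => ⊥
  | p + 1 => LinearMap.range (differential S π p)

/-- The cohomology `H^{p+1}` of the cochains with the differential generated by `π`. -/
abbrev Cohomology (p : ℕ) : Type _ :=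
  cocycles S π p ⧸ (coboundaries S π p).submoduleOf (cocycles S π p)

/-- The class of a cocycle. -/
def cohomologyClass (p : ℕ) (x : cocycles S π p) : Cohomology S π p :=
  Submodule.Quotient.mk x

end Cochains

/-! ### Gerstenhaber algebras -/

/-- A `G`-algebra structure on a graded vector space concentrated in positive degrees: `H p` is the
component of degree `p + 1`, so that `p` is the reduced degree `|x| = deg x - 1`. The dot product
has degree `0`, hence `(p + 1) + (q + 1) = r + 1`, and the bracket has degree `-1`, hence
`(p + 1) + (q + 1) - 1 = r + 1`. The product is associative and graded commutative, the bracket is a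
graded Lie bracket for the reduced degree (with the usual additional identities in characteristics
`2` and `3`) and a graded derivation of the product. -/
structure GAlgebra (K : Type u) [Field K] (H : ℕ → Type v) [∀ p, AddCommGroup (H p)]
    [∀ p, Module K (H p)] where
  dot : ∀ {p q r : ℕ}, p + q + 1 = r → H p →ₗ[K] H q →ₗ[K] H r
  bracket : ∀ {p q r : ℕ}, p + q = r → H p →ₗ[K] H q →ₗ[K] H r
  dot_assoc : ∀ {p q s a b r : ℕ} (h₁ : p + q + 1 = a) (h₂ : a + s + 1 = r) (h₃ : q + s + 1 = b)
    (h₄ : p + b + 1 = r) (x : H p) (y : H q) (z : H s),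
    dot h₂ (dot h₁ x y) z = dot h₄ x (dot h₃ y z)
  dot_comm : ∀ {p q r : ℕ} (h₁ : p + q + 1 = r) (h₂ : q + p + 1 = r) (x : H p) (y : H q),
    dot h₁ x y = (-1 : K) ^ ((p + 1) * (q + 1)) • dot h₂ y x
  bracket_skew : ∀ {p q r : ℕ} (h₁ : p + q = r) (h₂ : q + p = r) (x : H p) (y : H q),
    bracket h₁ x y = -((-1 : K) ^ (p * q) • bracket h₂ y x)
  bracket_jacobi : ∀ {p q s a b c r : ℕ} (h₁ : q + s = a) (h₂ : p + a = r) (h₃ : p + q = b)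
    (h₄ : b + s = r) (h₅ : p + s = c) (h₆ : q + c = r) (x : H p) (y : H q) (z : H s),
    bracket h₂ x (bracket h₁ y z)
      = bracket h₄ (bracket h₃ x y) z + (-1 : K) ^ (p * q) • bracket h₆ y (bracket h₅ x z)
  bracket_self : ∀ {p r : ℕ} (h : p + p = r), Even p → ∀ x : H p, bracket h x x = 0
  bracket_bracket_self : ∀ {p a r : ℕ} (h₁ : p + p = a) (h₂ : p + a = r), Odd p → ∀ x : H p,
    bracket h₂ x (bracket h₁ x x) = 0
  bracket_dot : ∀ {p q s a b c r : ℕ} (h₁ : q + s + 1 = a) (h₂ : p + a = r) (h₃ : p + q = b)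
    (h₄ : b + s + 1 = r) (h₅ : p + s = c) (h₆ : q + c + 1 = r) (x : H p) (y : H q) (z : H s),
    bracket h₂ x (dot h₁ y z)
      = dot h₄ (bracket h₃ x y) z + (-1 : K) ^ (p * (q + 1)) • dot h₆ y (bracket h₅ x z)

section

variable {K : Type u} {A : Type v} [Field K] [AddCommGroup A] [Module K A] {U : ℕ → Type}

/-- The operations on cochains given by `S` and `π` induce a `G`-algebra structure on cohomology:
`S` is a pre-operadic system, `π` is a multiplication, `d ∘ d = 0`, the dot product and the bracket
of cocycles are cocycles, and there is a `G`-algebra structure on `H^*` for which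
`[x] · [y] = [x · y]` and `[[x], [y]] = [[x, y]]` for all cocycles `x`, `y`. -/
def InducesGAlgebra (S : SystemData U) (π : Cochain K A U 2) : Prop :=
  S.IsPreOperadic ∧
  IsMultiplication S π ∧
  (∀ (p : ℕ) (x : Cochain K A U (p + 1)), differential S π (p + 1) (differential S π p x) = 0) ∧
  ∃ (hdot : ∀ {p q r : ℕ} (h : p + q + 1 = r) (x : cocycles S π p) (y : cocycles S π q),
      dot S π h (x : Cochain K A U (p + 1)) (y : Cochain K A U (q + 1)) ∈ cocycles S π r)
    (hbracket : ∀ {p q r : ℕ} (h : p + q = r) (x : cocycles S π p) (y : cocycles S π q),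
      bracket S h (x : Cochain K A U (p + 1)) (y : Cochain K A U (q + 1)) ∈ cocycles S π r)
    (G : GAlgebra K (fun p => Cohomology S π p)),
    (∀ {p q r : ℕ} (h : p + q + 1 = r) (x : cocycles S π p) (y : cocycles S π q),
      G.dot h (cohomologyClass S π p x) (cohomologyClass S π q y)
        = cohomologyClass S π r ⟨_, hdot h x y⟩) ∧
    (∀ {p q r : ℕ} (h : p + q = r) (x : cocycles S π p) (y : cocycles S π q),
      G.bracket h (cohomologyClass S π p x) (cohomologyClass S π q y)
        = cohomologyClass S π r ⟨_, hbracket h x y⟩)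

/-- The bilinear operation `b`, as a map of two variables. -/
def binary (b : A →ₗ[K] A →ₗ[K] A) : MultilinearMap K (fun _ : Fin 2 => A) A :=
  MultilinearMap.mk' (fun x => b (x 0) (x 1))
    (by intro m i x y; fin_cases i <;> simp)
    (by intro m i c x; fin_cases i <;> simp)

end

/-! ### Dendriform dialgebras: the sets `C_n = {1, …, n}` -/

section Dendriform

variable {k N : ℕ}

/-- The map of `{1, …, N}` onto the `i`-th block (identified with `{1, …, n i}`) that sends
everything to the left of the block to its first element and everything to the right of it to its
last element. Positions are counted from `0` here. -/
def clamp (n : Fin k → ℕ) (hn : ∀ i, 0 < n i) (i : Fin k) (r : Fin N) : Fin (n i) :=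
  if (r : ℕ) < psum n i then ⟨0, hn i⟩
  else if h' : (r : ℕ) - psum n i < n i then ⟨r - psum n i, h'⟩
  else ⟨n i - 1, Nat.sub_lt (hn i) Nat.one_pos⟩

/-- The functions `R` on the sets `C_n`. -/
def didendSystem : SystemData Fin where
  R₀ n _ hN r := blockIndex n hN r
  R n hn _ i r := clamp n hn i r

end Dendriform

/-! ### Dendriform trialgebras: the non-empty subsets of `{1, …, n}` -/

/-- `P_n`, the set of non-empty subsets of an `n`-element set. -/
def NonemptySubset (n : ℕ) : Type := {X : Finset (Fin n) // X.Nonempty}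

/-- The functions `R` on the sets `P_n`: the images of a subset under the corresponding functions
on `C_n`. Thus `i ∈ R₀ X` iff `X` meets the `i`-th block, and `Rⱼ X` consists of the positions of
the elements of `X` in the `j`-th block, of the first position of that block if `X` meets what is to
the left of it, and of the last one if `X` meets what is to the right of it. -/
def tridendSystem : SystemData NonemptySubset where
  R₀ n _ hN X := ⟨X.1.image (blockIndex n hN), X.2.image _⟩
  R n hn _ i X := ⟨X.1.image (clamp n hn i), X.2.image _⟩

/-! ### Cubical trialgebras: the sets `{-1, 0, 1}^n` -/

/-- The functions `R` on the sets `Q_n = {-1, 0, 1}^n`: `(R₀ X)_i` is the product of the entries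
of `X` in the `i`-th block, and `Rⱼ X` is the `j`-th block of `X`. -/
def tricubSystem : SystemData (fun n => Fin n → SignType) where
  R₀ n _ hN X := fun i => ∏ t, X (block n hN i t)
  R n _ hN i X := fun l => X (block n hN i l)

/-! ### Dialgebras and associative trialgebras: planar trees -/

mutual

/-- Planar rooted trees, with leaves labelled by elements of `α`, in which every internal vertex
has at least two inputs: `node t f` is the grafting of `t` and of the (one or more) trees in `f`. -/
inductive PlanarTree (α : Type) : Type
  | leaf : α → PlanarTree α
  | node : PlanarTree α → PlanarForest α → PlanarTree α

/-- Non-empty ordered lists of planar trees. -/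
inductive PlanarForest (α : Type) : Type
  | single : PlanarTree α → PlanarForest α
  | cons : PlanarTree α → PlanarForest α → PlanarForest α

end

section Trees

variable {α β : Type}

mutual

/-- The labels of the leaves, from left to right. -/
def PlanarTree.leaves : PlanarTree α → List α
  | .leaf a => [a]
  | .node t f => t.leaves ++ f.leaves

/-- The labels of the leaves, from left to right. -/
def PlanarForest.leaves : PlanarForest α → List α
  | .single t => t.leaves
  | .cons t f => t.leaves ++ f.leaves

end

/-- The forest with the given first tree and the given list of further trees. -/
def PlanarForest.ofList : PlanarTree α → List (PlanarTree α) → PlanarForest α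
  | t, [] => .single t
  | t, t' :: l => .cons t (PlanarForest.ofList t' l)

/-- The grafting of a list of trees: there is nothing to graft for the empty list, and the grafting
of one tree is this tree (no internal vertex with only one input is created). -/
def PlanarTree.graft : List (PlanarTree α) → Option (PlanarTree α)
  | [] => none
  | [t] => some t
  | t :: t' :: l => some (.node t (PlanarForest.ofList t' l))

mutual

/-- Delete the leaves whose label `a` satisfies `f a = none`, and relabel those with `f a = some b`
by `b`. Vertices left with only one input are removed. The result is `none` if no leaf is left. -/
def PlanarTree.prune (f : α → Option β) : PlanarTree α → Option (PlanarTree β)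
  | .leaf a => (f a).map .leaf
  | .node t s => PlanarTree.graft ((t.prune f).toList ++ s.prune f)

/-- The trees of a forest that are left after deletion of leaves. -/
def PlanarForest.prune (f : α → Option β) : PlanarForest α → List (PlanarTree β)
  | .single t => (t.prune f).toList
  | .cons t s => (t.prune f).toList ++ s.prune f

end

mutual

/-- Binary trees: every internal vertex has exactly two inputs. -/
def PlanarTree.IsBinary : PlanarTree α → Prop
  | .leaf _ => True
  | .node t s => t.IsBinary ∧ s.IsBinarySingle

/-- A forest that consists of one binary tree. -/
def PlanarForest.IsBinarySingle : PlanarForest α → Prop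
  | .single t => t.IsBinary
  | .cons _ _ => False

end

theorem PlanarForest.leaves_ofList (t : PlanarTree α) (l : List (PlanarTree α)) :
    (PlanarForest.ofList t l).leaves = t.leaves ++ l.flatMap PlanarTree.leaves := by
  induction l generalizing t with
  | nil => simp [PlanarForest.ofList, PlanarForest.leaves]
  | cons t' l ih => simp [PlanarForest.ofList, PlanarForest.leaves, ih]

theorem PlanarTree.leaves_graft (l : List (PlanarTree α)) :
    (PlanarTree.graft l).toList.flatMap PlanarTree.leaves = l.flatMap PlanarTree.leaves := by
  match l with
  | [] => rfl
  | [t] => rfl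
  | t :: t' :: l => simp [PlanarTree.graft, PlanarTree.leaves, PlanarForest.leaves_ofList]

mutual

theorem PlanarTree.leaves_prune (f : α → Option β) : ∀ t : PlanarTree α,
    (t.prune f).toList.flatMap PlanarTree.leaves = t.leaves.filterMap f
  | .leaf a => by
    cases h : f a <;> simp [PlanarTree.prune, PlanarTree.leaves, h]
  | .node t s => by
    rw [PlanarTree.prune, PlanarTree.leaves_graft, List.flatMap_append,
      PlanarTree.leaves_prune f t, PlanarForest.leaves_prune f s, PlanarTree.leaves,
      List.filterMap_append]

theorem PlanarForest.leaves_prune (f : α → Option β) : ∀ s : PlanarForest α,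
    (s.prune f).flatMap PlanarTree.leaves = s.leaves.filterMap f
  | .single t => by
    rw [PlanarForest.prune, PlanarTree.leaves_prune f t, PlanarForest.leaves]
  | .cons t s => by
    rw [PlanarForest.prune, List.flatMap_append, PlanarTree.leaves_prune f t,
      PlanarForest.leaves_prune f s, PlanarForest.leaves, List.filterMap_append]

end

theorem PlanarTree.isBinary_prune (f : α → Option β) : ∀ t : PlanarTree α, t.IsBinary →
    ∀ t' ∈ t.prune f, t'.IsBinary
  | .leaf a, _, t', ht' => by
    cases h : f a with
    | none => simp [PlanarTree.prune, h] at ht'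
    | some b =>
      simp only [PlanarTree.prune, h, Option.map_some, Option.mem_some_iff] at ht'
      subst ht'; simp [PlanarTree.IsBinary]
  | .node t (.cons _ _), h, _, _ => by
    simp [PlanarTree.IsBinary, PlanarForest.IsBinarySingle] at h
  | .node t (.single s), h, t', ht' => by
    simp only [PlanarTree.IsBinary, PlanarForest.IsBinarySingle] at h
    have h1 := PlanarTree.isBinary_prune f t h.1
    have h2 := PlanarTree.isBinary_prune f s h.2
    simp only [PlanarTree.prune, PlanarForest.prune] at ht'
    rcases e1 : t.prune f with _ | a <;> rcases e2 : s.prune f with _ | b <;>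
      simp only [e1, e2, Option.toList, List.append_nil, List.nil_append, List.cons_append,
        PlanarTree.graft, PlanarForest.ofList, Option.mem_def, Option.some.injEq,
        reduceCtorEq] at ht' h1 h2
    · subst ht'; exact h2 _ rfl
    · subst ht'; exact h1 _ rfl
    · subst ht'
      simp only [PlanarTree.IsBinary, PlanarForest.IsBinarySingle]
      exact ⟨h1 _ rfl, h2 _ rfl⟩

/-- `𝒯_n`: the planar trees with `n + 1` leaves, labelled `0, 1, …, n` from left to right. -/
def LeafTree (n : ℕ) : Type := {t : PlanarTree (Fin (n + 1)) // t.leaves = List.finRange (n + 1)}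

/-- `Y_n`: the binary planar trees with `n + 1` leaves. -/
def BinTree (n : ℕ) : Type := {t : LeafTree n // t.1.IsBinary}

theorem filterMap_finRange {m n : ℕ} (φ : Fin m ↪o Fin n) :
    (List.finRange n).filterMap (Function.partialInv φ) = List.finRange m := by
  have hφ := φ.injective.isPartialInv
  refine List.Perm.eq_of_pairwise (le := (· < ·)) ?_ ?_ (List.pairwise_lt_finRange m) ?_
  · intro a b _ _ h1 h2; exact absurd (h1.trans h2) (lt_irrefl _)
  · refine (List.pairwise_lt_finRange n).filterMap _ ?_
    intro a a' h b hb b' hb'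
    rw [← (hφ _ _).1 hb, ← (hφ _ _).1 hb'] at h
    exact φ.lt_iff_lt.1 h
  · refine (List.perm_ext_iff_of_nodup ?_ (List.nodup_finRange m)).2 fun a => ?_
    · refine (List.nodup_finRange n).filterMap ?_
      intro a a' b hb hb'
      exact ((hφ _ _).1 hb).symm.trans ((hφ _ _).1 hb')
    · simp only [List.mem_filterMap, List.mem_finRange, true_and, iff_true]
      exact ⟨φ a, (hφ _ _).2 rfl⟩

theorem exists_prune {m n : ℕ} (φ : Fin (m + 1) ↪o Fin (n + 1)) (t : LeafTree n) :
    ∃ t' : LeafTree m, t.1.prune (Function.partialInv φ) = some t'.1 := by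
  have h := PlanarTree.leaves_prune (Function.partialInv φ) t.1
  rw [t.2, filterMap_finRange] at h
  rcases e : t.1.prune (Function.partialInv φ) with _ | t'
  · rw [e] at h; simp [List.finRange_succ] at h
  · rw [e] at h; exact ⟨⟨t', by simpa using h⟩, rfl⟩

/-- For leaves `φ 0 < φ 1 < ⋯ < φ m` of a tree with `n + 1` leaves, the tree obtained by keeping
these leaves (with the new labels `0, 1, …, m`) and deleting all others. -/
def LeafTree.keep {m n : ℕ} (φ : Fin (m + 1) ↪o Fin (n + 1)) (t : LeafTree n) : LeafTree m :=
  (exists_prune φ t).choose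

theorem LeafTree.keep_spec {m n : ℕ} (φ : Fin (m + 1) ↪o Fin (n + 1)) (t : LeafTree n) :
    t.1.prune (Function.partialInv φ) = some (t.keep φ).1 := (exists_prune φ t).choose_spec

/-- Leaf deletion on binary trees. -/
def BinTree.keep {m n : ℕ} (φ : Fin (m + 1) ↪o Fin (n + 1)) (t : BinTree n) : BinTree m :=
  ⟨t.1.keep φ, PlanarTree.isBinary_prune _ _ t.2 _ (LeafTree.keep_spec φ t.1)⟩

variable {k N : ℕ}

/-- The leaves `0 = N_0 < N_1 < ⋯ < N_k = N`, where `N_i = n_1 + ⋯ + n_i`. -/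
def boundaryLeaves (n : Fin k → ℕ) (hn : ∀ i, 0 < n i) (hN : ∑ i, n i = N) :
    Fin (k + 1) ↪o Fin (N + 1) :=
  OrderEmbedding.ofStrictMono
    (fun i => ⟨psum n i, Nat.lt_succ_of_le (hN ▸ psum_le n i)⟩) <| by
      refine Fin.strictMono_iff_lt_succ.2 fun i => ?_
      change psum n i < psum n (i + 1)
      rw [psum_succ]
      exact Nat.lt_add_of_pos_right (hn i)

/-- The leaves `N_{i-1} < N_{i-1} + 1 < ⋯ < N_i`. -/
def intervalLeaves (n : Fin k → ℕ) (hN : ∑ i, n i = N) (i : Fin k) :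
    Fin (n i + 1) ↪o Fin (N + 1) :=
  OrderEmbedding.ofStrictMono
    (fun l => ⟨psum n i + l, by
      have h1 : psum n (i + 1) = psum n i + n i := psum_succ n i
      have h2 := psum_le n (i + 1)
      have h3 := l.2
      omega⟩) <| by
      intro a b h
      exact Nat.add_lt_add_left h _

/-- The functions `R` on planar trees: `R₀` keeps the leaves `N_0, N_1, …, N_k`, and `Rⱼ` keeps the
leaves `N_{j-1}, N_{j-1} + 1, …, N_j`. -/
def treeSystem : SystemData LeafTree where
  R₀ n hn hN := LeafTree.keep (boundaryLeaves n hn hN)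
  R n _ hN i := LeafTree.keep (intervalLeaves n hN i)

/-- The functions `R` on binary planar trees, given by the same deletions of leaves. -/
def binTreeSystem : SystemData BinTree where
  R₀ n hn hN := BinTree.keep (boundaryLeaves n hn hN)
  R n _ hN i := BinTree.keep (intervalLeaves n hN i)

/-- On trees with three leaves: `l`, `r` and `m` for the trees `0 ∨ (1 ∨ 2)`, `(0 ∨ 1) ∨ 2` and
`0 ∨ 1 ∨ 2` respectively. -/
def PlanarTree.select {X : Type v} (l r m : X) : PlanarTree α → X
  | .node (.leaf _) (.single _) => l
  | .node (.leaf _) (.cons _ _) => m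
  | .node (.node _ _) _ => r
  | .leaf _ => l

end Trees

/-! ### The multiplications -/

section Multiplications

variable {K : Type u} {A : Type v} [Field K] [AddCommGroup A] [Module K A]

/-- `π(ψ; x, y)` is `x ⊣ y` for `ψ = 0 ∨ (1 ∨ 2)` and `x ⊢ y` for `ψ = (0 ∨ 1) ∨ 2`. -/
def Dialgebra.mult (D : Dialgebra K A) : Cochain K A BinTree 2 := fun ψ =>
  PlanarTree.select (binary D.left) (binary D.right) 0 ψ.1.1

/-- `π(r; x, y) = x ≺ y + x ≻ y`. -/
def DendriformDialgebra.mult (D : DendriformDialgebra K A) : Cochain K A Fin 2 := fun _ =>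
  binary (D.left + D.right)

/-- `π(ψ; x, y)` is `x ⊣ y` for `ψ = 0 ∨ (1 ∨ 2)`, `x ⊢ y` for `ψ = (0 ∨ 1) ∨ 2` and `x ⊥ y` for
`ψ = 0 ∨ 1 ∨ 2`. -/
def AssociativeTrialgebra.mult (D : AssociativeTrialgebra K A) : Cochain K A LeafTree 2 := fun ψ =>
  PlanarTree.select (binary D.left) (binary D.right) (binary D.mid) ψ.1

/-- `π(X; x, y) = x ≺ y + x · y + x ≻ y`. -/
def DendriformTrialgebra.mult (D : DendriformTrialgebra K A) : Cochain K A NonemptySubset 2 :=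
  fun _ => binary (D.left + D.mid + D.right)

/-- `π(X; x, y) = x ⊣ y + x ⊥ y + x ⊢ y`. -/
def CubicalTrialgebra.mult (D : CubicalTrialgebra K A) :
    Cochain K A (fun n => Fin n → SignType) 2 := fun _ =>
  binary (D.left + D.mid + D.right)

end Multiplications

end Loday

end

/-!
The cochains `C^*(A, A)` form an operad, and a multiplication of an operad makes the cohomology of
its cochains a Gerstenhaber algebra. The proof separates three things: the identities in an
abstract operad, the operad of cochains of a pre-operadic system, and the five systems with their
multiplications.

*Identities.* A `SignedOperad` consists of insertions `x ∘ᵢ y` with the Koszul sign `(-1)^{|y| i}`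
built in. The braces with at most three arguments satisfy the relations `circ_circ`, `circ_brace₂`
and `brace₂_circ`, which are proved by sorting the summands according to the input that an
argument is put into. From the first relation the bracket satisfies the Jacobi identity. For a
multiplication `π`, that is `π ∘ π = 0`, the map `d = [π, -]` is a differential (`diff_diff`) and
a derivation of the bracket (`diff_bracket`) and of the dot product (`diff_dot`), which is
associative (`dot_assoc`). The two remaining identities hold up to coboundaries only: `diff_circ`
says that `x ∘ y` is a homotopy for the commutativity of the dot product, and `diff_brace₂` that
`x{y, z}` is one for the Leibniz rule `[x, y · z] = [x, y] · z ± y · [x, z]`. No step divides by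
`2` or `3`, so that everything holds in all characteristics.

*Cochains.* Inserting one cochain into another one is the composition `γ` with all other slots
filled by `Id_A`. The four conditions on a pre-operadic system give the sequential axiom of an
operad, and with the additional property `SystemData.IsUnital`, `R₁(1; N) = id`, which the five
systems have, the parallel one (`cochainOperad`). The signs of the braces are those of the
`SignedOperad` (`circ_eq`, `dot_eq`), and so the result descends to cohomology
(`inducesGAlgebra`).

*Systems.* For the sets `{1, …, n}`, their non-empty subsets, and the cubes, the conditions amount
to arithmetic of partial sums (`psum_add`, `psum_sum_block`, `block_block`). For trees they hold
because deletions of leaves compose (`PlanarTree.prune_prune`), and because the leaves that are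
kept are the same on both sides. Finally, `π ∘ π = 0` is checked on three elements
(`isMultiplication_of_assoc`): for trees this is one identity for each tree with four leaves
(`PlanarTree.eq_of_leaves_four`), and in the other cases it is the associativity of the sum of the
operations.
-/

noncomputable section

namespace Loday

universe u v

/-! ### Graded operads with Koszul signs -/

/-- Insertion operations `x ∘ᵢ y` on a graded module, `O p` being the component of reduced degree
`p` (that is, of arity `p + 1`), which satisfy the sequential and the parallel axiom of an operad.
The inputs of `x` are numbered `0, …, p`. The Koszul sign in the parallel axiom is the one that
results from replacing the insertion into the `i`-th input by its multiple by `(-1) ^ (|y| i)`. The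
values of `ins h i` for `i > p` are irrelevant. -/
structure SignedOperad (K : Type u) [CommRing K] (O : ℕ → Type v) [∀ p, AddCommGroup (O p)]
    [∀ p, Module K (O p)] where
  ins : ∀ {p q r : ℕ}, p + q = r → ℕ → O p →ₗ[K] O q →ₗ[K] O r
  ins_seq : ∀ {p q s a b r : ℕ} (h₁ : p + q = a) (h₂ : a + s = r) (h₃ : q + s = b)
    (h₄ : p + b = r) {i j : ℕ}, i ≤ p → j ≤ q → ∀ (x : O p) (y : O q) (z : O s),
    ins h₂ (i + j) (ins h₁ i x y) z = ins h₄ i x (ins h₃ j y z)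
  ins_par : ∀ {p q s a b r : ℕ} (h₁ : p + q = a) (h₂ : a + s = r) (h₃ : p + s = b)
    (h₄ : b + q = r) {i j : ℕ}, i < j → j ≤ p → ∀ (x : O p) (y : O q) (z : O s),
    ins h₂ (j + q) (ins h₁ i x y) z = (-1 : K) ^ (q * s) • ins h₄ i (ins h₃ j x z) y

/-- The inputs of a composite `x ∘ᵢ y` are those of `y` and those of `x` other than `i`. -/
theorem sum_range_split {M : Type*} [AddCommMonoid M] {p q r i : ℕ} (h : p + q = r) (hi : i ≤ p)
    (G : ℕ → M) :
    ∑ k ∈ Finset.range (r + 1), G k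
      = (∑ k ∈ Finset.range (p + 1), if k < i then G k else 0)
        + ∑ m ∈ Finset.range (q + 1), G (i + m)
        + ∑ k ∈ Finset.range (p + 1), if i < k then G (k + q) else 0 := by
  subst h
  obtain ⟨t, rfl⟩ := Nat.exists_eq_add_of_le hi
  rw [show i + t + q + 1 = i + ((q + 1) + t) by omega, Finset.sum_range_add, Finset.sum_range_add,
    ← add_assoc]
  congr 1
  · congr 1
    rw [show i + t + 1 = i + (t + 1) by omega, Finset.sum_range_add]
    rw [Finset.sum_eq_zero (s := Finset.range (t + 1)) fun k _ => by simp, add_zero]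
    exact Finset.sum_congr rfl fun k hk => by rw [if_pos (Finset.mem_range.1 hk)]
  · rw [show i + t + 1 = (i + 1) + t by omega, Finset.sum_range_add,
      Finset.sum_eq_zero (s := Finset.range (i + 1)) fun k hk => by
        rw [if_neg]; have := Finset.mem_range.1 hk; omega, zero_add]
    refine Finset.sum_congr rfl fun k hk => ?_
    rw [if_pos (by omega)]
    congr 1; omega

namespace SignedOperad

variable {K : Type u} [CommRing K] {O : ℕ → Type v} [∀ p, AddCommGroup (O p)]
  [∀ p, Module K (O p)] (P : SignedOperad K O)

/-- The brace `x{y}`. -/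
def circ {p q r : ℕ} (h : p + q = r) : O p →ₗ[K] O q →ₗ[K] O r :=
  ∑ i ∈ Finset.range (p + 1), P.ins h i

/-- The brace `x{y, z}`. -/
def brace₂ {p q s r : ℕ} (h : p + q + s = r) : O p →ₗ[K] O q →ₗ[K] O s →ₗ[K] O r :=
  ∑ i ∈ Finset.range (p + 1), ∑ j ∈ Finset.range (p + 1),
    if i < j then (P.ins (rfl : p + q = _) i).compr₂ (P.ins h (j + q)) else 0

/-- The brace `x{y, z, w}`. -/
def brace₃ {p q s t r : ℕ} (h : p + q + s + t = r) (x : O p) (y : O q) (z : O s) (w : O t) : O r :=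
  ∑ i ∈ Finset.range (p + 1), ∑ j ∈ Finset.range (p + 1), ∑ k ∈ Finset.range (p + 1),
    if i < j ∧ j < k then
      P.ins h (k + q + s) (P.ins (rfl : p + q + s = _) (j + q) (P.ins (rfl : p + q = _) i x y) z) w
    else 0

theorem circ_apply {p q r : ℕ} (h : p + q = r) (x : O p) (y : O q) :
    P.circ h x y = ∑ i ∈ Finset.range (p + 1), P.ins h i x y := by
  simp [circ, LinearMap.sum_apply]

theorem brace₂_apply {p q s a r : ℕ} (h : p + q + s = r) (h₁ : p + q = a) (h₂ : a + s = r)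
    (x : O p) (y : O q) (z : O s) :
    P.brace₂ h x y z = ∑ i ∈ Finset.range (p + 1), ∑ j ∈ Finset.range (p + 1),
      if i < j then P.ins h₂ (j + q) (P.ins h₁ i x y) z else 0 := by
  subst h₁
  simp only [brace₂, LinearMap.sum_apply]
  refine Finset.sum_congr rfl fun i _ => Finset.sum_congr rfl fun j _ => ?_
  split_ifs <;> simp

/-- The parallel axiom, with the sign on the other side. -/
theorem ins_par' {p q s a b r : ℕ} (h₁ : p + q = a) (h₂ : a + s = r) (h₃ : p + s = b)
    (h₄ : b + q = r) {i j : ℕ} (hij : i < j) (hj : j ≤ p) (x : O p) (y : O q) (z : O s) :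
    P.ins h₄ i (P.ins h₃ j x z) y = (-1 : K) ^ (q * s) • P.ins h₂ (j + q) (P.ins h₁ i x y) z := by
  rw [P.ins_par h₁ h₂ h₃ h₄ hij hj, smul_smul, ← pow_add, Even.neg_one_pow ⟨_, rfl⟩, one_smul]

theorem brace₃_apply {p q s t a b r : ℕ} (h : p + q + s + t = r) (h₁ : p + q = a) (h₂ : a + s = b)
    (h₃ : b + t = r) (x : O p) (y : O q) (z : O s) (w : O t) :
    P.brace₃ h x y z w = ∑ i ∈ Finset.range (p + 1), ∑ j ∈ Finset.range (p + 1),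
      ∑ k ∈ Finset.range (p + 1), if i < j ∧ j < k then
        P.ins h₃ (k + q + s) (P.ins h₂ (j + q) (P.ins h₁ i x y) z) w else 0 := by
  subst h₁ h₂
  rfl

/-- The composite `(x ∘ᵢ y){z}`, decomposed according to the input that `z` is put into. -/
theorem circ_ins {p q s a b r : ℕ} (h₁ : p + q = a) (h₂ : a + s = r) (h₃ : q + s = b)
    (h₄ : p + b = r) {i : ℕ} (hi : i ≤ p) (x : O p) (y : O q) (z : O s) :
    P.circ h₂ (P.ins h₁ i x y) z
      = (∑ k ∈ Finset.range (p + 1), if k < i then P.ins h₂ k (P.ins h₁ i x y) z else 0)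
        + P.ins h₄ i x (P.circ h₃ y z)
        + ∑ k ∈ Finset.range (p + 1), if i < k then P.ins h₂ (k + q) (P.ins h₁ i x y) z else 0 := by
  rw [P.circ_apply h₂, sum_range_split h₁ hi, P.circ_apply h₃, map_sum]
  congr 2
  refine Finset.sum_congr rfl fun m hm => ?_
  exact P.ins_seq _ _ _ _ hi (Nat.lt_succ_iff.1 (Finset.mem_range.1 hm)) _ _ _

/-- `x{y}{z} = x{y{z}} + x{y, z} + (-1)^{|y||z|} x{z, y}`. -/
theorem circ_circ {p q s a b r : ℕ} (h₁ : p + q = a) (h₂ : a + s = r) (h₃ : q + s = b)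
    (h₄ : p + b = r) (h₅ : p + q + s = r) (h₆ : p + s + q = r) (x : O p) (y : O q) (z : O s) :
    P.circ h₂ (P.circ h₁ x y) z = P.circ h₄ x (P.circ h₃ y z) + P.brace₂ h₅ x y z
      + (-1 : K) ^ (q * s) • P.brace₂ h₆ x z y := by
  rw [P.brace₂_apply h₅ h₁ h₂, P.brace₂_apply h₆ rfl h₆, P.circ_apply h₁, map_sum,
    LinearMap.sum_apply, P.circ_apply h₄, Finset.sum_comm (f := fun i j =>
      if i < j then P.ins h₆ (j + s) (P.ins rfl i x z) y else 0)]
  simp only [Finset.smul_sum, ← Finset.sum_add_distrib]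
  refine Finset.sum_congr rfl fun i hi => ?_
  have hi' : i ≤ p := Nat.lt_succ_iff.1 (Finset.mem_range.1 hi)
  rw [P.circ_ins h₁ h₂ h₃ h₄ hi', add_comm (Finset.sum _ _) (P.ins h₄ i x _), add_assoc, add_assoc,
    add_comm (Finset.sum _ _)]
  congr 2
  refine Finset.sum_congr rfl fun k hk => ?_
  split_ifs with hki
  · rw [P.ins_par' rfl h₆ h₁ h₂ hki hi', mul_comm]
  · simp

/-- `x{y, z}{w} = x{y, z, w} ± x{y, w, z} ± x{w, y, z} + x{y, z{w}} ± x{y{w}, z}`. -/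
theorem circ_brace₂ {p q s t a b c r : ℕ} (h₁ : p + q + s = a) (h₂ : a + t = r)
    (h₃ : s + t = b) (h₄ : p + q + b = r) (h₅ : q + t = c) (h₆ : p + c + s = r)
    (h₇ : p + q + s + t = r) (h₈ : p + q + t + s = r) (h₉ : p + t + q + s = r)
    (x : O p) (y : O q) (z : O s) (w : O t) :
    P.circ h₂ (P.brace₂ h₁ x y z) w
      = P.brace₃ h₇ x y z w + (-1 : K) ^ (s * t) • P.brace₃ h₈ x y w z
        + (-1 : K) ^ ((s + q) * t) • P.brace₃ h₉ x w y z
        + P.brace₂ h₄ x y (P.circ h₃ z w)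
        + (-1 : K) ^ (s * t) • P.brace₂ h₆ x (P.circ h₅ y w) z := by
  have e : p + t + q = p + q + t := by omega
  have e' : p + c = p + q + t := by omega
  have e₁ : P.brace₃ h₇ x y z w = ∑ i ∈ Finset.range (p + 1), ∑ j ∈ Finset.range (p + 1),
      if i < j then ∑ k ∈ Finset.range (p + 1), if j < k then
        P.ins h₂ (k + q + s) (P.ins h₁ (j + q) (P.ins rfl i x y) z) w else 0 else 0 := by
    rw [P.brace₃_apply h₇ rfl h₁ h₂]
    refine Finset.sum_congr rfl fun i _ => Finset.sum_congr rfl fun j _ => ?_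
    split_ifs with hij <;> simp [hij]
  have e₂ : P.brace₃ h₈ x y w z = ∑ i ∈ Finset.range (p + 1), ∑ j ∈ Finset.range (p + 1),
      if i < j then ∑ k ∈ Finset.range (p + 1), if i < k ∧ k < j then
        P.ins h₈ (j + q + t) (P.ins rfl (k + q) (P.ins rfl i x y) w) z else 0 else 0 := by
    rw [P.brace₃_apply h₈ rfl rfl h₈]
    refine Finset.sum_congr rfl fun i _ => ?_
    rw [Finset.sum_comm]
    refine Finset.sum_congr rfl fun j _ => ?_
    split_ifs with hij
    · rfl
    · exact Finset.sum_eq_zero fun k _ => if_neg (by omega)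
  have e₃ : P.brace₃ h₉ x w y z = ∑ i ∈ Finset.range (p + 1), ∑ j ∈ Finset.range (p + 1),
      if i < j then ∑ k ∈ Finset.range (p + 1), if k < i then
        P.ins h₈ (j + t + q) (P.ins e (i + t) (P.ins rfl k x w) y) z else 0 else 0 := by
    rw [P.brace₃_apply h₉ rfl e h₈, Finset.sum_comm]
    refine Finset.sum_congr rfl fun i _ => ?_
    rw [Finset.sum_comm]
    refine Finset.sum_congr rfl fun j _ => ?_
    split_ifs with hij <;> simp [hij]
  rw [e₁, e₂, e₃, P.brace₂_apply h₁ rfl h₁, P.brace₂_apply h₄ rfl h₄, P.brace₂_apply h₆ e' h₈]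
  simp only [map_sum, LinearMap.sum_apply, Finset.smul_sum (s := Finset.range (p + 1)),
    ← Finset.sum_add_distrib]
  refine Finset.sum_congr rfl fun i hi => Finset.sum_congr rfl fun j hj => ?_
  have hi' : i ≤ p := Nat.lt_succ_iff.1 (Finset.mem_range.1 hi)
  have hj' : j ≤ p := Nat.lt_succ_iff.1 (Finset.mem_range.1 hj)
  split_ifs with hij
  swap
  · simp
  rw [P.circ_ins h₁ h₂ h₃ h₄ (by omega), sum_range_split (rfl : p + q = _) hi',
    sum_range_split (rfl : p + q = _) hi']
  -- `w` is put into an input of `x` in front of `y`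
  have f₁ : (∑ k ∈ Finset.range (p + 1), if k < i then if k < j + q then
      P.ins h₂ k (P.ins h₁ (j + q) (P.ins rfl i x y) z) w else 0 else 0)
      = (-1 : K) ^ ((s + q) * t) • ∑ k ∈ Finset.range (p + 1), if k < i then
        P.ins h₈ (j + t + q) (P.ins e (i + t) (P.ins rfl k x w) y) z else 0 := by
    rw [Finset.smul_sum]
    refine Finset.sum_congr rfl fun k hk => ?_
    split_ifs with h h'
    · rw [P.ins_par' rfl h₈ h₁ h₂ h' (by omega), P.ins_par' rfl e rfl rfl h hi',
        map_smul, LinearMap.smul_apply, smul_smul, ← pow_add, Nat.add_right_comm j q t]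
      congr 2
      ring
    · omega
    · simp
  -- `w` is put into `y`
  have f₂ : (∑ m ∈ Finset.range (q + 1), if i + m < j + q then
      P.ins h₂ (i + m) (P.ins h₁ (j + q) (P.ins rfl i x y) z) w else 0)
      = (-1 : K) ^ (s * t) • P.ins h₈ (j + c) (P.ins e' i x (P.circ h₅ y w)) z := by
    simp only [P.circ_apply h₅, map_sum, LinearMap.sum_apply, Finset.smul_sum]
    refine Finset.sum_congr rfl fun m hm => ?_
    have := Finset.mem_range.1 hm
    rw [if_pos (by omega), P.ins_par' rfl h₈ h₁ h₂ (by omega) (by omega),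
      P.ins_seq rfl rfl h₅ e' hi' (by omega), mul_comm, show j + c = j + q + t by omega]
  -- `w` is put into an input of `x` between `y` and `z`
  have f₃ : (∑ k ∈ Finset.range (p + 1), if i < k then if k + q < j + q then
      P.ins h₂ (k + q) (P.ins h₁ (j + q) (P.ins rfl i x y) z) w else 0 else 0)
      = (-1 : K) ^ (s * t) • ∑ k ∈ Finset.range (p + 1), if i < k ∧ k < j then
        P.ins h₈ (j + q + t) (P.ins rfl (k + q) (P.ins rfl i x y) w) z else 0 := by
    rw [Finset.smul_sum]
    refine Finset.sum_congr rfl fun k hk => ?_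
    by_cases h : i < k ∧ k < j
    · rw [if_pos h.1, if_pos (by omega), if_pos h, P.ins_par' rfl h₈ h₁ h₂ (by omega) (by omega),
        mul_comm]
    · rw [if_neg h, smul_zero]
      split_ifs with h' h''
      · omega
      · rfl
      · rfl
  -- what is behind `z` is neither in front of `y` nor in `y`
  have f₄ : (∑ k ∈ Finset.range (p + 1), if k < i then if j + q < k then
      P.ins h₂ (k + s) (P.ins h₁ (j + q) (P.ins rfl i x y) z) w else 0 else 0) = 0 :=
    Finset.sum_eq_zero fun k _ => by split_ifs <;> first | rfl | omega
  have f₅ : (∑ m ∈ Finset.range (q + 1), if j + q < i + m then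
      P.ins h₂ (i + m + s) (P.ins h₁ (j + q) (P.ins rfl i x y) z) w else 0) = 0 :=
    Finset.sum_eq_zero fun m hm => by
      have := Finset.mem_range.1 hm
      rw [if_neg (by omega)]
  -- `w` is put into an input of `x` behind `z`
  have f₆ : (∑ k ∈ Finset.range (p + 1), if i < k then if j + q < k + q then
      P.ins h₂ (k + q + s) (P.ins h₁ (j + q) (P.ins rfl i x y) z) w else 0 else 0)
      = ∑ k ∈ Finset.range (p + 1), if j < k then
        P.ins h₂ (k + q + s) (P.ins h₁ (j + q) (P.ins rfl i x y) z) w else 0 :=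
    Finset.sum_congr rfl fun k _ => by
      split_ifs <;> first | rfl | omega
  rw [f₁, f₂, f₃, f₄, f₅, f₆]
  abel

/-- `x{y}{z, w}` is the sum of `x{y{z, w}}`, `± x{z, y{w}}`, `x{y{z}, w}`, `x{y, z, w}`,
`± x{z, y, w}` and `± x{z, w, y}`. -/
theorem brace₂_circ {p q s t a b c d r : ℕ} (h₁ : p + q = a) (h₂ : a + s + t = r)
    (h₃ : q + s + t = b) (h₄ : p + b = r) (h₅ : q + t = c) (h₆ : p + s + c = r) (h₇ : q + s = d)
    (h₈ : p + d + t = r) (h₉ : p + q + s + t = r) (h₁₀ : p + s + q + t = r)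
    (h₁₁ : p + s + t + q = r) (x : O p) (y : O q) (z : O s) (w : O t) :
    P.brace₂ h₂ (P.circ h₁ x y) z w
      = P.circ h₄ x (P.brace₂ h₃ y z w) + (-1 : K) ^ (q * s) • P.brace₂ h₆ x z (P.circ h₅ y w)
        + P.brace₂ h₈ x (P.circ h₇ y z) w + P.brace₃ h₉ x y z w
        + (-1 : K) ^ (q * s) • P.brace₃ h₁₀ x z y w
        + (-1 : K) ^ (q * (s + t)) • P.brace₃ h₁₁ x z w y := by
  subst h₁
  have e : p + s + q = p + q + s := by omega
  have e' : p + d = p + q + s := by omega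
  have e₁ : P.brace₃ h₁₀ x z y w = ∑ i ∈ Finset.range (p + 1), ∑ j ∈ Finset.range (p + 1),
      ∑ k ∈ Finset.range (p + 1), if j < i ∧ i < k then
        P.ins h₂ (k + q + s) (P.ins e (i + s) (P.ins rfl j x z) y) w else 0 := by
    rw [P.brace₃_apply h₁₀ rfl e h₂, Finset.sum_comm]
    simp only [Nat.add_right_comm _ s q]
  have e₂ : P.brace₃ h₁₁ x z w y = ∑ i ∈ Finset.range (p + 1), ∑ j ∈ Finset.range (p + 1),
      ∑ k ∈ Finset.range (p + 1), if j < k ∧ k < i then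
        P.ins h₁₁ (i + s + t) (P.ins rfl (k + s) (P.ins rfl j x z) w) y else 0 := by
    rw [P.brace₃_apply h₁₁ rfl rfl h₁₁]
    exact (Finset.sum_congr rfl fun _ _ => Finset.sum_comm).trans Finset.sum_comm
  have e₃ : P.brace₂ h₆ x z (P.circ h₅ y w) = ∑ i ∈ Finset.range (p + 1),
      ∑ j ∈ Finset.range (p + 1), ∑ n ∈ Finset.range (q + 1), if j < i then
        P.ins h₂ (i + s + n) (P.ins e (i + s) (P.ins rfl j x z) y) w else 0 := by
    rw [P.brace₂_apply h₆ rfl h₆, Finset.sum_comm]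
    refine Finset.sum_congr rfl fun i hi => Finset.sum_congr rfl fun j hj => ?_
    have := Finset.mem_range.1 hi
    split_ifs with hij
    · rw [P.circ_apply, map_sum]
      refine Finset.sum_congr rfl fun n hn => ?_
      have := Finset.mem_range.1 hn
      rw [P.ins_seq e h₂ h₅ h₆ (by omega) (by omega)]
    · simp
  have e₄ : P.brace₂ h₈ x (P.circ h₇ y z) w = ∑ i ∈ Finset.range (p + 1),
      ∑ m ∈ Finset.range (q + 1), ∑ k ∈ Finset.range (p + 1), if i < k then
        P.ins h₂ (k + q + s) (P.ins rfl (i + m) (P.ins rfl i x y) z) w else 0 := by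
    rw [P.brace₂_apply h₈ e' h₂]
    refine Finset.sum_congr rfl fun i hi => ?_
    rw [Finset.sum_comm]
    refine Finset.sum_congr rfl fun k _ => ?_
    split_ifs with hik
    · simp only [P.circ_apply, map_sum, LinearMap.sum_apply]
      refine Finset.sum_congr rfl fun m hm => ?_
      have := Finset.mem_range.1 hm
      have := Finset.mem_range.1 hi
      rw [P.ins_seq rfl rfl h₇ e' (by omega) (by omega),
        show k + d = k + q + s by omega]
    · simp
  have e₅ : P.circ h₄ x (P.brace₂ h₃ y z w) = ∑ i ∈ Finset.range (p + 1),
      ∑ m ∈ Finset.range (q + 1), ∑ n ∈ Finset.range (q + 1), if m < n then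
        P.ins h₂ (i + n + s) (P.ins rfl (i + m) (P.ins rfl i x y) z) w else 0 := by
    rw [P.circ_apply h₄]
    refine Finset.sum_congr rfl fun i hi => ?_
    rw [P.brace₂_apply h₃ h₇ (by omega), map_sum]
    refine Finset.sum_congr rfl fun m hm => ?_
    rw [map_sum]
    refine Finset.sum_congr rfl fun n hn => ?_
    have := Finset.mem_range.1 hi
    have := Finset.mem_range.1 hm
    have := Finset.mem_range.1 hn
    split_ifs with hmn
    · rw [P.ins_seq rfl rfl h₇ e' (by omega) (by omega), add_assoc i n s,
        P.ins_seq e' h₂ (by omega) h₄ (by omega) (by omega)]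
    · simp
  have e₆ : P.brace₂ h₂ (P.circ rfl x y) z w = ∑ i ∈ Finset.range (p + 1),
      ∑ j ∈ Finset.range (p + q + 1), ∑ k ∈ Finset.range (p + q + 1), if j < k then
        P.ins h₂ (k + s) (P.ins rfl j (P.ins rfl i x y) z) w else 0 := by
    rw [P.circ_apply, map_sum, LinearMap.sum_apply, LinearMap.sum_apply]
    exact Finset.sum_congr rfl fun i _ => P.brace₂_apply h₂ rfl h₂ _ _ _
  rw [e₁, e₂, e₃, e₄, e₅, e₆, P.brace₃_apply h₉ rfl rfl h₂]
  simp only [Finset.smul_sum (s := Finset.range (p + 1)), ← Finset.sum_add_distrib]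
  refine Finset.sum_congr rfl fun i hi => ?_
  have hi' : i ≤ p := Nat.lt_succ_iff.1 (Finset.mem_range.1 hi)
  -- the inner sum over `k`, split into the inputs of `x` before `i`, of `y`, and of `x` after `i`
  have key : ∀ j, (∑ k ∈ Finset.range (p + q + 1), if j < k then
        P.ins h₂ (k + s) (P.ins rfl j (P.ins rfl i x y) z) w else 0)
      = (∑ k ∈ Finset.range (p + 1), if j < k ∧ k < i then
          P.ins h₂ (k + s) (P.ins rfl j (P.ins rfl i x y) z) w else 0)
        + (∑ n ∈ Finset.range (q + 1), if j < i + n then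
          P.ins h₂ (i + n + s) (P.ins rfl j (P.ins rfl i x y) z) w else 0)
        + ∑ k ∈ Finset.range (p + 1), if i < k ∧ j < k + q then
          P.ins h₂ (k + q + s) (P.ins rfl j (P.ins rfl i x y) z) w else 0 := by
    intro j
    rw [sum_range_split rfl hi']
    refine congrArg₂ _ (congrArg₂ _ ?_ rfl) ?_
    · exact Finset.sum_congr rfl fun k _ => by split_ifs <;> first | rfl | omega
    · exact Finset.sum_congr rfl fun k _ => by split_ifs <;> first | rfl | omega
  -- `z` is put into the input `j` of `x`, in front of `y`
  have g₁ : ∀ j, (if j < i then ∑ k ∈ Finset.range (p + q + 1), if j < k then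
        P.ins h₂ (k + s) (P.ins rfl j (P.ins rfl i x y) z) w else 0 else 0)
      = (-1 : K) ^ (q * (s + t)) • (∑ k ∈ Finset.range (p + 1), if j < k ∧ k < i then
          P.ins h₁₁ (i + s + t) (P.ins rfl (k + s) (P.ins rfl j x z) w) y else 0)
        + (-1 : K) ^ (q * s) • (∑ n ∈ Finset.range (q + 1), if j < i then
          P.ins h₂ (i + s + n) (P.ins e (i + s) (P.ins rfl j x z) y) w else 0)
        + (-1 : K) ^ (q * s) • ∑ k ∈ Finset.range (p + 1), if j < i ∧ i < k then
          P.ins h₂ (k + q + s) (P.ins e (i + s) (P.ins rfl j x z) y) w else 0 := by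
    intro j
    by_cases hji : j < i
    · rw [if_pos hji, key, P.ins_par' rfl e rfl rfl hji hi', mul_comm s q]
      simp only [map_smul, LinearMap.smul_apply, Finset.smul_sum]
      refine congrArg₂ _ (congrArg₂ _ ?_ ?_) ?_ <;> refine Finset.sum_congr rfl fun k hk => ?_
      · split_ifs with h
        · rw [P.ins_par' rfl h₁₁ e h₂ (by omega) (by omega), smul_smul, ← pow_add]
          congr 2; ring
        · simp
      · rw [if_pos (by omega), if_pos hji, Nat.add_right_comm i k s]
      · by_cases hik : i < k
        · rw [if_pos (by omega), if_pos (by omega)]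
        · rw [if_neg (by omega), if_neg (by omega), smul_zero]
    · rw [if_neg hji, Finset.sum_eq_zero fun k _ => if_neg (by omega),
        Finset.sum_eq_zero fun k _ => if_neg hji, Finset.sum_eq_zero fun k _ => if_neg (by omega)]
      simp
  -- `z` is put into the input `m` of `y`
  have g₂ : ∀ m ∈ Finset.range (q + 1), (∑ k ∈ Finset.range (p + q + 1), if i + m < k then
        P.ins h₂ (k + s) (P.ins rfl (i + m) (P.ins rfl i x y) z) w else 0)
      = (∑ n ∈ Finset.range (q + 1), if m < n then
          P.ins h₂ (i + n + s) (P.ins rfl (i + m) (P.ins rfl i x y) z) w else 0)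
        + ∑ k ∈ Finset.range (p + 1), if i < k then
          P.ins h₂ (k + q + s) (P.ins rfl (i + m) (P.ins rfl i x y) z) w else 0 := by
    intro m hm
    have := Finset.mem_range.1 hm
    rw [key, Finset.sum_eq_zero fun k _ => if_neg (by omega), zero_add]
    congr 1 <;> exact Finset.sum_congr rfl fun k _ => by split_ifs <;> first | rfl | omega
  -- `z` is put into the input `j` of `x`, behind `y`
  have g₃ : ∀ j, (if i < j then ∑ k ∈ Finset.range (p + q + 1), if j + q < k then
        P.ins h₂ (k + s) (P.ins rfl (j + q) (P.ins rfl i x y) z) w else 0 else 0)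
      = ∑ k ∈ Finset.range (p + 1), if i < j ∧ j < k then
          P.ins h₂ (k + q + s) (P.ins rfl (j + q) (P.ins rfl i x y) z) w else 0 := by
    intro j
    split_ifs with hij
    · rw [key, Finset.sum_eq_zero fun k _ => if_neg (by omega), Finset.sum_eq_zero fun n hn => by
        have := Finset.mem_range.1 hn
        rw [if_neg (by omega)], zero_add, zero_add]
      exact Finset.sum_congr rfl fun k _ => by split_ifs <;> first | rfl | omega
    · exact (Finset.sum_eq_zero fun k _ => if_neg (by omega)).symm
  rw [sum_range_split rfl hi', Finset.sum_congr rfl fun j _ => g₁ j, Finset.sum_congr rfl g₂,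
    Finset.sum_congr rfl fun j _ => g₃ j]
  simp only [Finset.sum_add_distrib, Finset.smul_sum (s := Finset.range (p + 1))]
  abel

end SignedOperad

namespace SignedOperad

variable {K : Type u} [CommRing K] {O : ℕ → Type v} [∀ p, AddCommGroup (O p)]
  [∀ p, Module K (O p)] (P : SignedOperad K O)

/-! ### The bracket -/

/-- The bracket `[x, y] = x ∘ y - (-1)^{|x||y|} y ∘ x`. -/
def bracket {p q r : ℕ} (h : p + q = r) : O p →ₗ[K] O q →ₗ[K] O r :=
  P.circ h - (-1 : K) ^ (p * q) • (P.circ ((add_comm q p).trans h)).flip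

theorem bracket_apply {p q r : ℕ} (h : p + q = r) (h' : q + p = r) (x : O p) (y : O q) :
    P.bracket h x y = P.circ h x y - (-1 : K) ^ (p * q) • P.circ h' y x := rfl

theorem bracket_skew {p q r : ℕ} (h₁ : p + q = r) (h₂ : q + p = r) (x : O p) (y : O q) :
    P.bracket h₁ x y = -((-1 : K) ^ (p * q) • P.bracket h₂ y x) := by
  rw [P.bracket_apply h₁ h₂, P.bracket_apply h₂ h₁, smul_sub, smul_smul, mul_comm q p, ← pow_add,
    Even.neg_one_pow ⟨_, rfl⟩, one_smul, neg_sub]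

theorem bracket_self {p r : ℕ} (h : p + p = r) (hp : Even p) (x : O p) : P.bracket h x x = 0 := by
  rw [P.bracket_apply h h, (hp.mul_left p).neg_one_pow, one_smul, sub_self]

/-- The associator of `∘`, given by `circ_circ`, is graded symmetric in its last two arguments, and
this implies the Jacobi identity. -/
theorem bracket_jacobi {p q s a b c r : ℕ} (h₁ : q + s = a) (h₂ : p + a = r) (h₃ : p + q = b)
    (h₄ : b + s = r) (h₅ : p + s = c) (h₆ : q + c = r) (x : O p) (y : O q) (z : O s) :
    P.bracket h₂ x (P.bracket h₁ y z)
      = P.bracket h₄ (P.bracket h₃ x y) z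
        + (-1 : K) ^ (p * q) • P.bracket h₆ y (P.bracket h₅ x z) := by
  have e₁ := P.circ_circ (a := b) (b := a) (r := r) (by omega) (by omega) (by omega) (by omega)
    (by omega) (by omega) x y z
  have e₂ := P.circ_circ (a := b) (b := c) (r := r) (by omega) (by omega) (by omega) (by omega)
    (by omega) (by omega) y x z
  have e₃ := P.circ_circ (a := c) (b := a) (r := r) (by omega) (by omega) (by omega) (by omega)
    (by omega) (by omega) x z y
  have e₄ := P.circ_circ (a := c) (b := b) (r := r) (by omega) (by omega) (by omega) (by omega)
    (by omega) (by omega) z x y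
  have e₅ := P.circ_circ (a := a) (b := c) (r := r) (by omega) (by omega) (by omega) (by omega)
    (by omega) (by omega) y z x
  have e₆ := P.circ_circ (a := a) (b := b) (r := r) (by omega) (by omega) (by omega) (by omega)
    (by omega) (by omega) z y x
  rw [P.bracket_apply h₂ (by omega), P.bracket_apply h₁ (by omega), P.bracket_apply h₄ (by omega),
    P.bracket_apply h₃ (by omega), P.bracket_apply h₆ (by omega), P.bracket_apply h₅ (by omega)]
  simp only [map_sub, map_smul, LinearMap.sub_apply, LinearMap.smul_apply, e₁, e₂, e₃, e₄, e₅, e₆]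
  simp only [← h₁, ← h₃, ← h₅, mul_add, add_mul, pow_add, pow_mul]
  rcases neg_one_pow_eq_or K p with hp | hp <;> rcases neg_one_pow_eq_or K q with hq | hq <;>
    rcases neg_one_pow_eq_or K s with hs | hs <;> simp only [hp, hq, hs, one_pow] <;> module

/-- This does not follow from the Jacobi identity in characteristic `3`; here it follows from
`circ_circ`, in which the two braces `x{x, x}` cancel. -/
theorem bracket_bracket_self {p a r : ℕ} (h₁ : p + p = a) (h₂ : p + a = r) (hp : Odd p) (x : O p) :
    P.bracket h₂ x (P.bracket h₁ x x) = 0 := by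
  have e := P.circ_circ (a := a) (b := a) (r := r) (by omega) (by omega) (by omega) (by omega)
    (by omega) (by omega) x x x
  have ha : Even a := ⟨p, h₁.symm⟩
  rw [P.bracket_apply h₂ (by omega), P.bracket_apply h₁ (by omega)]
  simp only [map_sub, map_smul, LinearMap.sub_apply, LinearMap.smul_apply, e,
    (hp.mul hp).neg_one_pow, (ha.mul_left p).neg_one_pow]
  module

/-! ### The differential and the dot product of a multiplication -/

/-- The differential `d x = [π, x]`. -/
def diff (π : O 1) (p : ℕ) : O p →ₗ[K] O (p + 1) := P.bracket (add_comm 1 p) π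

theorem diff_apply (π : O 1) {p : ℕ} (h : 1 + p = p + 1) (x : O p) :
    P.diff π p x = P.circ h π x - (-1 : K) ^ p • P.circ (rfl : p + 1 = _) x π := by
  rw [diff, P.bracket_apply _ rfl, one_mul]

/-- The dot product `x · y = (-1)^{deg x} π{x, y}`. -/
def dot (π : O 1) {p q r : ℕ} (h : p + q + 1 = r) : O p →ₗ[K] O q →ₗ[K] O r :=
  (-1 : K) ^ (p + 1) • P.brace₂ (show 1 + p + q = r by omega) π

theorem dot_apply (π : O 1) {p q r : ℕ} (h : p + q + 1 = r) (h' : 1 + p + q = r) (x : O p)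
    (y : O q) : P.dot π h x y = (-1 : K) ^ (p + 1) • P.brace₂ h' π x y := rfl

/-- At most two operations can be inserted into an operation with two inputs. -/
theorem brace₃_eq_zero {q s t r : ℕ} (h : 1 + q + s + t = r) (π : O 1) (x : O q) (y : O s)
    (z : O t) : P.brace₃ h π x y z = 0 :=
  Finset.sum_eq_zero fun i _ => Finset.sum_eq_zero fun j _ => Finset.sum_eq_zero fun k hk => by
    have := Finset.mem_range.1 hk
    rw [if_neg (by omega)]

/-- Only one pair of inputs of an operation with two inputs is available for a brace. -/
theorem brace₂_two {p q a r : ℕ} (h : 1 + p + q = r) (h₁ : 1 + p = a) (h₂ : a + q = r) (π : O 1)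
    (x : O p) (y : O q) : P.brace₂ h π x y = P.ins h₂ (1 + p) (P.ins h₁ 0 π x) y := by
  rw [P.brace₂_apply h h₁ h₂]
  simp [Finset.sum_range_succ]

/-- The differential is a derivation of the bracket. -/
theorem diff_bracket (π : O 1) {p q r : ℕ} (h : p + q = r) (h₁ : p + 1 + q = r + 1)
    (h₂ : p + (q + 1) = r + 1) (x : O p) (y : O q) :
    P.diff π r (P.bracket h x y)
      = P.bracket h₁ (P.diff π p x) y + (-1 : K) ^ p • P.bracket h₂ x (P.diff π q y) := by
  rw [diff, diff, diff, P.bracket_jacobi h (add_comm 1 r) (add_comm 1 p) h₁ (add_comm 1 q) h₂,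
    one_mul]

/-- This does not follow from `[π, π] = 0` and the Jacobi identity in characteristic `2`;
`circ_circ` is used instead. -/
theorem diff_diff {π : O 1} (hπ : P.circ (rfl : 1 + 1 = _) π π = 0)
    {p : ℕ} (x : O p) : P.diff π (p + 1) (P.diff π p x) = 0 := by
  have e₁ := P.circ_circ (a := 2) (b := p + 1) (r := p + 1 + 1) (by omega) (by omega) (by omega)
    (by omega) (by omega) (by omega) π π x
  have e₂ := P.circ_circ (a := p + 1) (b := p + 1) (r := p + 1 + 1) (by omega) (by omega)
    (by omega) (by omega) (by omega) (by omega) π x π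
  have e₃ := P.circ_circ (a := p + 1) (b := 2) (r := p + 1 + 1) (by omega) (by omega) (by omega)
    (by omega) (by omega) (by omega) x π π
  rw [hπ] at e₁ e₃
  simp only [map_zero, LinearMap.zero_apply] at e₁ e₃
  rw [P.diff_apply π (by omega), P.diff_apply π (by omega)]
  simp only [map_sub, map_smul, LinearMap.sub_apply, LinearMap.smul_apply, e₂, e₃]
  simp only [pow_add, mul_one, one_mul, pow_one] at e₁ ⊢
  rcases neg_one_pow_eq_or K p with hp | hp <;> simp only [hp] at e₁ ⊢ <;>
    linear_combination (norm := module) (-1 : K) • e₁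

/-- Both products are, up to sign, the insertion of `x`, `y` and `z` into the three inputs of
`π ∘₀ π = -π ∘₁ π`. -/
theorem dot_assoc {π : O 1} (hπ : P.circ (rfl : 1 + 1 = _) π π = 0)
    {p q s a b r : ℕ} (h₁ : p + q + 1 = a) (h₂ : a + s + 1 = r) (h₃ : q + s + 1 = b)
    (h₄ : p + b + 1 = r) (x : O p) (y : O q) (z : O s) :
    P.dot π h₂ (P.dot π h₁ x y) z = P.dot π h₄ x (P.dot π h₃ y z) := by
  have h : P.ins (rfl : 1 + 1 = _) 1 π π = -P.ins (rfl : 1 + 1 = _) 0 π π := by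
    rw [P.circ_apply, Finset.sum_range_succ, Finset.sum_range_one] at hπ
    exact eq_neg_of_add_eq_zero_right hπ
  have e : 1 + a = p + 2 + q := by omega
  have e₁ : P.brace₂ (show 1 + a + s = r by omega) π
        (P.brace₂ (show 1 + p + q = a by omega) π x y) z
      = P.ins (show p + 2 + q + s = r by omega) (p + q + 2)
          (P.ins rfl (p + 1)
            (P.ins (show 1 + 1 + p = p + 2 by omega) 0 (P.ins rfl 0 π π) x) y) z := by
    rw [P.brace₂_two _ e (by omega), P.brace₂_two _ rfl (by omega),
      ← P.ins_seq (show 1 + (1 + p) = p + 2 by omega) rfl _ _ (Nat.zero_le _) le_rfl,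
      ← P.ins_seq (rfl : 1 + 1 = _) (by omega) rfl _ (Nat.zero_le _) (Nat.zero_le _),
      show 1 + a = p + q + 2 by omega, Nat.zero_add, Nat.zero_add, add_comm 1 p]
  have e₂ : P.brace₂ (show 1 + p + b = r by omega) π x
        (P.brace₂ (show 1 + q + s = b by omega) π y z)
      = (-1 : K) ^ (p + 1) • P.ins (show p + 2 + q + s = r by omega) (p + q + 2)
          (P.ins rfl (p + 1)
            (P.ins (show 1 + 1 + p = p + 2 by omega) 0 (P.ins rfl 0 π π) x) y) z := by
    have e₃ := P.ins_par (i := 0) (j := 1) rfl (show 1 + p + 1 = p + 2 by omega) rfl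
      (by omega) Nat.zero_lt_one le_rfl π x π
    rw [P.brace₂_two _ rfl (by omega), P.brace₂_two _ rfl (by omega),
      ← P.ins_seq (show 1 + p + (1 + q) = p + 2 + q by omega) (by omega) _ _ le_rfl le_rfl,
      ← P.ins_seq (show 1 + p + 1 = p + 2 by omega) rfl _ _ le_rfl (Nat.zero_le _), add_zero, e₃, h]
    simp only [map_neg, map_smul, LinearMap.neg_apply, LinearMap.smul_apply, mul_one, pow_succ]
    rw [show 1 + p + (1 + q) = p + q + 2 by omega, add_comm 1 p]
    module
  rw [P.dot_apply π h₂ (by omega), P.dot_apply π h₁ (by omega), P.dot_apply π h₄ (by omega),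
    P.dot_apply π h₃ (by omega)]
  simp only [map_smul, LinearMap.smul_apply, e₁, e₂]
  simp only [← h₁, pow_add, pow_one]
  rcases neg_one_pow_eq_or K p with hp | hp <;> simp only [hp] <;> module

/-- The differential is a derivation of the dot product. -/
theorem diff_dot {π : O 1} (hπ : P.circ (rfl : 1 + 1 = _) π π = 0)
    {p q r : ℕ} (h : p + q + 1 = r) (h₁ : p + 1 + q + 1 = r + 1)
    (h₂ : p + (q + 1) + 1 = r + 1) (x : O p) (y : O q) :
    P.diff π r (P.dot π h x y)
      = P.dot π h₁ (P.diff π p x) y + (-1 : K) ^ (p + 1) • P.dot π h₂ x (P.diff π q y) := by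
  have e₁ := P.circ_brace₂ (a := r) (b := q + 1) (c := p + 1) (r := r + 1) (by omega) (by omega)
    (by omega) (by omega) (by omega) (by omega) (by omega) (by omega) (by omega) π x y π
  have e₂ := P.brace₂_circ (a := 2) (b := r) (c := q + 1) (d := p + 1) (r := r + 1) (by omega)
    (by omega) (by omega) (by omega) (by omega) (by omega) (by omega) (by omega) (by omega)
    (by omega) (by omega) π π x y
  rw [hπ] at e₂
  simp only [brace₃_eq_zero, map_zero, LinearMap.zero_apply, smul_zero, add_zero, zero_add] at e₁ e₂
  rw [P.diff_apply π (by omega), P.dot_apply π h (by omega), P.dot_apply π h₁ (by omega),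
    P.dot_apply π h₂ (by omega), P.diff_apply π (by omega), P.diff_apply π (by omega)]
  simp only [map_sub, map_smul, LinearMap.sub_apply, LinearMap.smul_apply, e₁]
  simp only [← h, pow_add, mul_one, one_mul, pow_one] at e₂ ⊢
  rcases neg_one_pow_eq_or K p with hp | hp <;> rcases neg_one_pow_eq_or K q with hq | hq <;>
    simp only [hp, hq] at e₂ ⊢
  · linear_combination (norm := module) (1 : K) • e₂
  · linear_combination (norm := module) (1 : K) • e₂
  · linear_combination (norm := module) (-1 : K) • e₂
  · linear_combination (norm := module) (-1 : K) • e₂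

/-- The dot product is graded commutative up to the homotopy `x ∘ y`. -/
theorem diff_circ (π : O 1) {p q r : ℕ} (h : p + q = r) (h₁ : p + 1 + q = r + 1)
    (h₂ : p + (q + 1) = r + 1) (h₃ : p + q + 1 = r + 1) (h₄ : q + p + 1 = r + 1) (x : O p)
    (y : O q) :
    P.diff π r (P.circ h x y)
      = P.circ h₁ (P.diff π p x) y + (-1 : K) ^ p • P.circ h₂ x (P.diff π q y)
        + (-1 : K) ^ p •
          (P.dot π h₃ x y - (-1 : K) ^ ((p + 1) * (q + 1)) • P.dot π h₄ y x) := by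
  have e₁ := P.circ_circ (a := p + 1) (b := r) (r := r + 1) (by omega) (by omega) (by omega)
    (by omega) (by omega) (by omega) π x y
  have e₂ := P.circ_circ (a := r) (b := q + 1) (r := r + 1) (by omega) (by omega) (by omega)
    (by omega) (by omega) (by omega) x y π
  have e₃ := P.circ_circ (a := p + 1) (b := q + 1) (r := r + 1) (by omega) (by omega) (by omega)
    (by omega) (by omega) (by omega) x π y
  rw [P.diff_apply π (by omega), P.dot_apply π h₃ (by omega), P.dot_apply π h₄ (by omega),
    P.diff_apply π (by omega), P.diff_apply π (by omega)]
  simp only [map_sub, map_smul, LinearMap.sub_apply, LinearMap.smul_apply, e₁, e₂, e₃]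
  simp only [← h, mul_add, add_mul, pow_add, pow_mul, mul_one, one_mul, pow_one]
  rcases neg_one_pow_eq_or K p with hp | hp <;> rcases neg_one_pow_eq_or K q with hq | hq <;>
    simp only [hp, hq, one_pow] <;> module

/-- The bracket is a graded derivation of the dot product up to the homotopy `x{y, z}`. -/
theorem diff_brace₂ (π : O 1) {p q s a b c d r : ℕ} (h₀ : p + q + s = d) (h₁ : q + s + 1 = a)
    (h₂ : p + a = r) (h₃ : p + q = b) (h₄ : b + s + 1 = r) (h₅ : p + s = c) (h₆ : q + c + 1 = r)
    (h₇ : p + 1 + q + s = d + 1) (h₈ : p + (q + 1) + s = d + 1) (h₉ : p + q + (s + 1) = d + 1)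
    (hr : r = d + 1) (x : O p) (y : O q) (z : O s) :
    P.diff π d (P.brace₂ h₀ x y z)
      = P.brace₂ h₇ (P.diff π p x) y z + (-1 : K) ^ p • P.brace₂ h₈ x (P.diff π q y) z
        + (-1 : K) ^ (p + q) • P.brace₂ h₉ x y (P.diff π s z)
        + (-1 : K) ^ (p + q + 1) • (P.bracket (h₂.trans hr) x (P.dot π h₁ y z)
          - P.dot π (h₄.trans hr) (P.bracket h₃ x y) z
          - (-1 : K) ^ (p * (q + 1)) • P.dot π (h₆.trans hr) y (P.bracket h₅ x z)) := by
  subst hr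
  have e₁ := P.circ_brace₂ (a := d) (b := s + 1) (c := q + 1) (r := d + 1) (by omega) (by omega)
    (by omega) (by omega) (by omega) (by omega) (by omega) (by omega) (by omega) x y z π
  have e₂ := P.brace₂_circ (a := p + 1) (b := d) (c := c) (d := b) (r := d + 1) (by omega)
    (by omega) (by omega) (by omega) (by omega) (by omega) (by omega) (by omega) (by omega)
    (by omega) (by omega) π x y z
  have e₃ := P.brace₂_circ (a := p + 1) (b := a) (c := s + 1) (d := q + 1) (r := d + 1) (by omega)
    (by omega) (by omega) (by omega) (by omega) (by omega) (by omega) (by omega) (by omega)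
    (by omega) (by omega) x π y z
  have e₄ := P.circ_brace₂ (a := a) (b := c) (c := b) (r := d + 1) (by omega) (by omega)
    (by omega) (by omega) (by omega) (by omega) (by omega) (by omega) (by omega) π y z x
  simp only [brace₃_eq_zero, smul_zero, add_zero, zero_add] at e₂ e₄
  rw [P.diff_apply π (by omega), P.bracket_apply _ (by omega), P.dot_apply π h₁ (by omega),
    P.dot_apply π _ (by omega), P.dot_apply π _ (by omega), P.bracket_apply h₃ (by omega),
    P.bracket_apply h₅ (by omega), P.diff_apply π (by omega), P.diff_apply π (by omega),
    P.diff_apply π (by omega)]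
  simp only [map_sub, map_smul, LinearMap.sub_apply, LinearMap.smul_apply, e₁, e₂, e₃, e₄]
  simp only [← h₀, ← h₁, ← h₃, mul_add, pow_add, pow_mul, mul_one, one_mul, pow_one]
  rcases neg_one_pow_eq_or K p with hp | hp <;> rcases neg_one_pow_eq_or K q with hq | hq <;>
    rcases neg_one_pow_eq_or K s with hs | hs <;> simp only [hp, hq, hs, one_pow] <;> module

end SignedOperad

/-! ### Pre-operadic systems and insertion -/

section Insertion

variable {U : ℕ → Type}

/-- The function `Rᵢ(k; n₁, …, n_k)` with values in `U t`, for `t = nᵢ`. -/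
def SystemData.Rto (S : SystemData U) {k N t : ℕ} (n : Fin k → ℕ) (hn : ∀ i, 0 < n i)
    (hN : ∑ i, n i = N) (i : Fin k) (h : n i = t) (r : U N) : U t := h ▸ S.R n hn hN i r

/-- All functions `R₁(1; N)` are identities. This is not among the conditions on a pre-operadic
system, but the parallel axiom for the insertion of cochains depends on it: a cochain in one of the
slots is composed with the `Id_A` of another insertion, that is, with `R₁(1; N)`. -/
def SystemData.IsUnital (S : SystemData U) : Prop :=
  ∀ (N : ℕ) (hN : 0 < N) (r : U N), S.R (fun _ : Fin 1 => N) (fun _ => hN) (by simp) 0 r = r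

namespace SystemData

variable {S : SystemData U} {k N M t t' : ℕ}

theorem Rto_congr {n n' : Fin k → ℕ} {hn : ∀ i, 0 < n i} {hn' : ∀ i, 0 < n' i}
    {hN : ∑ i, n i = N} {hN' : ∑ i, n' i = N} {i i' : Fin k} {h : n i = t} {h' : n' i' = t}
    (e : n = n') (e' : i = i') (r : U N) : S.Rto n hn hN i h r = S.Rto n' hn' hN' i' h' r := by
  subst e e'; rfl

theorem R₀_congr {n n' : Fin k → ℕ} {hn : ∀ i, 0 < n i} {hn' : ∀ i, 0 < n' i}
    {hN : ∑ i, n i = N} {hN' : ∑ i, n' i = N} (e : n = n') (r : U N) :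
    S.R₀ n hn hN r = S.R₀ n' hn' hN' r := by
  subst e; rfl

theorem IsUnital.Rto_eq (hU : S.IsUnital) (n : Fin 1 → ℕ) (hn : ∀ i, 0 < n i)
    (hN : ∑ i, n i = N) (i : Fin 1) (h : n i = N) (r : U N) : S.Rto n hn hN i h r = r := by
  obtain rfl : i = 0 := Subsingleton.elim _ _
  obtain rfl : n = fun _ => N := funext fun l => by rw [Subsingleton.elim l 0, h]
  exact hU N (hn 0) r

theorem IsPreOperadic.R₀_eq (hS : S.IsPreOperadic) (hk : 0 < k) (n : Fin k → ℕ)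
    (hn : ∀ i, 0 < n i) (hN : ∑ i, n i = k) (h : ∀ i, n i = 1) (r : U k) : S.R₀ n hn hN r = r := by
  obtain rfl : n = fun _ => 1 := funext h
  exact hS.identity k hk r

theorem IsPreOperadic.R₀_R₀ (hS : S.IsPreOperadic) (hk : 0 < k)
    {n : Fin k → ℕ} {hn : ∀ i, 0 < n i} {hN : ∑ i, n i = N}
    {m : Fin N → ℕ} {hm : ∀ l, 0 < m l} {hM : ∑ l, m l = M} {T : Fin k → ℕ}
    {hT : ∀ i, 0 < T i} {hTM : ∑ i, T i = M} (e : ∀ i, ∑ j, m (block n hN i j) = T i) (r : U M) :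
    S.R₀ n hn hN (S.R₀ m hm hM r) = S.R₀ T hT hTM r := by
  obtain rfl := funext e
  exact hS.idempotency hk n hn hN m hm hM r

theorem IsPreOperadic.Rto_R₀ (hS : S.IsPreOperadic) (hk : 0 < k)
    {n : Fin k → ℕ} {hn : ∀ i, 0 < n i} {hN : ∑ i, n i = N}
    {m : Fin N → ℕ} {hm : ∀ l, 0 < m l} {hM : ∑ l, m l = M} {T : Fin k → ℕ}
    {hT : ∀ i, 0 < T i} {hTM : ∑ i, T i = M} (e : ∀ i, ∑ j, m (block n hN i j) = T i)
    (i : Fin k) (h : n i = t) (h' : T i = t') {m' : Fin t → ℕ} {hm' : ∀ j, 0 < m' j}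
    {hM' : ∑ j, m' j = t'} (e' : ∀ j, m (block n hN i j) = m' (Fin.cast h j)) (r : U M) :
    S.Rto n hn hN i h (S.R₀ m hm hM r) = S.R₀ m' hm' hM' (S.Rto T hT hTM i h' r) := by
  obtain rfl := funext e
  subst h
  obtain rfl : m' = fun j => m (block n hN i j) := funext fun j => (e' j).symm
  subst hM'
  exact hS.commutativity hk n hn hN m hm hM r i

theorem IsPreOperadic.Rto_Rto (hS : S.IsPreOperadic) (hk : 0 < k)
    {n : Fin k → ℕ} {hn : ∀ i, 0 < n i} {hN : ∑ i, n i = N}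
    {m : Fin N → ℕ} {hm : ∀ l, 0 < m l} {hM : ∑ l, m l = M} {T : Fin k → ℕ}
    {hT : ∀ i, 0 < T i} {hTM : ∑ i, T i = M} (e : ∀ i, ∑ j, m (block n hN i j) = T i)
    (i : Fin k) (h : n i = t) (h' : T i = t') {m' : Fin t → ℕ} {hm' : ∀ j, 0 < m' j}
    {hM' : ∑ j, m' j = t'} (e' : ∀ j, m (block n hN i j) = m' (Fin.cast h j)) {l : Fin N}
    {j : Fin t} (hl : l = block n hN i (Fin.cast h.symm j)) {b : ℕ} (hb : m l = b)
    (hb' : m' j = b) (r : U M) :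
    S.Rto m hm hM l hb r = S.Rto m' hm' hM' j hb' (S.Rto T hT hTM i h' r) := by
  obtain rfl := funext e
  subst h
  obtain rfl : m' = fun j => m (block n hN i j) := funext fun j => (e' j).symm
  subst hM' hl hb
  exact hS.closure hk n hn hN m hm hM r i j

end SystemData

/-- The sizes of the blocks when `q + 1` inputs are inserted into the input `i` of an operation with
`p + 1` inputs. -/
def insSizes (p q i : ℕ) (j : Fin (p + 1)) : ℕ := if (j : ℕ) = i then q + 1 else 1

theorem insSizes_pos (p q i : ℕ) (j : Fin (p + 1)) : 0 < insSizes p q i j := by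
  unfold insSizes; split_ifs <;> omega

/-- The sum of `k` consecutive block sizes of an insertion into the input `d`, from the `c`-th
on. -/
theorem sum_add_ite (k c d s : ℕ) :
    ∑ t : Fin k, (if c + (t : ℕ) = d then s + 1 else 1)
      = k + if c ≤ d ∧ d < c + k then s else 0 := by
  induction k with
  | zero => simp
  | succ k ih =>
    rw [Fin.sum_univ_castSucc]
    simp only [Fin.val_castSucc, Fin.val_last, ih]
    split_ifs <;> omega

theorem sum_insSizes {p q r i : ℕ} (h : p + q = r) (hi : i ≤ p) :
    ∑ j, insSizes p q i j = r + 1 := by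
  have := sum_add_ite (p + 1) 0 i q
  simp only [Nat.zero_add] at this
  unfold insSizes
  rw [this, if_pos (by omega)]
  omega

theorem psum_insSizes (p q i : ℕ) : ∀ l, l ≤ p + 1 →
    psum (insSizes p q i) l = if l ≤ i then l else l + q := by
  intro l
  induction l with
  | zero => simp [psum_zero]
  | succ l ih =>
    intro hl
    have := psum_succ (insSizes p q i) ⟨l, hl⟩
    simp only [insSizes] at this
    rw [this, ih (by omega)]
    split_ifs <;> omega

theorem sum_insSizes_block {p a s d : ℕ} (n : Fin (p + 1) → ℕ) (hN : ∑ j, n j = a + 1)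
    (l : Fin (p + 1)) :
    ∑ t, insSizes a s d (block n hN l t)
      = n l + if psum n l ≤ d ∧ d < psum n l + n l then s else 0 := by
  simp only [insSizes, block_val, sum_add_ite]

/-- The sizes of the blocks when `q + 1` inputs are inserted into the input `i` and `s + 1` inputs
into the input `j` of an operation with `p + 1` inputs. -/
def insSizes₂ (p q i s j : ℕ) (l : Fin (p + 1)) : ℕ :=
  if (l : ℕ) = i then q + 1 else if (l : ℕ) = j then s + 1 else 1

theorem insSizes₂_pos (p q i s j : ℕ) (l : Fin (p + 1)) : 0 < insSizes₂ p q i s j l := by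
  unfold insSizes₂; split_ifs <;> omega

theorem insSizes₂_left {p q i s j : ℕ} (hi : i < p + 1) : insSizes₂ p q i s j ⟨i, hi⟩ = q + 1 :=
  if_pos rfl

theorem insSizes₂_right {p q i s j : ℕ} (hj : j < p + 1) (hij : i ≠ j) :
    insSizes₂ p q i s j ⟨j, hj⟩ = s + 1 :=
  (if_neg hij.symm).trans (if_pos rfl)

theorem insSizes₂_comm {i j : ℕ} (hij : i ≠ j) (p q s : ℕ) :
    insSizes₂ p q i s j = insSizes₂ p s j q i := by
  funext l; unfold insSizes₂; split_ifs <;> omega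

/-- The block sizes of two insertions into different inputs; `d` is the number that the input `j`
gets after the first insertion. -/
theorem sum_block_insSizes₂ {p q a s i j d : ℕ} (h : p + q = a) (hi : i ≤ p)
    (hij : i ≠ j) (hd : d = if j ≤ i then j else j + q) (l : Fin (p + 1)) :
    ∑ t, insSizes a s d (block (insSizes p q i) (sum_insSizes h hi) l t)
      = insSizes₂ p q i s j l := by
  rw [sum_insSizes_block, psum_insSizes _ _ _ _ l.2.le]
  have := l.2
  simp only [insSizes, insSizes₂, hd]
  split_ifs <;> omega

theorem sum_insSizes₂ {p q a s r i j : ℕ} (h : p + q = a) (h' : a + s = r) (hi : i ≤ p)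
    (hj : j ≤ p) (hij : i ≠ j) : ∑ l, insSizes₂ p q i s j l = r + 1 := by
  rw [← Finset.sum_congr rfl fun l _ => sum_block_insSizes₂ h hi hij rfl l]
  refine sum_block _ _ _ (sum_insSizes h' ?_)
  split_ifs <;> omega

namespace SystemData

variable (S : SystemData U)

/-- The function `R₀` that belongs to an insertion into the input `i`. -/
def outer {p q r i : ℕ} (h : p + q = r) (hi : i ≤ p) : U (r + 1) → U (p + 1) :=
  S.R₀ (insSizes p q i) (insSizes_pos p q i) (sum_insSizes h hi)

/-- The function `Rᵢ` that belongs to an insertion into the input `i`. -/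
def inner {p q r i : ℕ} (h : p + q = r) (hi : i ≤ p) : U (r + 1) → U (q + 1) :=
  S.Rto (insSizes p q i) (insSizes_pos p q i) (sum_insSizes h hi) ⟨i, Nat.lt_succ_of_le hi⟩
    (if_pos rfl)

end SystemData

/-- The block sizes of an insertion of `z` into the input `j` of the inserted `y` add up to those of
an insertion of the composite. -/
theorem sum_block_seq {p q s a b i j : ℕ} (h₁ : p + q = a) (h₃ : q + s = b) (hi : i ≤ p)
    (hj : j ≤ q) (l : Fin (p + 1)) :
    ∑ t, insSizes a s (i + j) (block (insSizes p q i) (sum_insSizes h₁ hi) l t)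
      = insSizes p b i l := by
  rw [sum_insSizes_block, psum_insSizes _ _ _ _ l.2.le]
  simp only [insSizes]
  split_ifs <;> omega

theorem insSizes_block_seq {p q s a i j : ℕ} (h₁ : p + q = a) (hi : i ≤ p)
    (t : Fin (insSizes p q i ⟨i, Nat.lt_succ_of_le hi⟩)) :
    insSizes a s (i + j) (block (insSizes p q i) (sum_insSizes h₁ hi) _ t)
      = insSizes q s j (Fin.cast (if_pos rfl) t) := by
  simp only [insSizes, block_val, psum_insSizes _ _ _ _ (show i ≤ p + 1 by omega), if_pos le_rfl,
    Nat.add_left_cancel_iff]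
  rfl

namespace SystemData.IsPreOperadic

variable {S : SystemData U} {p q s a b r i j d : ℕ}

section Sequential

variable (h₁ : p + q = a) (h₂ : a + s = r) (h₃ : q + s = b) (h₄ : p + b = r) (hi : i ≤ p)
  (hj : j ≤ q) (ρ : U (r + 1))

theorem outer_outer_seq (hS : S.IsPreOperadic) :
    S.outer h₁ hi (S.outer h₂ (show i + j ≤ a by omega) ρ)
    = S.outer h₄ hi ρ :=
  hS.R₀_R₀ p.succ_pos (sum_block_seq h₁ h₃ hi hj) ρ

theorem inner_outer_seq (hS : S.IsPreOperadic) :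
    S.inner h₁ hi (S.outer h₂ (show i + j ≤ a by omega) ρ)
    = S.outer h₃ hj (S.inner h₄ hi ρ) :=
  hS.Rto_R₀ p.succ_pos (sum_block_seq h₁ h₃ hi hj) _ _ _ (insSizes_block_seq h₁ hi) ρ

theorem inner_seq (hS : S.IsPreOperadic) :
    S.inner h₂ (show i + j ≤ a by omega) ρ = S.inner h₃ hj (S.inner h₄ hi ρ) := by
  refine hS.Rto_Rto (hn := insSizes_pos p q i) p.succ_pos (sum_block_seq h₁ h₃ hi hj)
    _ _ _ (insSizes_block_seq h₁ hi) ?_ _ _ ρ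
  ext
  rw [block_val, psum_insSizes _ _ _ _ (show i ≤ p + 1 by omega), if_pos le_rfl]
  rfl

end Sequential

section Parallel

variable (h₁ : p + q = a) (h₂ : a + s = r) (hi : i ≤ p) (hj : j ≤ p) (hij : i ≠ j)
  (hda : d ≤ a) (ρ : U (r + 1))

/-- The first of the three lemmas on insertions into different inputs: the functions `R` for the two
insertions, one after the other, are those for both at once. -/
theorem outer_outer_par (hd : d = if j ≤ i then j else j + q)
    (hS : S.IsPreOperadic) : S.outer h₁ hi (S.outer h₂ hda ρ)
    = S.R₀ (insSizes₂ p q i s j) (insSizes₂_pos _ _ _ _ _) (sum_insSizes₂ h₁ h₂ hi hj hij) ρ :=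
  hS.R₀_R₀ p.succ_pos (sum_block_insSizes₂ h₁ hi hij hd) ρ

theorem inner_outer_par (hd : d = if j ≤ i then j else j + q)
    (hS : S.IsPreOperadic) : S.inner h₁ hi (S.outer h₂ hda ρ)
    = S.Rto (insSizes₂ p q i s j) (insSizes₂_pos _ _ _ _ _) (sum_insSizes₂ h₁ h₂ hi hj hij)
      ⟨i, Nat.lt_succ_of_le hi⟩ (insSizes₂_left _) ρ := by
  refine (hS.Rto_R₀ (m' := fun _ => 1) (hm' := fun _ => Nat.one_pos) (hM' := by simp) p.succ_pos
    (sum_block_insSizes₂ h₁ hi hij hd) ⟨i, Nat.lt_succ_of_le hi⟩ (if_pos rfl)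
    (insSizes₂_left _) ?_ ρ).trans
      (hS.R₀_eq q.succ_pos _ _ _ (fun _ => rfl) _)
  intro t
  have ht : (t : ℕ) < q + 1 := t.2.trans_eq (if_pos rfl)
  simp only [insSizes, block_val, psum_insSizes _ _ _ _ (show i ≤ p + 1 by omega), if_pos le_rfl]
  rw [if_neg]
  split_ifs at hd <;> omega

theorem inner_par (hd : d = if j ≤ i then j else j + q)
    (hS : S.IsPreOperadic) (hU : S.IsUnital) : S.inner h₂ hda ρ
    = S.Rto (insSizes₂ p q i s j) (insSizes₂_pos _ _ _ _ _) (sum_insSizes₂ h₁ h₂ hi hj hij)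
      ⟨j, Nat.lt_succ_of_le hj⟩ (insSizes₂_right _ hij) ρ := by
  refine (hS.Rto_Rto (hn := insSizes_pos p q i) (m' := fun _ => s + 1)
    (hm' := fun _ => s.succ_pos) (hM' := by simp) p.succ_pos (sum_block_insSizes₂ h₁ hi hij hd)
    ⟨j, Nat.lt_succ_of_le hj⟩ (if_neg hij.symm) (insSizes₂_right _ hij) ?_ (j := 0) ?_ _ rfl
    ρ).trans (hU.Rto_eq _ _ _ _ _ _)
  · intro t
    have ht : (t : ℕ) < 1 := t.2.trans_eq (if_neg hij.symm)
    simp only [insSizes, block_val, psum_insSizes _ _ _ _ (show j ≤ p + 1 by omega)]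
    rw [if_pos]
    omega
  · ext
    rw [block_val, psum_insSizes _ _ _ _ (show j ≤ p + 1 by omega)]
    exact hd

end Parallel

end SystemData.IsPreOperadic

end Insertion

/-! ### The operad of cochains -/

section CochainOperad

variable {K : Type u} {A : Type v} [Field K] [AddCommGroup A] [Module K A] {U : ℕ → Type}

/-- The value of a cochain on the first terms of an infinite sequence. -/
def ev {k : ℕ} (x : Cochain K A U k) (ρ : U k) (a : ℕ → A) : A := x ρ fun j => a j

theorem cochain_ext {k : ℕ} {x y : Cochain K A U k} (h : ∀ ρ a, ev x ρ a = ev y ρ a) : x = y := by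
  funext ρ
  ext v
  have := h ρ fun j => if hj : j < k then v ⟨j, hj⟩ else 0
  simpa [ev] using this

theorem ev_congr {k : ℕ} (x : Cochain K A U k) {ρ ρ' : U k} (hρ : ρ = ρ') {a a' : ℕ → A}
    (h : ∀ j < k, a j = a' j) : ev x ρ a = ev x ρ' a' := by
  subst hρ
  exact congrArg (x ρ) (funext fun j => h j j.2)

/-- The sequence in which the terms `aᵢ, …, aᵢ₊q` of `a` are replaced by the single term `b`. -/
def contract (i q : ℕ) (b : A) (a : ℕ → A) (j : ℕ) : A :=
  if j < i then a j else if j = i then b else a (j + q)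

variable (S : SystemData U)

theorem slot_apply_none {s : ℕ} {q : Fin s → ℕ} (y : ∀ b, Cochain K A U (q b + 1))
    {o : Option (Fin s)} (ho : o = none) (ρ : U (o.elim 0 q + 1)) (c : ℕ) (a : ℕ → A) :
    (slot y o ρ fun l => a (c + l)) = a c := by
  subst ho; rfl

theorem slot_apply_some {s : ℕ} {q : Fin s → ℕ} (y : ∀ b, Cochain K A U (q b + 1))
    {o : Option (Fin s)} {b : Fin s} (ho : o = some b) (h : o.elim 0 q + 1 = q b + 1)
    (ρ : U (o.elim 0 q + 1)) (c : ℕ) (a : ℕ → A) :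
    (slot y o ρ fun l => a (c + l)) = ev (y b) (h ▸ ρ) fun l => a (c + l) := by
  subst ho; rfl

/-- The value of the summand of a brace that belongs to the insertion of `y₁, …, y_s` into the
inputs `e 1 < ⋯ < e s`. -/
theorem ev_gamma_slot {p s r : ℕ} {q : Fin s → ℕ} (e : Fin s ↪o Fin (p + 1))
    (n : Fin (p + 1) → ℕ) (hn : ∀ j, 0 < n j) (hN : ∑ j, n j = r + 1)
    (hq : ∀ j, slotDeg q e j + 1 = n j) (hqN : ∑ j, (slotDeg q e j + 1) = r + 1)
    (x : Cochain K A U (p + 1)) (y : ∀ b, Cochain K A U (q b + 1)) (ρ : U (r + 1)) (a : ℕ → A)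
    (V : ℕ → A) (h₀ : ∀ j, (∀ b, e b ≠ j) → V j = a (psum n j))
    (h₁ : ∀ b (h : n (e b) = q b + 1),
      V (e b) = ev (y b) (S.Rto n hn hN (e b) h ρ) fun l => a (psum n (e b) + l)) :
    ev (gamma S (fun j => slotDeg q e j + 1) (fun _ => Nat.succ_pos _) hqN x
      fun j => slot y (Function.partialInv e j)) ρ a = ev x (S.R₀ n hn hN ρ) V := by
  obtain rfl := funext hq
  refine (gamma_apply S (fun j => slotDeg q e j + 1) (fun _ => Nat.succ_pos _) hqN x
    (fun j => slot y (Function.partialInv e j)) ρ fun j => a j).trans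
      (congrArg (x _) (funext fun j => ?_))
  simp only [block_val]
  obtain ho | ⟨b, ho⟩ := Option.eq_none_or_eq_some (Function.partialInv e j)
  · rw [h₀ j fun b hb => by rw [← hb, Function.partialInv_left e.injective] at ho; simp at ho]
    exact slot_apply_none y ho _ _ a
  · obtain rfl := (e.injective.isPartialInv b j).1 ho
    have h : (Function.partialInv e (e b)).elim 0 q + 1 = q b + 1 := by rw [ho]; rfl
    rw [h₁ b h]
    exact slot_apply_some y ho h _ _ a

/-- The insertion into the input `i`, as an embedding of a one-element set. -/
def singleEmb (p i : ℕ) : Fin 1 ↪o Fin (p + 1) :=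
  OrderEmbedding.ofStrictMono (fun _ => ⟨min i p, by omega⟩) (Subsingleton.strictMono _)

theorem singleEmb_apply {p i : ℕ} (hi : i ≤ p) (b : Fin 1) :
    singleEmb p i b = ⟨i, Nat.lt_succ_of_le hi⟩ :=
  Fin.ext (min_eq_left hi)

theorem slotDeg_single {p q i : ℕ} (hi : i ≤ p) (j : Fin (p + 1)) :
    slotDeg (fun _ : Fin 1 => q) (singleEmb p i) j + 1 = insSizes p q i j := by
  unfold slotDeg insSizes
  split_ifs with h
  · have : j = singleEmb p i 0 := by rw [singleEmb_apply hi]; exact Fin.ext h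
    rw [this, Function.partialInv_left (singleEmb p i).injective]
    rfl
  · rw [partialInv_none _ _ fun hj => h (by rw [hj, singleEmb_apply hi])]
    rfl

/-- The summand `γ(x; Id, …, y, …, Id)` of `x ∘ y`, without the sign, in which `y` is inserted into
the input `i` (counted from `0`). -/
def insertAt {p q r : ℕ} (h : p + q = r) (i : ℕ) (x : Cochain K A U (p + 1))
    (y : Cochain K A U (q + 1)) : Cochain K A U (r + 1) :=
  gamma S (fun j => slotDeg (fun _ : Fin 1 => q) (singleEmb p i) j + 1) (fun _ => Nat.succ_pos _)
    ((sum_slotDeg _ _).trans (by simp; omega)) x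
    fun j => slot (fun _ => y) (Function.partialInv (singleEmb p i) j)

theorem ev_insertAt {p q r i : ℕ} (h : p + q = r) (hi : i ≤ p) (x : Cochain K A U (p + 1))
    (y : Cochain K A U (q + 1)) (ρ : U (r + 1)) (a : ℕ → A) :
    ev (insertAt S h i x y) ρ a = ev x (S.outer h hi ρ)
      (contract i q (ev y (S.inner h hi ρ) fun l => a (i + l)) a) := by
  refine ev_gamma_slot S (singleEmb p i) (insSizes p q i) (insSizes_pos p q i) (sum_insSizes h hi)
    (slotDeg_single hi) _ x (fun _ => y) ρ a _ ?_ ?_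
  · intro j hj
    rw [psum_insSizes _ _ _ _ (by omega)]
    have hj' : (j : ℕ) ≠ i := fun h => hj 0 (by rw [singleEmb_apply hi]; exact Fin.ext h.symm)
    unfold contract
    split_ifs <;> first | rfl | omega
  · intro b hb
    have e := singleEmb_apply hi b
    have e' : psum (insSizes p q i) (singleEmb p i b) = i := by
      rw [e, psum_insSizes _ _ _ _ (by simp; omega), if_pos le_rfl]
    rw [e']
    simp only [contract, e, lt_irrefl, if_false, if_true]
    rfl

theorem insertAt_add_left {p q r : ℕ} (h : p + q = r) (i : ℕ) (x x' : Cochain K A U (p + 1))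
    (y : Cochain K A U (q + 1)) :
    insertAt S h i (x + x') y = insertAt S h i x y + insertAt S h i x' y :=
  gamma_add_left S _ _ _ _ _ _

theorem insertAt_smul_left {p q r : ℕ} (h : p + q = r) (i : ℕ) (c : K) (x : Cochain K A U (p + 1))
    (y : Cochain K A U (q + 1)) : insertAt S h i (c • x) y = c • insertAt S h i x y :=
  gamma_smul_left S _ _ _ _ _ _

theorem insertAt_add_right {p q r : ℕ} (h : p + q = r) (i : ℕ) (x : Cochain K A U (p + 1))
    (y y' : Cochain K A U (q + 1)) :
    insertAt S h i x (y + y') = insertAt S h i x y + insertAt S h i x y' :=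
  gamma_add_right S _ _ _ _ _ _ _ (singleEmb p i 0)
    (slot_add y y' _ (by simp [Function.partialInv_left (singleEmb p i).injective]))
    (fun j hj => slot_none _ _ _ (partialInv_none _ j hj))
    (fun j hj => slot_none _ _ _ (partialInv_none _ j hj))

theorem insertAt_smul_right {p q r : ℕ} (h : p + q = r) (i : ℕ) (c : K) (x : Cochain K A U (p + 1))
    (y : Cochain K A U (q + 1)) : insertAt S h i x (c • y) = c • insertAt S h i x y :=
  gamma_smul_right S _ _ _ c _ _ _ (singleEmb p i 0)
    (slot_smul c y _ (by simp [Function.partialInv_left (singleEmb p i).injective]))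
    (fun j hj => slot_none _ _ _ (partialInv_none _ j hj))

variable {S}

theorem insertAt_seq (hS : S.IsPreOperadic) {p q s a b r i j : ℕ} (h₁ : p + q = a) (h₂ : a + s = r)
    (h₃ : q + s = b) (h₄ : p + b = r) (hi : i ≤ p) (hj : j ≤ q) (x : Cochain K A U (p + 1))
    (y : Cochain K A U (q + 1)) (z : Cochain K A U (s + 1)) :
    insertAt S h₂ (i + j) (insertAt S h₁ i x y) z = insertAt S h₄ i x (insertAt S h₃ j y z) := by
  refine cochain_ext fun ρ v => ?_
  rw [ev_insertAt S h₂ (by omega), ev_insertAt S h₁ hi, ev_insertAt S h₄ hi, ev_insertAt S h₃ hj]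
  refine ev_congr x (hS.outer_outer_seq h₁ h₂ h₃ h₄ hi hj ρ) fun l hl => ?_
  simp only [contract, ← hS.inner_seq h₁ h₂ h₃ h₄ hi hj ρ, ← hS.inner_outer_seq h₁ h₂ h₃ h₄ hi hj ρ]
  split_ifs
  any_goals omega
  · rfl
  · refine ev_congr y rfl fun m hm => ?_
    simp only [contract, Nat.add_lt_add_iff_left, Nat.add_left_cancel_iff, add_assoc]
  · congr 1; omega

/-- The common value of the two ways to insert `y` and `z` into different inputs. -/
theorem ev_insertAt_insertAt (hS : S.IsPreOperadic) (hU : S.IsUnital) {p q s a r i j d : ℕ}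
    (h₁ : p + q = a) (h₂ : a + s = r) (hi : i ≤ p) (hj : j ≤ p) (hij : i ≠ j)
    (hd : d = if j ≤ i then j else j + q) (x : Cochain K A U (p + 1))
    (y : Cochain K A U (q + 1)) (z : Cochain K A U (s + 1)) (ρ : U (r + 1)) (v : ℕ → A) :
    ev (insertAt S h₂ d (insertAt S h₁ i x y) z) ρ v
      = ev x (S.R₀ (insSizes₂ p q i s j) (insSizes₂_pos _ _ _ _ _)
          (sum_insSizes₂ h₁ h₂ hi hj hij) ρ)
        fun l => if l = i then
            ev y (S.Rto (insSizes₂ p q i s j) (insSizes₂_pos _ _ _ _ _)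
              (sum_insSizes₂ h₁ h₂ hi hj hij) ⟨i, Nat.lt_succ_of_le hi⟩ (insSizes₂_left _) ρ)
              fun m => v ((if i < j then i else i + s) + m)
          else if l = j then
            ev z (S.Rto (insSizes₂ p q i s j) (insSizes₂_pos _ _ _ _ _)
              (sum_insSizes₂ h₁ h₂ hi hj hij) ⟨j, Nat.lt_succ_of_le hj⟩
              (insSizes₂_right _ hij) ρ) fun m => v (d + m)
          else v (l + (if i < l then q else 0) + if j < l then s else 0) := by
  have hda : d ≤ a := by split_ifs at hd <;> omega
  rw [ev_insertAt S h₂ hda, ev_insertAt S h₁ hi]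
  refine ev_congr x
    (SystemData.IsPreOperadic.outer_outer_par h₁ h₂ hi hj hij hda ρ hd hS) fun l hl => ?_
  simp only [contract]
  rw [SystemData.IsPreOperadic.inner_outer_par h₁ h₂ hi hj hij hda ρ hd hS,
    SystemData.IsPreOperadic.inner_par h₁ h₂ hi hj hij hda ρ hd hS hU]
  have hd' : i < j ∧ d = j + q ∨ j < i ∧ d = j := by split_ifs at hd <;> omega
  clear hd
  by_cases hli : l = i
  · subst hli
    simp only [lt_irrefl, if_true, if_false]
    refine ev_congr y rfl fun m hm => ?_
    rcases hd' with ⟨h, rfl⟩ | ⟨h, rfl⟩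
    · rw [if_pos (by omega), if_pos h]
    · rw [if_neg (by omega), if_neg (by omega), if_neg (by omega)]
      congr 1; omega
  · simp only [hli, if_false]
    by_cases hlj : l = j
    · subst hlj
      rcases hd' with ⟨h, rfl⟩ | ⟨h, rfl⟩
      · rw [if_neg (by omega), if_neg (by omega), if_pos rfl, if_pos rfl]
      · rw [if_pos h, if_neg (by omega), if_pos rfl, if_pos rfl]
    · simp only [hlj, if_false]
      rcases hd' with ⟨h, rfl⟩ | ⟨h, rfl⟩ <;> split_ifs <;>
        first | omega | rfl

theorem insertAt_par (hS : S.IsPreOperadic) (hU : S.IsUnital) {p q s a b r i j : ℕ}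
    (h₁ : p + q = a) (h₂ : a + s = r) (h₃ : p + s = b) (h₄ : b + q = r) (hij : i < j) (hj : j ≤ p)
    (x : Cochain K A U (p + 1)) (y : Cochain K A U (q + 1)) (z : Cochain K A U (s + 1)) :
    insertAt S h₂ (j + q) (insertAt S h₁ i x y) z = insertAt S h₄ i (insertAt S h₃ j x z) y := by
  refine cochain_ext fun ρ v => ?_
  rw [ev_insertAt_insertAt hS hU h₁ h₂ (hij.le.trans hj) hj hij.ne (by rw [if_neg hij.not_ge]),
    ev_insertAt_insertAt hS hU h₃ h₄ hj (hij.le.trans hj) hij.ne' (by rw [if_pos hij.le])]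
  refine ev_congr x (SystemData.R₀_congr (insSizes₂_comm hij.ne p q s) ρ) fun l hl => ?_
  by_cases hli : l = i
  · subst hli
    simp only [hij, hij.ne, if_true, if_false]
    exact ev_congr y (SystemData.Rto_congr (insSizes₂_comm hij.ne p q s) rfl ρ) fun _ _ => rfl
  · by_cases hlj : l = j
    · subst hlj
      simp only [hij.ne', hij.not_gt, if_true, if_false]
      exact ev_congr z (SystemData.Rto_congr (insSizes₂_comm hij.ne p q s) rfl ρ) fun _ _ => rfl
    · simp only [hli, hlj, if_false, add_right_comm]

/-- The cochains, with the insertions `(-1)^{|y| i} x ∘ᵢ y` that occur in the braces. -/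
def cochainOperad (hS : S.IsPreOperadic) (hU : S.IsUnital) :
    SignedOperad K fun p => Cochain K A U (p + 1) where
  ins {p q r} h i := LinearMap.mk₂ K (fun x y => (-1 : K) ^ (q * i) • insertAt S h i x y)
    (fun x x' y => by rw [insertAt_add_left, smul_add])
    (fun c x y => by rw [insertAt_smul_left, smul_comm])
    (fun x y y' => by rw [insertAt_add_right, smul_add])
    (fun c x y => by rw [insertAt_smul_right, smul_comm])
  ins_seq {p q s a b r} h₁ h₂ h₃ h₄ i j hi hj x y z := by
    simp only [LinearMap.mk₂_apply, insertAt_smul_left, insertAt_smul_right, smul_smul]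
    rw [insertAt_seq hS h₁ h₂ h₃ h₄ hi hj, ← pow_add, ← pow_add,
      show s * (i + j) + q * i = b * i + s * j by rw [← h₃]; ring]
  ins_par {p q s a b r} h₁ h₂ h₃ h₄ i j hij hj x y z := by
    simp only [LinearMap.mk₂_apply, insertAt_smul_left, smul_smul]
    rw [insertAt_par hS hU h₁ h₂ h₃ h₄ hij hj, ← pow_add, ← pow_add, ← pow_add]
    congr 2; ring

theorem cochainOperad_ins (hS : S.IsPreOperadic) (hU : S.IsUnital) {p q r : ℕ} (h : p + q = r)
    (i : ℕ) (x : Cochain K A U (p + 1)) (y : Cochain K A U (q + 1)) :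
    (cochainOperad hS hU).ins h i x y = (-1 : K) ^ (q * i) • insertAt S h i x y := rfl

theorem circ_eq (hS : S.IsPreOperadic) (hU : S.IsUnital) {p q r : ℕ} (h : p + q = r)
    (x : Cochain K A U (p + 1)) (y : Cochain K A U (q + 1)) :
    circ S h x y = (cochainOperad hS hU).circ h x y := by
  rw [SignedOperad.circ_apply, Finset.sum_range]
  unfold circ brace
  refine Fintype.sum_bijective (fun e : Fin 1 ↪o Fin (p + 1) => e 0)
    ⟨fun e e' he => ?_, fun i => ?_⟩ _ _ fun e => ?_
  · ext b; rw [Subsingleton.elim b 0]; exact congrArg Fin.val he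
  · exact ⟨singleEmb p i, singleEmb_apply (Nat.lt_succ_iff.1 i.2) 0⟩
  · obtain ⟨i, hi, rfl⟩ : ∃ i, i ≤ p ∧ e = singleEmb p i := by
      have hi : (e 0 : ℕ) ≤ p := Nat.lt_succ_iff.1 (e 0).2
      exact ⟨e 0, hi, by ext b; rw [Subsingleton.elim b 0, singleEmb_apply hi]⟩
    rw [singleEmb_apply hi, cochainOperad_ins]
    have : psum (fun j => slotDeg (fun _ : Fin 1 => q) (singleEmb p i) j + 1) i = i := by
      rw [funext (slotDeg_single hi), psum_insSizes _ _ _ _ (by omega), if_pos le_rfl]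
    simp only [Finset.univ_unique, Finset.sum_singleton, Fin.default_eq_zero, singleEmb_apply hi,
      this]
    rfl

theorem bracket_eq (hS : S.IsPreOperadic) (hU : S.IsUnital) {p q r : ℕ} (h : p + q = r)
    (x : Cochain K A U (p + 1)) (y : Cochain K A U (q + 1)) :
    bracket S h x y = (cochainOperad hS hU).bracket h x y := by
  rw [bracket, circ_eq hS hU, circ_eq hS hU]
  rfl

theorem differential_eq (hS : S.IsPreOperadic) (hU : S.IsUnital) (π : Cochain K A U 2) {p : ℕ}
    (x : Cochain K A U (p + 1)) :
    differential S π p x = (cochainOperad hS hU).diff π p x :=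
  bracket_eq hS hU _ π x

/-- In the only summand of `π{x, y}`, the cochain `x` is inserted into the first input of `π`, and
`y` into the last one. -/
theorem dot_eq (hS : S.IsPreOperadic) (hU : S.IsUnital) (π : Cochain K A U 2) {p q r : ℕ}
    (h : p + q + 1 = r) (x : Cochain K A U (p + 1)) (y : Cochain K A U (q + 1)) :
    dot S π h x y = (cochainOperad hS hU).dot π h x y := by
  rw [SignedOperad.dot_apply _ _ _ (by omega), SignedOperad.brace₂_two _ _ rfl (by omega),
    cochainOperad_ins, cochainOperad_ins, insertAt_smul_left, smul_smul, dot, brace]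
  have he : ∀ e : Fin 2 ↪o Fin (1 + 1), ∀ b, e b = b := by
    intro e b
    have h01 : e 0 < e 1 := e.lt_iff_lt.2 Fin.zero_lt_one
    have h0 := (e 0).2
    have h1 := (e 1).2
    rw [Fin.lt_def] at h01
    fin_cases b
    · exact Fin.ext (by simp; omega)
    · exact Fin.ext (by simp; omega)
  have e : Fin 2 ↪o Fin (1 + 1) := RelEmbedding.refl _
  rw [Fintype.sum_eq_single e fun e' h => (h (by ext b; rw [he, he])).elim]
  have hn : ∀ j, slotDeg ![p, q] e j + 1 = insSizes₂ 1 p 0 q 1 j := by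
    intro j
    have := Function.partialInv_left e.injective j
    rw [he] at this
    rw [slotDeg, this]
    fin_cases j <;> rfl
  have hp : psum (insSizes₂ 1 p 0 q 1) 1 = 1 + p := by
    have := psum_succ (insSizes₂ 1 p 0 q 1) 0
    simp only [Fin.val_zero, psum_zero, insSizes₂] at this
    simpa [add_comm] using this
  have hg : gamma S (fun j => slotDeg ![p, q] e j + 1) (fun _ => Nat.succ_pos _)
      ((sum_slotDeg ![p, q] e).trans (by simp; omega)) π (fun j =>
        slot (Fin.cons x (Fin.cons y finZeroElim)) (Function.partialInv e j))
      = insertAt S (show 1 + p + q = r by omega) (1 + p) (insertAt S rfl 0 π x) y := by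
    refine cochain_ext fun ρ a => ?_
    rw [ev_insertAt_insertAt hS hU (i := 0) (j := 1) rfl (by omega) (Nat.zero_le _) le_rfl
      Nat.zero_ne_one (add_comm 1 p ▸ rfl)]
    refine ev_gamma_slot S e _ _ _ hn _ π _ ρ a _ (fun j hj => (hj j (he e j)).elim) ?_
    intro b hb
    match b, hb with
    | 0, hb =>
      simp only [he, Fin.val_zero, if_true, psum_zero, Nat.zero_lt_one]
      rfl
    | 1, hb =>
      simp only [he, Fin.val_one, if_true, one_ne_zero, if_false, hp]
      rfl
  change (-1 : K) ^ (p + 1) • (-1 : K) ^ (∑ b, ![p, q] b * psum (fun j => slotDeg ![p, q] e j + 1)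
    (e b)) • gamma S (fun j => slotDeg ![p, q] e j + 1) _ _ π _ = _
  rw [hg, funext hn, Fin.sum_univ_two, he, he]
  simp only [Fin.val_zero, Fin.val_one, psum_zero, hp, ← pow_add, smul_smul]
  simp

end CochainOperad

/-! ### The cohomology of a multiplication -/

/-- The bilinear map of quotients induced by a bilinear map. -/
def quotientMap₂ {K M N P : Type*} [CommRing K] [AddCommGroup M] [Module K M] [AddCommGroup N]
    [Module K N] [AddCommGroup P] [Module K P] (M' : Submodule K M) (N' : Submodule K N)
    (P' : Submodule K P) (f : M →ₗ[K] N →ₗ[K] P) (hM : ∀ x ∈ M', ∀ y, f x y ∈ P')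
    (hN : ∀ x, ∀ y ∈ N', f x y ∈ P') : M ⧸ M' →ₗ[K] N ⧸ N' →ₗ[K] P ⧸ P' :=
  M'.liftQ
    { toFun := fun x => N'.mapQ P' (f x) (hN x)
      map_add' := fun x x' => by ext y; simp
      map_smul' := fun c x => by ext y; simp }
    fun x hx => by
      rw [LinearMap.mem_ker]
      ext y
      simpa using hM x hx y

section Cohomology

variable {K : Type u} {A : Type v} [Field K] [AddCommGroup A] [Module K A] {U : ℕ → Type}
  {S : SystemData U} {π : Cochain K A U 2}

theorem mem_cocycles (hS : S.IsPreOperadic) (hU : S.IsUnital) {p : ℕ} {x : Cochain K A U (p + 1)} :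
    x ∈ cocycles S π p ↔ (cochainOperad hS hU).diff π p x = 0 := by
  rw [cocycles, LinearMap.mem_ker, differential_eq hS hU]

theorem mem_coboundaries (hS : S.IsPreOperadic) (hU : S.IsUnital) {p : ℕ}
    {x : Cochain K A U (p + 1 + 1)} : x ∈ coboundaries S π (p + 1)
      ↔ ∃ w : Cochain K A U (p + 1), (cochainOperad hS hU).diff π p w = x := by
  simp only [← differential_eq hS hU]
  exact Iff.rfl

/-- The multiplication, as an element of an operad of cochains. -/
theorem circ_self_eq_zero (hS : S.IsPreOperadic) (hU : S.IsUnital) (hπ : IsMultiplication S π) :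
    (cochainOperad hS hU).circ (rfl : 1 + 1 = _) π π = 0 := by
  rw [← circ_eq hS hU]
  exact hπ

section Descent

variable {p q r : ℕ} {x : Cochain K A U (p + 1)} {y : Cochain K A U (q + 1)}

theorem dot_mem_cocycles (hS : S.IsPreOperadic) (hU : S.IsUnital) (hπ : IsMultiplication S π)
    (h : p + q + 1 = r) (hx : x ∈ cocycles S π p) (hy : y ∈ cocycles S π q) :
    dot S π h x y ∈ cocycles S π r := by
  rw [mem_cocycles hS hU] at *
  rw [dot_eq hS hU, (cochainOperad (K := K) (A := A) hS hU).diff_dot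
    (circ_self_eq_zero hS hU hπ) h (by omega) (by omega), hx, hy]
  simp

theorem bracket_mem_cocycles (hS : S.IsPreOperadic) (hU : S.IsUnital) (h : p + q = r)
    (hx : x ∈ cocycles S π p) (hy : y ∈ cocycles S π q) : bracket S h x y ∈ cocycles S π r := by
  rw [mem_cocycles hS hU] at *
  rw [bracket_eq hS hU, (cochainOperad (K := K) (A := A) hS hU).diff_bracket π h
    (by omega) (by omega), hx, hy]
  simp

theorem dot_mem_coboundaries_left (hS : S.IsPreOperadic) (hU : S.IsUnital)
    (hπ : IsMultiplication S π) (h : p + q + 1 = r) (hx : x ∈ coboundaries S π p)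
    (hy : y ∈ cocycles S π q) : dot S π h x y ∈ coboundaries S π r := by
  rw [mem_cocycles hS hU] at hy
  rw [dot_eq hS hU]
  cases p with
  | zero => rw [(Submodule.mem_bot K).1 hx]; simp
  | succ p =>
    obtain ⟨w, rfl⟩ := (mem_coboundaries hS hU).1 hx
    obtain rfl : r = p + q + 1 + 1 := by omega
    refine (mem_coboundaries hS hU).2 ⟨(cochainOperad hS hU).dot π rfl w y, ?_⟩
    rw [(cochainOperad (K := K) (A := A) hS hU).diff_dot
      (circ_self_eq_zero hS hU hπ) rfl h (by omega), hy]
    simp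

theorem dot_mem_coboundaries_right (hS : S.IsPreOperadic) (hU : S.IsUnital)
    (hπ : IsMultiplication S π) (h : p + q + 1 = r) (hx : x ∈ cocycles S π p)
    (hy : y ∈ coboundaries S π q) : dot S π h x y ∈ coboundaries S π r := by
  rw [mem_cocycles hS hU] at hx
  rw [dot_eq hS hU]
  cases q with
  | zero => rw [(Submodule.mem_bot K).1 hy]; simp
  | succ q =>
    obtain ⟨w, rfl⟩ := (mem_coboundaries hS hU).1 hy
    obtain rfl : r = p + q + 1 + 1 := by omega
    refine (mem_coboundaries hS hU).2
      ⟨(-1 : K) ^ (p + 1) • (cochainOperad hS hU).dot π rfl x w, ?_⟩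
    rw [map_smul, (cochainOperad (K := K) (A := A) hS hU).diff_dot
      (circ_self_eq_zero hS hU hπ) rfl (by omega) h, hx, map_zero, LinearMap.zero_apply, zero_add,
      smul_smul, ← pow_add, Even.neg_one_pow ⟨_, rfl⟩, one_smul]

theorem bracket_mem_coboundaries_left (hS : S.IsPreOperadic) (hU : S.IsUnital) (h : p + q = r)
    (hx : x ∈ coboundaries S π p) (hy : y ∈ cocycles S π q) :
    bracket S h x y ∈ coboundaries S π r := by
  rw [mem_cocycles hS hU] at hy
  rw [bracket_eq hS hU]
  cases p with
  | zero => rw [(Submodule.mem_bot K).1 hx]; simp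
  | succ p =>
    obtain ⟨w, rfl⟩ := (mem_coboundaries hS hU).1 hx
    obtain rfl : r = p + q + 1 := by omega
    refine (mem_coboundaries hS hU).2 ⟨(cochainOperad hS hU).bracket rfl w y, ?_⟩
    rw [(cochainOperad (K := K) (A := A) hS hU).diff_bracket π rfl h (by omega), hy]
    simp

theorem bracket_mem_coboundaries_right (hS : S.IsPreOperadic) (hU : S.IsUnital) (h : p + q = r)
    (hx : x ∈ cocycles S π p) (hy : y ∈ coboundaries S π q) :
    bracket S h x y ∈ coboundaries S π r := by
  rw [mem_cocycles hS hU] at hx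
  rw [bracket_eq hS hU]
  cases q with
  | zero => rw [(Submodule.mem_bot K).1 hy]; simp
  | succ q =>
    obtain ⟨w, rfl⟩ := (mem_coboundaries hS hU).1 hy
    obtain rfl : r = p + q + 1 := by omega
    refine (mem_coboundaries hS hU).2
      ⟨(-1 : K) ^ p • (cochainOperad hS hU).bracket rfl x w, ?_⟩
    rw [map_smul, (cochainOperad (K := K) (A := A) hS hU).diff_bracket π rfl (by omega) h, hx,
      map_zero, LinearMap.zero_apply, zero_add, smul_smul, ← pow_add, Even.neg_one_pow ⟨_, rfl⟩,
      one_smul]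

end Descent

variable (hS : S.IsPreOperadic) (hU : S.IsUnital) (hπ : IsMultiplication S π)

/-- The dot product of cohomology classes. -/
def cohomologyDot {p q r : ℕ} (h : p + q + 1 = r) :
    Cohomology S π p →ₗ[K] Cohomology S π q →ₗ[K] Cohomology S π r :=
  quotientMap₂ _ _ _
    (LinearMap.mk₂ K (fun x y => ⟨dot S π h x.1 y.1, dot_mem_cocycles hS hU hπ h x.2 y.2⟩)
      (fun x x' y => Subtype.ext <| by simp [dot_eq hS hU])
      (fun c x y => Subtype.ext <| by simp [dot_eq hS hU])
      (fun x y y' => Subtype.ext <| by simp [dot_eq hS hU])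
      (fun c x y => Subtype.ext <| by simp [dot_eq hS hU]))
    (fun _ hx y => dot_mem_coboundaries_left hS hU hπ h hx y.2)
    (fun x _ hy => dot_mem_coboundaries_right hS hU hπ h x.2 hy)

/-- The bracket of cohomology classes. -/
def cohomologyBracket {p q r : ℕ} (h : p + q = r) :
    Cohomology S π p →ₗ[K] Cohomology S π q →ₗ[K] Cohomology S π r :=
  quotientMap₂ _ _ _
    (LinearMap.mk₂ K (fun x y => ⟨bracket S h x.1 y.1, bracket_mem_cocycles hS hU h x.2 y.2⟩)
      (fun x x' y => Subtype.ext <| by simp [bracket_eq hS hU])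
      (fun c x y => Subtype.ext <| by simp [bracket_eq hS hU])
      (fun x y y' => Subtype.ext <| by simp [bracket_eq hS hU])
      (fun c x y => Subtype.ext <| by simp [bracket_eq hS hU]))
    (fun _ hx y => bracket_mem_coboundaries_left hS hU h hx y.2)
    (fun x _ hy => bracket_mem_coboundaries_right hS hU h x.2 hy)

theorem cohomologyDot_mk {p q r : ℕ} (h : p + q + 1 = r) (x : cocycles S π p)
    (y : cocycles S π q) :
    cohomologyDot hS hU hπ h (Submodule.Quotient.mk x) (Submodule.Quotient.mk y)
      = Submodule.Quotient.mk ⟨_, dot_mem_cocycles hS hU hπ h x.2 y.2⟩ := rfl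

theorem cohomologyBracket_mk {p q r : ℕ} (h : p + q = r) (x : cocycles S π p)
    (y : cocycles S π q) :
    cohomologyBracket hS hU h (Submodule.Quotient.mk x) (Submodule.Quotient.mk y)
      = (Submodule.Quotient.mk ⟨_, bracket_mem_cocycles hS hU h x.2 y.2⟩ : Cohomology S π r) := rfl

theorem mk_eq_mk_of_eq {p : ℕ} {x y : cocycles S π p} (h : x.1 = y.1) :
    (Submodule.Quotient.mk x : Cohomology S π p) = Submodule.Quotient.mk y :=
  congrArg _ (Subtype.ext h)

theorem mk_eq_mk_of_sub {p : ℕ} {x y : cocycles S π p} (h : x.1 - y.1 ∈ coboundaries S π p) :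
    (Submodule.Quotient.mk x : Cohomology S π p) = Submodule.Quotient.mk y :=
  (Submodule.Quotient.eq _).2 h

/-- The Gerstenhaber algebra structure on the cohomology of a multiplication. -/
def cohomologyGAlgebra : GAlgebra K fun p => Cohomology S π p where
  dot h := cohomologyDot hS hU hπ h
  bracket h := cohomologyBracket hS hU h
  dot_assoc {p q s a b r} h₁ h₂ h₃ h₄ x y z := by
    obtain ⟨x, rfl⟩ := Submodule.Quotient.mk_surjective _ x
    obtain ⟨y, rfl⟩ := Submodule.Quotient.mk_surjective _ y
    obtain ⟨z, rfl⟩ := Submodule.Quotient.mk_surjective _ z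
    simp only [cohomologyDot_mk]
    refine mk_eq_mk_of_eq ?_
    simp only [dot_eq hS hU]
    exact (cochainOperad (K := K) (A := A) hS hU).dot_assoc
      (circ_self_eq_zero hS hU hπ) h₁ h₂ h₃ h₄ x.1 y.1 z.1
  dot_comm {p q r} h₁ h₂ x y := by
    obtain ⟨x, rfl⟩ := Submodule.Quotient.mk_surjective _ x
    obtain ⟨y, rfl⟩ := Submodule.Quotient.mk_surjective _ y
    simp only [cohomologyDot_mk, ← Submodule.Quotient.mk_smul]
    refine mk_eq_mk_of_sub ?_
    subst h₁
    -- the commutator is the coboundary of `± x ∘ y`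
    refine (mem_coboundaries hS hU).2 ⟨(-1 : K) ^ p • (cochainOperad hS hU).circ rfl x.1 y.1, ?_⟩
    rw [map_smul, (cochainOperad (K := K) (A := A) hS hU).diff_circ π rfl
      (by omega) (by omega) rfl h₂, (mem_cocycles hS hU).1 x.2, (mem_cocycles hS hU).1 y.2]
    simp only [map_zero, LinearMap.zero_apply, zero_add, smul_zero, smul_smul, ← pow_add,
      Even.neg_one_pow ⟨p, rfl⟩, one_smul, Submodule.coe_smul, dot_eq hS hU]
  bracket_skew {p q r} h₁ h₂ x y := by
    obtain ⟨x, rfl⟩ := Submodule.Quotient.mk_surjective _ x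
    obtain ⟨y, rfl⟩ := Submodule.Quotient.mk_surjective _ y
    simp only [cohomologyBracket_mk, ← Submodule.Quotient.mk_smul, ← Submodule.Quotient.mk_neg]
    refine mk_eq_mk_of_eq ?_
    simp only [bracket_eq hS hU, Submodule.coe_neg, Submodule.coe_smul]
    exact (cochainOperad (K := K) (A := A) hS hU).bracket_skew h₁ h₂ x.1 y.1
  bracket_jacobi {p q s a b c r} h₁ h₂ h₃ h₄ h₅ h₆ x y z := by
    obtain ⟨x, rfl⟩ := Submodule.Quotient.mk_surjective _ x
    obtain ⟨y, rfl⟩ := Submodule.Quotient.mk_surjective _ y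
    obtain ⟨z, rfl⟩ := Submodule.Quotient.mk_surjective _ z
    simp only [cohomologyBracket_mk, ← Submodule.Quotient.mk_smul, ← Submodule.Quotient.mk_add]
    refine mk_eq_mk_of_eq ?_
    simp only [bracket_eq hS hU, Submodule.coe_add, Submodule.coe_smul]
    exact (cochainOperad (K := K) (A := A) hS hU).bracket_jacobi h₁ h₂ h₃ h₄ h₅ h₆ x.1 y.1 z.1
  bracket_self {p r} h hp x := by
    obtain ⟨x, rfl⟩ := Submodule.Quotient.mk_surjective _ x
    rw [cohomologyBracket_mk, ← Submodule.Quotient.mk_zero]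
    refine mk_eq_mk_of_eq ?_
    simp only [bracket_eq hS hU]
    exact (cochainOperad (K := K) (A := A) hS hU).bracket_self h hp x.1
  bracket_bracket_self {p a r} h₁ h₂ hp x := by
    obtain ⟨x, rfl⟩ := Submodule.Quotient.mk_surjective _ x
    rw [cohomologyBracket_mk, cohomologyBracket_mk, ← Submodule.Quotient.mk_zero]
    refine mk_eq_mk_of_eq ?_
    simp only [bracket_eq hS hU]
    exact (cochainOperad (K := K) (A := A) hS hU).bracket_bracket_self h₁ h₂ hp x.1
  bracket_dot {p q s a b c r} h₁ h₂ h₃ h₄ h₅ h₆ x y z := by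
    obtain ⟨x, rfl⟩ := Submodule.Quotient.mk_surjective _ x
    obtain ⟨y, rfl⟩ := Submodule.Quotient.mk_surjective _ y
    obtain ⟨z, rfl⟩ := Submodule.Quotient.mk_surjective _ z
    simp only [cohomologyBracket_mk, cohomologyDot_mk, ← Submodule.Quotient.mk_smul,
      ← Submodule.Quotient.mk_add]
    refine mk_eq_mk_of_sub ?_
    obtain rfl : r = p + q + s + 1 := by omega
    -- the deviation from the Leibniz rule is the coboundary of `± x{y, z}`
    refine (mem_coboundaries hS hU).2
      ⟨(-1 : K) ^ (p + q + 1) • (cochainOperad hS hU).brace₂ rfl x.1 y.1 z.1, ?_⟩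
    rw [map_smul, (cochainOperad (K := K) (A := A) hS hU).diff_brace₂ π rfl
      h₁ h₂ h₃ h₄ h₅ h₆ (by omega) (by omega) (by omega) rfl,
      (mem_cocycles hS hU).1 x.2, (mem_cocycles hS hU).1 y.2, (mem_cocycles hS hU).1 z.2]
    simp only [map_zero, LinearMap.zero_apply, zero_add, smul_zero, smul_smul, ← pow_add,
      Even.neg_one_pow ⟨p + q + 1, rfl⟩, one_smul, Submodule.coe_smul, Submodule.coe_add,
      dot_eq hS hU, bracket_eq hS hU, sub_sub]

/-- A multiplication on the cochains of a pre-operadic system induces a Gerstenhaber algebra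
structure on cohomology. -/
theorem inducesGAlgebra (hS : S.IsPreOperadic) (hU : S.IsUnital) (hπ : IsMultiplication S π) :
    InducesGAlgebra S π := by
  refine ⟨hS, hπ, fun p x => ?_, fun h x y => dot_mem_cocycles hS hU hπ h x.2 y.2,
    fun h x y => bracket_mem_cocycles hS hU h x.2 y.2, cohomologyGAlgebra hS hU hπ,
    fun _ _ _ => rfl, fun _ _ _ => rfl⟩
  rw [differential_eq hS hU, differential_eq hS hU]
  exact (cochainOperad (K := K) (A := A) hS hU).diff_diff (circ_self_eq_zero hS hU hπ) x

end Cohomology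

/-! ### Partial sums and blocks -/

section Blocks

variable {k N M : ℕ}

theorem exists_block (n : Fin k → ℕ) (hN : ∑ i, n i = N) (r : Fin N) :
    ∃ i j, block n hN i j = r :=
  ⟨(finSigmaFinEquiv.symm (Fin.cast hN.symm r)).1, (finSigmaFinEquiv.symm (Fin.cast hN.symm r)).2,
    by simp [block]⟩

theorem blockIndex_block (n : Fin k → ℕ) (hN : ∑ i, n i = N) (i : Fin k) (j : Fin (n i)) :
    blockIndex n hN (block n hN i j) = i := by
  simp [block, blockIndex]

theorem psum_blockIndex_le (n : Fin k → ℕ) (hN : ∑ i, n i = N) (r : Fin N) :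
    psum n (blockIndex n hN r) ≤ r := by
  obtain ⟨i, j, rfl⟩ := exists_block n hN r
  rw [blockIndex_block, block_val]
  exact Nat.le_add_right _ _

theorem lt_psum_blockIndex_succ (n : Fin k → ℕ) (hN : ∑ i, n i = N) (r : Fin N) :
    (r : ℕ) < psum n (blockIndex n hN r + 1) := by
  obtain ⟨i, j, rfl⟩ := exists_block n hN r
  rw [blockIndex_block, block_val, psum_succ]
  exact Nat.add_lt_add_left j.2 _

theorem blockIndex_eq {n : Fin k → ℕ} (hN : ∑ i, n i = N) {r : Fin N} {i : Fin k}
    (h₁ : psum n i ≤ r) (h₂ : (r : ℕ) < psum n (i + 1)) : blockIndex n hN r = i := by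
  have e₁ := psum_blockIndex_le n hN r
  have e₂ := lt_psum_blockIndex_succ n hN r
  refine Fin.ext (le_antisymm ?_ ?_)
  · by_contra! h
    have := psum_mono n (show (i : ℕ) + 1 ≤ blockIndex n hN r from h)
    omega
  · by_contra! h
    have := psum_mono n (show (blockIndex n hN r : ℕ) + 1 ≤ i from h)
    omega

/-- A closed form of `clamp` with truncated subtraction: to the left of the block the difference is
`0`. -/
theorem clamp_val (n : Fin k → ℕ) (hn : ∀ i, 0 < n i) (i : Fin k) (r : Fin N) :
    (clamp n hn i r : ℕ) = min ((r : ℕ) - psum n i) (n i - 1) := by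
  have := hn i
  unfold clamp
  split_ifs <;> simp only <;> omega

/-- A partial sum within the `i`-th block. -/
theorem psum_add (n : Fin k → ℕ) (hN : ∑ i, n i = N) (m : Fin N → ℕ) (i : Fin k) {j : ℕ}
    (hj : j ≤ n i) :
    psum m (psum n i + j) = psum m (psum n i) + psum (fun t => m (block n hN i t)) j := by
  induction j with
  | zero => simp [psum_zero]
  | succ j ih =>
    have e₁ := psum_succ m (block n hN i ⟨j, hj⟩)
    have e₂ := psum_succ (fun t => m (block n hN i t)) ⟨j, hj⟩
    rw [block_val] at e₁
    simp only at e₁ e₂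
    rw [e₂, ← add_assoc, ← add_assoc, e₁, ih (Nat.le_of_succ_le hj)]

/-- The partial sums of the block sums `Tᵢ`. -/
theorem psum_sum_block (n : Fin k → ℕ) (hN : ∑ i, n i = N) (m : Fin N → ℕ) {i : ℕ} (hi : i ≤ k) :
    psum (fun i => ∑ j, m (block n hN i j)) i = psum m (psum n i) := by
  induction i with
  | zero => simp [psum_zero]
  | succ i ih =>
    have e₁ := psum_succ (fun i => ∑ j, m (block n hN i j)) ⟨i, hi⟩
    have e₂ := psum_succ n ⟨i, hi⟩
    simp only at e₁ e₂
    rw [e₁, e₂, psum_add n hN m ⟨i, hi⟩ le_rfl, ih (Nat.le_of_succ_le hi), psum_top]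

theorem psum_one (l : ℕ) (hl : l ≤ k) : psum (fun _ : Fin k => 1) l = l := by
  induction l with
  | zero => exact psum_zero _
  | succ l ih =>
    have := psum_succ (fun _ : Fin k => 1) ⟨l, hl⟩
    rw [this, ih (Nat.le_of_succ_le hl)]

/-- The blocks of the sizes `m_l` are the blocks within the blocks of the sizes `Tᵢ`. -/
theorem block_block (n : Fin k → ℕ) (hN : ∑ i, n i = N) (m : Fin N → ℕ) (hM : ∑ l, m l = M)
    (i : Fin k) (j : Fin (n i)) (t : Fin (m (block n hN i j))) :
    block m hM (block n hN i j) t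
      = block (fun i => ∑ j, m (block n hN i j)) (sum_block n hN m hM) i
          (block (fun j => m (block n hN i j)) rfl j t) := by
  ext
  rw [block_val, block_val, block_val, block_val, psum_sum_block n hN m i.2.le,
    psum_add n hN m i j.2.le, add_assoc]

theorem prod_block {X : Type*} [CommMonoid X] (n : Fin k → ℕ) (hN : ∑ i, n i = N) (F : Fin N → X) :
    ∏ r, F r = ∏ i, ∏ j, F (block n hN i j) := by
  subst hN
  rw [← Fintype.prod_sigma']
  exact (Fintype.prod_equiv finSigmaFinEquiv _ _ fun _ => rfl).symm

end Blocks

/-! ### The systems of dendriform dialgebras and trialgebras -/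

theorem blockIndex_blockIndex {k N M : ℕ} (n : Fin k → ℕ) (hN : ∑ i, n i = N) (m : Fin N → ℕ)
    (hM : ∑ l, m l = M) (r : Fin M) :
    blockIndex n hN (blockIndex m hM r)
      = blockIndex (fun i => ∑ j, m (block n hN i j)) (sum_block n hN m hM) r := by
  set l := blockIndex m hM r with hl
  refine (blockIndex_eq _ ?_ ?_).symm
  · rw [psum_sum_block n hN m (blockIndex n hN l).2.le]
    exact (psum_mono m (psum_blockIndex_le n hN l)).trans (psum_blockIndex_le m hM r)
  · rw [psum_sum_block n hN m (blockIndex n hN l).2]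
    exact (lt_psum_blockIndex_succ m hM r).trans_le
      (psum_mono m (lt_psum_blockIndex_succ n hN l))

theorem clamp_blockIndex {k N M : ℕ} (n : Fin k → ℕ) (hn : ∀ i, 0 < n i) (hN : ∑ i, n i = N)
    (m : Fin N → ℕ) (hm : ∀ l, 0 < m l) (hM : ∑ l, m l = M) (r : Fin M) (i : Fin k) :
    clamp n hn i (blockIndex m hM r)
      = blockIndex (fun j => m (block n hN i j)) rfl
          (clamp (fun i => ∑ j, m (block n hN i j)) (sum_block_pos n hn hN m hm) i r) := by
  have h₁ := psum_blockIndex_le m hM r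
  have h₂ := lt_psum_blockIndex_succ m hM r
  set l := blockIndex m hM r with hl
  have hT : ∑ j, m (block n hN i j) = psum (fun j => m (block n hN i j)) (n i) := (psum_top _).symm
  have hc := clamp_val n hn i l
  generalize clamp n hn i l = c at hc ⊢
  have e₀ := psum_add n hN m i le_rfl
  have e₁ := psum_add n hN m i c.2.le
  have e₂ := psum_succ (fun j => m (block n hN i j)) c
  have e₃ := psum_add n hN m i (j := c + 1) c.2
  have hmc := hm (block n hN i c)
  have hni := hn i
  have e₄ : psum (fun j => m (block n hN i j)) (c + 1) ≤ psum (fun j => m (block n hN i j)) (n i) :=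
    psum_mono _ c.2
  symm
  refine blockIndex_eq _ ?_ ?_ <;> rw [clamp_val, psum_sum_block n hN m i.2.le, hT]
  · rcases lt_or_ge (l : ℕ) (psum n i) with h | h
    · have : (c : ℕ) = 0 := by omega
      rw [this, psum_zero]
      exact Nat.zero_le _
    · have := psum_mono m (show psum n i + c ≤ l by omega)
      omega
  · rcases lt_or_ge (l : ℕ) (psum n i) with h | h
    · have := psum_mono m (show (l : ℕ) + 1 ≤ psum n i by omega)
      omega
    · rcases lt_or_ge (l : ℕ) (psum n i + n i) with h' | h'
      · rw [show psum n i + ((c : ℕ) + 1) = l + 1 by omega] at e₃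
        omega
      · rw [show (c : ℕ) + 1 = n i by omega]
        omega

theorem clamp_clamp {k N M : ℕ} (n : Fin k → ℕ) (hn : ∀ i, 0 < n i) (hN : ∑ i, n i = N)
    (m : Fin N → ℕ) (hm : ∀ l, 0 < m l) (r : Fin M) (i : Fin k) (j : Fin (n i)) :
    clamp m hm (block n hN i j) r
      = clamp (fun j => m (block n hN i j)) (fun _ => hm _) j
          (clamp (fun i => ∑ j, m (block n hN i j)) (sum_block_pos n hn hN m hm) i r) := by
  have e₁ := psum_add n hN m i j.2.le
  have e₂ := psum_succ (fun j => m (block n hN i j)) j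
  have e₄ : psum (fun j => m (block n hN i j)) (j + 1) ≤ psum (fun j => m (block n hN i j)) (n i) :=
    psum_mono _ j.2
  rw [psum_top] at e₄
  ext
  rw [clamp_val, clamp_val, clamp_val, psum_sum_block n hN m i.2.le, block_val]
  omega

theorem blockIndex_one {k : ℕ} (h : ∑ _ : Fin k, 1 = k) (r : Fin k) :
    blockIndex (fun _ => 1) h r = r := by
  refine blockIndex_eq _ ?_ ?_ <;> rw [psum_one _ (by omega)]
  exact Nat.lt_succ_self _

theorem clamp_single {N : ℕ} (hN : 0 < N) (r : Fin N) :
    clamp (fun _ : Fin 1 => N) (fun _ => hN) 0 r = r := by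
  ext
  rw [clamp_val, Fin.val_zero, psum_zero]
  omega

theorem didendSystem_isPreOperadic : didendSystem.IsPreOperadic where
  identity _ _ r := blockIndex_one (by simp) r
  idempotency _ n _ hN m _ hM r := blockIndex_blockIndex n hN m hM r
  commutativity _ n hn hN m hm hM r i := clamp_blockIndex n hn hN m hm hM r i
  closure _ n hn hN m hm _ r i j := clamp_clamp n hn hN m hm r i j

theorem didendSystem_isUnital : didendSystem.IsUnital := fun _ hN r => clamp_single hN r

theorem tridendSystem_isPreOperadic : tridendSystem.IsPreOperadic where
  identity k _ X := Subtype.ext <|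
    (Finset.image_congr fun r _ => blockIndex_one (by simp) r).trans Finset.image_id
  idempotency _ n _ hN m _ hM X := Subtype.ext <| Finset.image_image.trans <|
    Finset.image_congr fun r _ => blockIndex_blockIndex n hN m hM r
  commutativity _ n hn hN m hm hM X i := Subtype.ext <| by
    simp only [tridendSystem, Finset.image_image]
    exact Finset.image_congr fun r _ => clamp_blockIndex n hn hN m hm hM r i
  closure _ n hn hN m hm _ X i j := Subtype.ext <| by
    simp only [tridendSystem, Finset.image_image]
    exact Finset.image_congr fun r _ => clamp_clamp n hn hN m hm r i j

theorem tridendSystem_isUnital : tridendSystem.IsUnital := fun _ hN _ => Subtype.ext <|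
  (Finset.image_congr fun r _ => clamp_single hN r).trans Finset.image_id

/-! ### The system of cubical trialgebras -/

theorem block_one {k : ℕ} (h : ∑ _ : Fin k, 1 = k) (i : Fin k) (t : Fin 1) :
    block (fun _ => 1) h i t = i := by
  ext
  rw [block_val, psum_one _ i.2.le]
  omega

theorem block_single {N : ℕ} (h : ∑ _ : Fin 1, N = N) (l : Fin N) :
    block (fun _ : Fin 1 => N) h 0 l = l := by
  ext
  rw [block_val, Fin.val_zero, psum_zero, zero_add]

theorem tricubSystem_isPreOperadic : tricubSystem.IsPreOperadic where
  identity k _ X := funext fun i => by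
    simp [tricubSystem, block_one]
  idempotency _ n _ hN m _ hM X := funext fun i => by
    simp only [tricubSystem, block_block n hN m hM]
    exact (prod_block (fun j => m (block n hN i j)) rfl fun t =>
      X (block _ (sum_block n hN m hM) i t)).symm
  commutativity _ n _ hN m _ hM X i := funext fun j => by
    simp only [tricubSystem, block_block n hN m hM]
  closure _ n _ hN m _ hM X i j := funext fun l => by
    simp only [tricubSystem, block_block n hN m hM]

theorem tricubSystem_isUnital : tricubSystem.IsUnital := fun _ _ X => funext fun l =>
  congrArg X (block_single _ l)

/-! ### The systems of planar trees -/

section Prune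

variable {α β δ : Type}

theorem PlanarForest.prune_ofList (g : α → Option β) (t : PlanarTree α) (l : List (PlanarTree α)) :
    (PlanarForest.ofList t l).prune g = (t :: l).flatMap fun t => (t.prune g).toList := by
  induction l generalizing t with
  | nil => simp [PlanarForest.ofList, PlanarForest.prune]
  | cons t' l ih => rw [PlanarForest.ofList, PlanarForest.prune, ih]; rfl

theorem PlanarTree.bind_graft (g : α → Option β) (l : List (PlanarTree α)) :
    (PlanarTree.graft l).bind (PlanarTree.prune g)
      = PlanarTree.graft (l.flatMap fun t => (t.prune g).toList) := by
  match l with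
  | [] => rfl
  | [t] =>
    rcases h : t.prune g with _ | t' <;> simp [PlanarTree.graft, h]
  | t :: t' :: l =>
    rw [PlanarTree.graft, Option.bind_some, PlanarTree.prune, PlanarForest.prune_ofList]
    rfl

mutual

/-- Deleting leaves in two steps amounts to deleting them at once. -/
theorem PlanarTree.prune_prune (f : α → Option β) (g : β → Option δ) : ∀ t : PlanarTree α,
    (t.prune f).bind (PlanarTree.prune g) = t.prune fun a => (f a).bind g
  | .leaf a => by
    rcases h : f a with _ | b <;> simp [PlanarTree.prune, h]
  | .node t s => by
    rw [PlanarTree.prune, PlanarTree.bind_graft, List.flatMap_append,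
      PlanarForest.prune_prune f g s, PlanarTree.prune, ← PlanarTree.prune_prune f g t]
    rcases t.prune f with _ | t' <;> simp

/-- The version of `PlanarTree.prune_prune` for forests. -/
theorem PlanarForest.prune_prune (f : α → Option β) (g : β → Option δ) : ∀ s : PlanarForest α,
    ((s.prune f).flatMap fun t => (t.prune g).toList) = s.prune fun a => (f a).bind g
  | .single t => by
    rw [PlanarForest.prune, PlanarForest.prune, ← PlanarTree.prune_prune f g t]
    rcases t.prune f with _ | t' <;> simp
  | .cons t s => by
    rw [PlanarForest.prune, PlanarForest.prune, List.flatMap_append,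
      PlanarForest.prune_prune f g s, ← PlanarTree.prune_prune f g t]
    rcases t.prune f with _ | t' <;> simp

end

mutual

theorem PlanarTree.prune_some : ∀ t : PlanarTree α, t.prune some = some t
  | .leaf a => rfl
  | .node t s => by
    obtain ⟨t', l, h, rfl⟩ := PlanarForest.prune_some s
    rw [PlanarTree.prune, PlanarTree.prune_some t, h]
    rfl

/-- Nothing is deleted from a forest; the forest is recovered from the list of its trees. -/
theorem PlanarForest.prune_some : ∀ s : PlanarForest α,
    ∃ t l, s.prune some = t :: l ∧ PlanarForest.ofList t l = s
  | .single t => ⟨t, [], by rw [PlanarForest.prune, PlanarTree.prune_some t]; rfl, rfl⟩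
  | .cons t s => by
    obtain ⟨t', l, h, rfl⟩ := PlanarForest.prune_some s
    exact ⟨t, t' :: l, by rw [PlanarForest.prune, PlanarTree.prune_some t, h]; rfl, rfl⟩

end

/-- A computable form of the deletion function of `LeafTree.keep`. -/
theorem partialInv_eq {m n : ℕ} (φ : Fin m ↪o Fin n) {f : Fin n → Option (Fin m)}
    (h : ∀ a b, f a = some b ↔ φ b = a) : Function.partialInv φ = f :=
  funext fun a => Option.ext fun b => by
    rw [h]; exact φ.injective.isPartialInv b a

variable {l m n : ℕ}

theorem LeafTree.keep_eq (φ : Fin (m + 1) ↪o Fin (n + 1)) {t : LeafTree n} {t' : LeafTree m}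
    (h : t.1.prune (Function.partialInv φ) = some t'.1) : t.keep φ = t' :=
  Subtype.ext (Option.some_injective _ ((LeafTree.keep_spec φ t).symm.trans h))

theorem LeafTree.keep_keep (φ : Fin (l + 1) ↪o Fin (m + 1)) (ψ : Fin (m + 1) ↪o Fin (n + 1))
    (χ : Fin (l + 1) ↪o Fin (n + 1)) (h : ∀ a, (ψ (φ a) : ℕ) = χ a) (t : LeafTree n) :
    (t.keep ψ).keep φ = t.keep χ := by
  refine (LeafTree.keep_eq χ ?_).symm
  have e := PlanarTree.prune_prune (Function.partialInv ψ) (Function.partialInv φ) t.1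
  rw [LeafTree.keep_spec, Option.bind_some, LeafTree.keep_spec] at e
  rw [e]
  congr 1
  refine partialInv_eq χ fun a b => ?_
  rw [Option.bind_eq_some_iff]
  constructor
  · rintro ⟨c, hc, hb⟩
    rw [← (ψ.injective.isPartialInv c a).1 hc, ← (φ.injective.isPartialInv b c).1 hb]
    exact Fin.ext (h b).symm
  · rintro rfl
    exact ⟨φ b, (ψ.injective.isPartialInv _ _).2 (Fin.ext (h b)),
      (φ.injective.isPartialInv _ _).2 rfl⟩

theorem LeafTree.keep_self (φ : Fin (n + 1) ↪o Fin (n + 1)) (h : ∀ a, (φ a : ℕ) = a)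
    (t : LeafTree n) : t.keep φ = t := by
  refine LeafTree.keep_eq φ ?_
  rw [partialInv_eq φ (f := some) fun a b => ?_, PlanarTree.prune_some]
  rw [Option.some_inj, eq_comm, Fin.ext_iff, Fin.ext_iff, h]

theorem LeafTree.keep_congr {φ φ' : Fin (m + 1) ↪o Fin (n + 1)} (h : ∀ a, (φ a : ℕ) = φ' a)
    (t : LeafTree n) : t.keep φ = t.keep φ' := by
  obtain rfl : φ = φ' := by ext a; exact h a
  rfl

end Prune

section Leaves

variable {k N M : ℕ}

theorem boundaryLeaves_val (n : Fin k → ℕ) (hn : ∀ i, 0 < n i) (hN : ∑ i, n i = N)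
    (a : Fin (k + 1)) : (boundaryLeaves n hn hN a : ℕ) = psum n a := rfl

theorem intervalLeaves_val (n : Fin k → ℕ) (hN : ∑ i, n i = N) (i : Fin k)
    (a : Fin (n i + 1)) : (intervalLeaves n hN i a : ℕ) = psum n i + a := rfl

variable (n : Fin k → ℕ) (hn : ∀ i, 0 < n i) (hN : ∑ i, n i = N) (m : Fin N → ℕ)
  (hm : ∀ l, 0 < m l) (hM : ∑ l, m l = M)

theorem boundaryLeaves_boundaryLeaves (a : Fin (k + 1)) :
    (boundaryLeaves m hm hM (boundaryLeaves n hn hN a) : ℕ)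
      = boundaryLeaves (fun i => ∑ j, m (block n hN i j)) (sum_block_pos n hn hN m hm)
        (sum_block n hN m hM) a := by
  rw [boundaryLeaves_val, boundaryLeaves_val, boundaryLeaves_val,
    psum_sum_block n hN m (Nat.lt_succ_iff.1 a.2)]

theorem boundaryLeaves_intervalLeaves (i : Fin k) (a : Fin (n i + 1)) :
    (boundaryLeaves m hm hM (intervalLeaves n hN i a) : ℕ)
      = intervalLeaves (fun i => ∑ j, m (block n hN i j)) (sum_block n hN m hM) i
        (boundaryLeaves (fun j => m (block n hN i j)) (fun _ => hm _) rfl a) := by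
  rw [boundaryLeaves_val, intervalLeaves_val, intervalLeaves_val, boundaryLeaves_val,
    psum_sum_block n hN m i.2.le, psum_add n hN m i (Nat.lt_succ_iff.1 a.2)]

theorem intervalLeaves_intervalLeaves (i : Fin k) (j : Fin (n i))
    (a : Fin (m (block n hN i j) + 1)) :
    (intervalLeaves (fun i => ∑ j, m (block n hN i j)) (sum_block n hN m hM) i
        (intervalLeaves (fun j => m (block n hN i j)) rfl j a) : ℕ)
      = intervalLeaves m hM (block n hN i j) a := by
  rw [intervalLeaves_val, intervalLeaves_val, intervalLeaves_val, block_val,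
    psum_sum_block n hN m i.2.le, psum_add n hN m i j.2.le, add_assoc]

end Leaves

theorem treeSystem_isPreOperadic : treeSystem.IsPreOperadic where
  identity _ _ r := LeafTree.keep_self _ (fun a => psum_one _ (Nat.lt_succ_iff.1 a.2)) r
  idempotency _ n hn hN m hm hM r :=
    LeafTree.keep_keep _ _ _ (boundaryLeaves_boundaryLeaves n hn hN m hm hM) r
  commutativity _ n _ hN m hm hM r i :=
    (LeafTree.keep_keep _ _
      ((boundaryLeaves (fun j => m (block n hN i j)) (fun _ => hm _) rfl).trans
        (intervalLeaves (fun i => ∑ j, m (block n hN i j)) (sum_block n hN m hM) i))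
      (boundaryLeaves_intervalLeaves n hN m hm hM i) r).trans
      (LeafTree.keep_keep _ _ _ (fun _ => rfl) r).symm
  closure _ n _ hN m _ hM r i j :=
    (LeafTree.keep_keep _ _ _ (intervalLeaves_intervalLeaves n hN m hM i j) r).symm

theorem treeSystem_isUnital : treeSystem.IsUnital := fun N hN r =>
  LeafTree.keep_self _ (fun a => by rw [intervalLeaves_val, Fin.val_zero, psum_zero, zero_add]) r

theorem binTreeSystem_isPreOperadic : binTreeSystem.IsPreOperadic where
  identity k hk r := Subtype.ext (treeSystem_isPreOperadic.identity k hk r.1)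
  idempotency hk n hn hN m hm hM r :=
    Subtype.ext (treeSystem_isPreOperadic.idempotency hk n hn hN m hm hM r.1)
  commutativity hk n hn hN m hm hM r i :=
    Subtype.ext (treeSystem_isPreOperadic.commutativity hk n hn hN m hm hM r.1 i)
  closure hk n hn hN m hm hM r i j :=
    Subtype.ext (treeSystem_isPreOperadic.closure hk n hn hN m hm hM r.1 i j)

theorem binTreeSystem_isUnital : binTreeSystem.IsUnital := fun N hN r =>
  Subtype.ext (treeSystem_isUnital N hN r.1)

/-! ### The multiplications of dendriform and cubical algebras -/

section Multiplication

variable {K : Type u} {A : Type v} [Field K] [AddCommGroup A] [Module K A] {U : ℕ → Type}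
  {S : SystemData U}

/-- A `2`-cochain that consists of bilinear operations is a multiplication if the two ways to
evaluate it on three elements agree. -/
theorem isMultiplication_of_assoc (hS : S.IsPreOperadic) (hU : S.IsUnital) (π : Cochain K A U 2)
    (b : U 2 → A →ₗ[K] A →ₗ[K] A) (hb : ∀ ρ, π ρ = binary (b ρ))
    (h : ∀ (ρ : U 3) (x y z : A),
      b (S.outer (rfl : 1 + 1 = 2) (Nat.zero_le 1) ρ)
          (b (S.inner (rfl : 1 + 1 = 2) (Nat.zero_le 1) ρ) x y) z
        = b (S.outer (rfl : 1 + 1 = 2) (le_refl 1) ρ) x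
          (b (S.inner (rfl : 1 + 1 = 2) (le_refl 1) ρ) y z)) :
    IsMultiplication S π := by
  have e : insertAt S (rfl : 1 + 1 = 2) 0 π π = insertAt S (rfl : 1 + 1 = 2) 1 π π := by
    refine cochain_ext fun ρ a => ?_
    rw [ev_insertAt S rfl (Nat.zero_le 1), ev_insertAt S rfl (le_refl 1)]
    simp only [ev, hb]
    exact h ρ (a 0) (a 1) (a 2)
  rw [IsMultiplication, circ_eq hS hU, SignedOperad.circ_apply, Finset.sum_range_succ,
    Finset.sum_range_one, cochainOperad_ins, cochainOperad_ins, e]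
  simp

theorem DendriformDialgebra.mult_isMultiplication (D : DendriformDialgebra K A) :
    IsMultiplication didendSystem D.mult := by
  refine isMultiplication_of_assoc didendSystem_isPreOperadic didendSystem_isUnital _
    (fun _ => D.left + D.right) (fun _ => rfl) fun _ x y z => ?_
  have e₁ := D.left_left x y z
  have e₂ := D.right_left x y z
  have e₃ := D.right_right x y z
  simp only [LinearMap.add_apply, map_add] at *
  rw [e₁, e₂, ← e₃]
  abel

theorem DendriformTrialgebra.mult_isMultiplication (D : DendriformTrialgebra K A) :
    IsMultiplication tridendSystem D.mult := by
  refine isMultiplication_of_assoc tridendSystem_isPreOperadic tridendSystem_isUnital _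
    (fun _ => D.left + D.mid + D.right) (fun _ => rfl) fun _ x y z => ?_
  have e := D.right_right x y z
  simp only [LinearMap.add_apply, map_add] at *
  simp only [D.left_left, D.right_left, D.right_mid, D.left_mid, D.mid_left, D.mid_mid, ← e,
    map_add]
  abel

theorem CubicalTrialgebra.mult_isMultiplication (D : CubicalTrialgebra K A) :
    IsMultiplication tricubSystem D.mult := by
  refine isMultiplication_of_assoc tricubSystem_isPreOperadic tricubSystem_isUnital _
    (fun _ => D.left + D.mid + D.right) (fun _ => rfl) fun _ x y z => ?_
  simp only [LinearMap.add_apply, map_add, D.left_left, D.left_right, D.left_mid, D.right_left,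
    D.right_right, D.right_mid, D.mid_left, D.mid_right, D.mid_mid]
  abel

end Multiplication

/-! ### Trees with four leaves -/

section FourLeaves

variable {α : Type}

theorem append_eq_two {l₁ l₂ : List α} {a b : α} (h₁ : l₁ ≠ []) (h₂ : l₂ ≠ [])
    (h : l₁ ++ l₂ = [a, b]) : l₁ = [a] ∧ l₂ = [b] := by
  rcases l₁ with _ | ⟨x, _ | ⟨y, l⟩⟩ <;> simp_all

theorem append_eq_three {l₁ l₂ : List α} {a b c : α} (h₁ : l₁ ≠ []) (h₂ : l₂ ≠ [])
    (h : l₁ ++ l₂ = [a, b, c]) : l₁ = [a] ∧ l₂ = [b, c] ∨ l₁ = [a, b] ∧ l₂ = [c] := by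
  rcases l₁ with _ | ⟨x, _ | ⟨y, _ | ⟨z, l⟩⟩⟩ <;> simp_all

theorem append_eq_four {l₁ l₂ : List α} {a b c d : α} (h₁ : l₁ ≠ []) (h₂ : l₂ ≠ [])
    (h : l₁ ++ l₂ = [a, b, c, d]) :
    l₁ = [a] ∧ l₂ = [b, c, d] ∨ l₁ = [a, b] ∧ l₂ = [c, d] ∨ l₁ = [a, b, c] ∧ l₂ = [d] := by
  rcases l₁ with _ | ⟨x, _ | ⟨y, _ | ⟨z, _ | ⟨w, l⟩⟩⟩⟩ <;> simp_all

mutual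

theorem PlanarTree.leaves_ne_nil : ∀ t : PlanarTree α, t.leaves ≠ []
  | .leaf a => by simp [PlanarTree.leaves]
  | .node t s => by simp [PlanarTree.leaves, PlanarTree.leaves_ne_nil t]

theorem PlanarForest.leaves_ne_nil : ∀ s : PlanarForest α, s.leaves ≠ []
  | .single t => by simp [PlanarForest.leaves, PlanarTree.leaves_ne_nil t]
  | .cons t s => by simp [PlanarForest.leaves, PlanarTree.leaves_ne_nil t]

end

open PlanarTree PlanarForest

theorem PlanarTree.eq_of_leaves_one {t : PlanarTree α} {a : α} (h : t.leaves = [a]) :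
    t = leaf a := by
  cases t with
  | leaf b => simpa [PlanarTree.leaves] using h
  | node t s =>
    have h₁ := PlanarTree.leaves_ne_nil t
    have h₂ := PlanarForest.leaves_ne_nil s
    simp [PlanarTree.leaves, List.append_eq_cons_iff, h₁, h₂] at h

theorem PlanarForest.eq_of_leaves_one {s : PlanarForest α} {a : α} (h : s.leaves = [a]) :
    s = single (leaf a) := by
  cases s with
  | single t => rw [PlanarTree.eq_of_leaves_one (t := t) (a := a) h]
  | cons t s =>
    have h₁ := PlanarTree.leaves_ne_nil t
    have h₂ := PlanarForest.leaves_ne_nil s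
    simp [PlanarForest.leaves, List.append_eq_cons_iff, h₁, h₂] at h

theorem PlanarTree.eq_of_leaves_two {t : PlanarTree α} {a b : α} (h : t.leaves = [a, b]) :
    t = node (leaf a) (single (leaf b)) := by
  cases t with
  | leaf c => simp [PlanarTree.leaves] at h
  | node t s =>
    replace h := append_eq_two (PlanarTree.leaves_ne_nil t) (PlanarForest.leaves_ne_nil s) h
    rw [PlanarTree.eq_of_leaves_one h.1, PlanarForest.eq_of_leaves_one h.2]

theorem PlanarForest.eq_of_leaves_two {s : PlanarForest α} {a b : α} (h : s.leaves = [a, b]) :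
    s = single (node (leaf a) (single (leaf b))) ∨ s = cons (leaf a) (single (leaf b)) := by
  cases s with
  | single t => rw [PlanarTree.eq_of_leaves_two (t := t) h]; exact Or.inl rfl
  | cons t s =>
    replace h := append_eq_two (PlanarTree.leaves_ne_nil t) (PlanarForest.leaves_ne_nil s) h
    rw [PlanarTree.eq_of_leaves_one h.1, PlanarForest.eq_of_leaves_one h.2]
    exact Or.inr rfl

theorem PlanarTree.eq_of_leaves_three {t : PlanarTree α} {a b c : α} (h : t.leaves = [a, b, c]) :
    t = node (leaf a) (single (node (leaf b) (single (leaf c)))) ∨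
    t = node (leaf a) (cons (leaf b) (single (leaf c))) ∨
    t = node (node (leaf a) (single (leaf b))) (single (leaf c)) := by
  cases t with
  | leaf c => simp [PlanarTree.leaves] at h
  | node t s =>
    replace h := append_eq_three (PlanarTree.leaves_ne_nil t) (PlanarForest.leaves_ne_nil s) h
    rcases h with ⟨h, h'⟩ | ⟨h, h'⟩
    · rw [PlanarTree.eq_of_leaves_one h]
      rcases PlanarForest.eq_of_leaves_two h' with rfl | rfl <;> simp
    · rw [PlanarTree.eq_of_leaves_two h, PlanarForest.eq_of_leaves_one h']
      simp

theorem PlanarForest.eq_of_leaves_three {s : PlanarForest α} {a b c : α}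
    (h : s.leaves = [a, b, c]) :
    s = single (node (leaf a) (single (node (leaf b) (single (leaf c))))) ∨
    s = single (node (leaf a) (cons (leaf b) (single (leaf c)))) ∨
    s = single (node (node (leaf a) (single (leaf b))) (single (leaf c))) ∨
    s = cons (leaf a) (single (node (leaf b) (single (leaf c)))) ∨
    s = cons (leaf a) (cons (leaf b) (single (leaf c))) ∨
    s = cons (node (leaf a) (single (leaf b))) (single (leaf c)) := by
  cases s with
  | single t => rcases PlanarTree.eq_of_leaves_three (t := t) h with rfl | rfl | rfl <;> simp
  | cons t s =>
    replace h := append_eq_three (PlanarTree.leaves_ne_nil t) (PlanarForest.leaves_ne_nil s) h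
    rcases h with ⟨h, h'⟩ | ⟨h, h'⟩
    · rw [PlanarTree.eq_of_leaves_one h]
      rcases PlanarForest.eq_of_leaves_two h' with rfl | rfl <;> simp
    · rw [PlanarTree.eq_of_leaves_two h, PlanarForest.eq_of_leaves_one h']
      simp

/-- The eleven planar trees with four leaves. -/
theorem PlanarTree.eq_of_leaves_four {t : PlanarTree α} {a b c d : α}
    (h : t.leaves = [a, b, c, d]) :
    t = node (leaf a) (single (node (leaf b) (single (node (leaf c) (single (leaf d)))))) ∨
    t = node (leaf a) (single (node (leaf b) (cons (leaf c) (single (leaf d))))) ∨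
    t = node (leaf a) (single (node (node (leaf b) (single (leaf c))) (single (leaf d)))) ∨
    t = node (leaf a) (cons (leaf b) (single (node (leaf c) (single (leaf d))))) ∨
    t = node (leaf a) (cons (leaf b) (cons (leaf c) (single (leaf d)))) ∨
    t = node (leaf a) (cons (node (leaf b) (single (leaf c))) (single (leaf d))) ∨
    t = node (node (leaf a) (single (leaf b))) (single (node (leaf c) (single (leaf d)))) ∨
    t = node (node (leaf a) (single (leaf b))) (cons (leaf c) (single (leaf d))) ∨
    t = node (node (leaf a) (single (node (leaf b) (single (leaf c))))) (single (leaf d)) ∨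
    t = node (node (leaf a) (cons (leaf b) (single (leaf c)))) (single (leaf d)) ∨
    t = node (node (node (leaf a) (single (leaf b))) (single (leaf c))) (single (leaf d)) := by
  cases t with
  | leaf c => simp [PlanarTree.leaves] at h
  | node t s =>
    replace h := append_eq_four (PlanarTree.leaves_ne_nil t) (PlanarForest.leaves_ne_nil s) h
    rcases h with ⟨h, h'⟩ | ⟨h, h'⟩ | ⟨h, h'⟩
    · rw [PlanarTree.eq_of_leaves_one h]
      rcases PlanarForest.eq_of_leaves_three h' with rfl | rfl | rfl | rfl | rfl | rfl <;> simp
    · rw [PlanarTree.eq_of_leaves_two h]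
      rcases PlanarForest.eq_of_leaves_two h' with rfl | rfl <;> simp
    · rw [PlanarForest.eq_of_leaves_one h']
      rcases PlanarTree.eq_of_leaves_three h with rfl | rfl | rfl <;> simp

end FourLeaves

/-! ### The multiplications on trees -/

section TreeMultiplication

variable {k N t : ℕ}

theorem treeSystem_Rto (n : Fin k → ℕ) (hn : ∀ i, 0 < n i) (hN : ∑ i, n i = N) (i : Fin k)
    (h : n i = t) (ψ : Fin (t + 1) ↪o Fin (N + 1)) (hψ : ∀ a, (ψ a : ℕ) = psum n i + a)
    (ρ : LeafTree N) : treeSystem.Rto n hn hN i h ρ = ρ.keep ψ := by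
  subst h
  exact LeafTree.keep_congr (fun a => (hψ a).symm) ρ

theorem binTreeSystem_Rto (n : Fin k → ℕ) (hn : ∀ i, 0 < n i) (hN : ∑ i, n i = N) (i : Fin k)
    (h : n i = t) (ρ : BinTree N) :
    (binTreeSystem.Rto n hn hN i h ρ).1 = treeSystem.Rto n hn hN i h ρ.1 := by
  subst h
  rfl

/-- The selection of an operation by a tree with three leaves that is obtained by deletion of the
other leaves. -/
theorem select_keep {X : Type v} (x y z : X) {n : ℕ} (φ : Fin 3 ↪o Fin (n + 1))
    {f : Fin (n + 1) → Option (Fin 3)} (hf : ∀ a b, f a = some b ↔ φ b = a) (ρ : LeafTree n) :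
    PlanarTree.select x y z (ρ.keep φ).1
      = ((ρ.1.prune f).map (PlanarTree.select x y z)).getD x := by
  rw [← partialInv_eq φ hf, LeafTree.keep_spec]
  rfl

variable {X : Type v} (x y z : X) (ρ : LeafTree 3)

/-! The four lemmas that follow list the leaves that are deleted from a tree with leaves
`0, 1, 2, 3` by the functions `R` of the compositions `π ∘₀ π` and `π ∘₁ π`. -/

theorem select_outer_zero :
    PlanarTree.select x y z (treeSystem.outer (rfl : 1 + 1 = 2) (Nat.zero_le 1) ρ).1
      = ((ρ.1.prune (![some 0, none, some 1, some 2] : Fin 4 → Option (Fin 3))).map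
          (PlanarTree.select x y z)).getD x := by
  refine select_keep x y z _ (fun a b => ?_) ρ
  rw [Fin.ext_iff, boundaryLeaves_val, psum_insSizes _ _ _ _ (Nat.lt_succ_iff.1 b.2)]
  revert a b
  decide

theorem select_outer_one :
    PlanarTree.select x y z (treeSystem.outer (rfl : 1 + 1 = 2) (le_refl 1) ρ).1
      = ((ρ.1.prune (![some 0, some 1, none, some 2] : Fin 4 → Option (Fin 3))).map
          (PlanarTree.select x y z)).getD x := by
  refine select_keep x y z _ (fun a b => ?_) ρ
  rw [Fin.ext_iff, boundaryLeaves_val, psum_insSizes _ _ _ _ (Nat.lt_succ_iff.1 b.2)]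
  revert a b
  decide

theorem select_inner_zero :
    PlanarTree.select x y z (treeSystem.inner (rfl : 1 + 1 = 2) (Nat.zero_le 1) ρ).1
      = ((ρ.1.prune (![some 0, some 1, some 2, none] : Fin 4 → Option (Fin 3))).map
          (PlanarTree.select x y z)).getD x := by
  have e : treeSystem.inner (rfl : 1 + 1 = 2) (Nat.zero_le 1) ρ = ρ.keep Fin.castSuccOrderEmb :=
    treeSystem_Rto _ _ _ _ _ _ (fun a => by simp [psum_zero]) ρ
  rw [e]
  exact select_keep x y z _ (by decide) ρ

theorem select_inner_one :
    PlanarTree.select x y z (treeSystem.inner (rfl : 1 + 1 = 2) (le_refl 1) ρ).1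
      = ((ρ.1.prune (![none, some 0, some 1, some 2] : Fin 4 → Option (Fin 3))).map
          (PlanarTree.select x y z)).getD x := by
  have e : treeSystem.inner (rfl : 1 + 1 = 2) (le_refl 1) ρ = ρ.keep (Fin.succOrderEmb 3) :=
    treeSystem_Rto _ _ _ _ _ _ (fun a => by
      rw [psum_insSizes _ _ _ _ (by simp)]; simp [add_comm]) ρ
  rw [e]
  exact select_keep x y z _ (by decide) ρ

variable {K : Type u} {A : Type v} [Field K] [AddCommGroup A] [Module K A]

theorem binary_select {α : Type} (b₁ b₂ b₃ : A →ₗ[K] A →ₗ[K] A) (t : PlanarTree α) :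
    PlanarTree.select (binary b₁) (binary b₂) (binary b₃) t
      = binary (PlanarTree.select b₁ b₂ b₃ t) := by
  unfold PlanarTree.select
  split <;> rfl

/-- The eleven identities of an associative trialgebra correspond to the eleven trees with four
leaves. -/
theorem AssociativeTrialgebra.mult_isMultiplication (D : AssociativeTrialgebra K A) :
    IsMultiplication treeSystem D.mult := by
  refine isMultiplication_of_assoc treeSystem_isPreOperadic treeSystem_isUnital _
    (fun ψ => PlanarTree.select D.left D.right D.mid ψ.1) (fun ψ => binary_select _ _ _ _)
    fun ρ x y z => ?_
  simp only [select_outer_zero, select_outer_one, select_inner_zero, select_inner_one]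
  rcases PlanarTree.eq_of_leaves_four (a := (0 : Fin 4)) (b := 1) (c := 2) (d := 3) ρ.2 with
    h | h | h | h | h | h | h | h | h | h | h <;> rw [h]
  · exact D.left_left x y z
  · exact D.left_left'' x y z
  · exact D.left_left' x y z
  · exact D.mid_left x y z
  · exact D.mid_mid x y z
  · exact D.left_mid x y z
  · exact D.right_left x y z
  · exact D.right_mid x y z
  · exact D.left_right x y z
  · exact D.mid_right x y z
  · exact D.right_right x y z

/-- The five identities of a dialgebra correspond to the five binary trees with four leaves. -/
theorem Dialgebra.mult_isMultiplication (D : Dialgebra K A) :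
    IsMultiplication binTreeSystem D.mult := by
  have h₀ : (0 : MultilinearMap K (fun _ : Fin 2 => A) A) = binary 0 := rfl
  refine isMultiplication_of_assoc binTreeSystem_isPreOperadic binTreeSystem_isUnital _
    (fun ψ => PlanarTree.select D.left D.right 0 ψ.1.1)
    (fun ψ => by rw [Dialgebra.mult, h₀, binary_select]) fun ρ x y z => ?_
  have i₀ : (binTreeSystem.inner (rfl : 1 + 1 = 2) (Nat.zero_le 1) ρ).1
      = treeSystem.inner (rfl : 1 + 1 = 2) (Nat.zero_le 1) ρ.1 := binTreeSystem_Rto _ _ _ _ _ ρ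
  have i₁ : (binTreeSystem.inner (rfl : 1 + 1 = 2) (le_refl 1) ρ).1
      = treeSystem.inner (rfl : 1 + 1 = 2) (le_refl 1) ρ.1 := binTreeSystem_Rto _ _ _ _ _ ρ
  have o₀ : (binTreeSystem.outer (rfl : 1 + 1 = 2) (Nat.zero_le 1) ρ).1
      = treeSystem.outer (rfl : 1 + 1 = 2) (Nat.zero_le 1) ρ.1 := rfl
  have o₁ : (binTreeSystem.outer (rfl : 1 + 1 = 2) (le_refl 1) ρ).1
      = treeSystem.outer (rfl : 1 + 1 = 2) (le_refl 1) ρ.1 := rfl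
  simp only [i₀, i₁, o₀, o₁, select_outer_zero, select_outer_one, select_inner_zero,
    select_inner_one]
  have hb := ρ.2
  rcases PlanarTree.eq_of_leaves_four (a := (0 : Fin 4)) (b := 1) (c := 2) (d := 3) ρ.1.2 with
    h | h | h | h | h | h | h | h | h | h | h <;> rw [h] at hb ⊢ <;>
    simp only [PlanarTree.IsBinary, PlanarForest.IsBinarySingle, and_false, false_and] at hb
  · exact D.left_left x y z
  · exact D.left_left' x y z
  · exact D.right_left x y z
  · exact D.left_right x y z
  · exact D.right_right x y z

end TreeMultiplication

end Loday

end

theorem mainTheorem4 {K : Type*} [Field K] {A : Type*} [AddCommGroup A] [Module K A] :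
    (∀ D : Loday.Dialgebra K A, Loday.InducesGAlgebra Loday.binTreeSystem D.mult) ∧
    (∀ D : Loday.DendriformDialgebra K A, Loday.InducesGAlgebra Loday.didendSystem D.mult) ∧
    (∀ D : Loday.AssociativeTrialgebra K A, Loday.InducesGAlgebra Loday.treeSystem D.mult) ∧
    (∀ D : Loday.DendriformTrialgebra K A, Loday.InducesGAlgebra Loday.tridendSystem D.mult) ∧
    (∀ D : Loday.CubicalTrialgebra K A, Loday.InducesGAlgebra Loday.tricubSystem D.mult) := by
  open Loday in
  exact
    ⟨fun D => inducesGAlgebra binTreeSystem_isPreOperadic binTreeSystem_isUnital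
        D.mult_isMultiplication,
      fun D => inducesGAlgebra didendSystem_isPreOperadic didendSystem_isUnital
        D.mult_isMultiplication,
      fun D => inducesGAlgebra treeSystem_isPreOperadic treeSystem_isUnital
        D.mult_isMultiplication,
      fun D => inducesGAlgebra tridendSystem_isPreOperadic tridendSystem_isUnital
        D.mult_isMultiplication,
      fun D => inducesGAlgebra tricubSystem_isPreOperadic tricubSystem_isUnital
        D.mult_isMultiplication⟩
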